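/- Let $n\ge 1$, $V=\mathbb C^n$, $A_V=\mathbb C[w_1,\dots,w_n]$, and let $h\in A_V$ be a reduced (squarefree, in particular nonzero) polynomial that is quasi-homogeneous of degree $d\in\mathbb N$ for rational weights $(p_1,\dots,p_n)$. Assume that $D=\{h=0\}$ is a free divisor: the $A_V$-module $\mathrm{Der}(-\log D)=\{\delta\in\mathrm{Der}_{\mathbb C}(A_V) : \delta(h)\in (h)\}$ is free with a basis $\delta_1,\dots,\delta_{n-1},\chi$, where $\chi=\sum_{i=1}^n p_iw_i\partial_{w_i}$ and $\delta_i(h)=0$ for $i=1,\dots,n-1$. Assume moreover that $D$ is strongly Koszul: the symbols $h,\sigma(\delta_1),\dots,\sigma(\delta_{n-1})$, with $\sigma\bigl(\sum_j a_j\partial_{w_j}\bigr)=\sum_j a_j\xi_j$, form a regular sequence in $A_V[\xi_1,\dots,\xi_n]$. Let $\widetilde V=\mathbb C\times V$ with coordinates $w_0,w_1,\dots,w_n$, let $A_{\widetilde V}=\mathbb C[w_0,\dots,w_n]$, and let $D_{\widetilde V}=A_{\widetilde V}\langle\partial_{w_0},\dots,\partial_{w_n}\rangle$ be the ring of algebraic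 differential operators on $\widetilde V$. For $c\in\mathbb C\setminus\{0\}$ and $\beta\in\mathbb C$ put $\widetilde h=h-cw_0^d$, $\widetilde\chi=\chi+w_0\partial_{w_0}$, and $$\underline r=(\widetilde h,\delta_1,\dots,\delta_{n-1},\widetilde\chi-d\beta),\qquad N(\beta)=D_{\widetilde V}/D_{\widetilde V}\langle \widetilde h,\delta_1,\dots,\delta_{n-1},\widetilde\chi-d\beta\rangle .$$ Then the entries of $\underline r$ are linearly independent over $A_{\widetilde V}$, their $A_{\widetilde V}$-span $\widetilde L(\beta)\subset D_{\widetilde V}$ is closed under commutators (so it is a Lie–Rinehart algebra over $(\mathbb C,A_{\widetilde V})$), and the Spencer complex over $D_{\widetilde V}$ associated with $\underline r$, that is, the complex of left $D_{\widetilde V}$-modules with terms $D_{\widetilde V}\otimes_{A_{\widetilde V}}\bigwedge^e\widetilde L(\beta)$ in degree $-e$ (for $e\ge 0$) and differentials $$P\otimes(\lambda_1\wedge\cdots\wedge\lambda_e)\mapsto\sum_{i=1}^e(-1)^{i-1}P\lambda_i\otimes(\lambda_1\wedge\cdots\widehat{\lambda_i}\cdots\wedge\lambda_e)+\sum_{1\le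 i<j\le e}(-1)^{i+j}P\otimes([\lambda_i,\lambda_j]\wedge\lambda_1\wedge\cdots\widehat{\lambda_i}\cdots\widehat{\lambda_j}\cdots\wedge\lambda_e),$$ is a free resolution of the left $D_{\widetilde V}$-module $N(\beta)$, through the augmentation $D_{\widetilde V}\to N(\beta)$, $P\mapsto[P]$. -/

import Mathlib

open scoped TensorProduct

set_option linter.unusedSectionVars false

noncomputable section

namespace SpencerRes

/-! ### The modules `R ⊗_A ⋀ᵉ L` -/

section Spencer

variable (A R : Type) [CommRing A] [Ring R] [Module A R] [IsScalarTower A R R]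

/-- The ring `R` as an `(R, A)`-bimodule: `R` acts by left multiplication, and `a : A` acts by
right multiplication with its image `a • 1` in `R`. -/
def RightMod (_A R : Type) : Type := R

instance : AddCommGroup (RightMod A R) := inferInstanceAs (AddCommGroup R)

instance : Module R (RightMod A R) := inferInstanceAs (Module R R)

/-- The identity map `R → R`, with target the bimodule. -/
def toRight : R ≃ₗ[R] RightMod A R := LinearEquiv.refl R R

instance : Module A (RightMod A R) where
  smul a P := toRight A R ((toRight A R).symm P * (a • (1 : R)))
  one_smul P := by
    change (toRight A R).symm P * ((1 : A) • (1 : R)) = (toRight A R).symm P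
    rw [one_smul, mul_one]
  mul_smul a b P := by
    change (toRight A R).symm P * ((a * b) • (1 : R)) =
      ((toRight A R).symm P * (b • (1 : R))) * (a • (1 : R))
    rw [mul_assoc, smul_mul_assoc, one_mul, smul_smul, mul_comm]
  smul_zero a := zero_mul (a • (1 : R))
  smul_add a P Q := add_mul ((toRight A R).symm P) ((toRight A R).symm Q) (a • (1 : R))
  add_smul a b P := by
    change (toRight A R).symm P * ((a + b) • (1 : R)) =
      (toRight A R).symm P * (a • (1 : R)) + (toRight A R).symm P * (b • (1 : R))
    rw [add_smul, mul_add]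
  zero_smul P := by
    change (toRight A R).symm P * ((0 : A) • (1 : R)) = 0
    rw [zero_smul, mul_zero]

variable {R} in
theorem smul_toRight (a : A) (P : R) :
    a • toRight A R P = toRight A R (P * (a • (1 : R))) := rfl

instance : SMulCommClass A R (RightMod A R) where
  smul_comm a x P := mul_assoc x ((toRight A R).symm P) (a • (1 : R))

variable {A R}

/-- An `A`-submodule `L` of `R` is a Lie-Rinehart algebra over `A`, with the commutator of `R` as
bracket and with anchor `x ↦ [x, -]` on `A`. -/
structure IsLieRinehart (L : Submodule A R) : Prop where
  lie_mem : ∀ x ∈ L, ∀ y ∈ L, ⁅x, y⁆ ∈ L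
  anchor : ∀ x ∈ L, ∀ a : A, ∃ b : A, ⁅x, a • (1 : R)⁆ = b • (1 : R)

/-- The bracket of `L`. -/
def IsLieRinehart.bracket {L : Submodule A R} (hL : IsLieRinehart L) (x y : L) : L :=
  ⟨⁅(x : R), (y : R)⁆, hL.lie_mem x x.2 y y.2⟩

/-- The term `R ⊗_A ⋀ᵉ L` of the Spencer complex, in cohomological degree `-e`. It is a left
`R`-module through the left factor. -/
abbrev SpencerTerm (L : Submodule A R) (e : ℕ) : Type :=
  RightMod A R ⊗[A] (⋀[A]^e L)

/-- The element `P ⊗ (v₁ ∧ ⋯ ∧ vₑ)`. -/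
def spencerTmul {L : Submodule A R} {e : ℕ} (P : R) (v : Fin e → L) : SpencerTerm L e :=
  toRight A R P ⊗ₜ[A] exteriorPower.ιMulti A e v

theorem spencerTmul_add {L : Submodule A R} {e : ℕ} (P Q : R) (v : Fin e → L) :
    spencerTmul (P + Q) v = spencerTmul P v + spencerTmul Q v := by
  simp [spencerTmul, TensorProduct.add_tmul]

theorem spencerTmul_sub {L : Submodule A R} {e : ℕ} (P Q : R) (v : Fin e → L) :
    spencerTmul (P - Q) v = spencerTmul P v - spencerTmul Q v := by
  simp [spencerTmul, TensorProduct.sub_tmul]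

theorem smul_spencerTmul {L : Submodule A R} {e : ℕ} (Q P : R) (v : Fin e → L) :
    Q • spencerTmul P v = spencerTmul (Q * P) v := by
  simp only [spencerTmul, TensorProduct.smul_tmul']
  rfl

theorem spencerTmul_update_smul {L : Submodule A R} {e : ℕ} (P : R) (v : Fin e → L) (i : Fin e)
    (a : A) (x : L) :
    spencerTmul P (Function.update v i (a • x)) =
      spencerTmul (P * (a • (1 : R))) (Function.update v i x) := by
  unfold spencerTmul
  rw [AlternatingMap.map_update_smul, ← TensorProduct.smul_tmul, smul_toRight]

theorem spencerTmul_cons_smul {L : Submodule A R} {e : ℕ} (P : R) (w : Fin e → L)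
    (a : A) (x : L) :
    spencerTmul (e := e + 1) P (Fin.cons (a • x) w) =
      spencerTmul (e := e + 1) (P * (a • (1 : R))) (Fin.cons x w) := by
  have h := spencerTmul_update_smul P (Fin.cons x w : Fin (e + 1) → L) 0 a x
  simpa only [Fin.update_cons_zero] using h

theorem spencerTmul_cons_cons_smul {L : Submodule A R} {e : ℕ} (P : R) (w : Fin e → L)
    (a : A) (x y : L) :
    spencerTmul (e := e + 2) P (Fin.cons y (Fin.cons (a • x) w : Fin (e + 1) → L)) =
      spencerTmul (e := e + 2) (P * (a • (1 : R)))
        (Fin.cons y (Fin.cons x w : Fin (e + 1) → L)) := by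
  have h := spencerTmul_update_smul P
    (Fin.cons y (Fin.cons x w : Fin (e + 1) → L) : Fin (e + 2) → L) (Fin.succ 0) a x
  simpa only [← Fin.cons_update, Fin.update_cons_zero] using h

theorem spencerTmul_cons_sub {L : Submodule A R} {e : ℕ} (P : R) (w : Fin e → L) (x y : L) :
    spencerTmul (e := e + 1) P (Fin.cons (x - y) w) =
      spencerTmul (e := e + 1) P (Fin.cons x w) - spencerTmul (e := e + 1) P (Fin.cons y w) := by
  have h := (exteriorPower.ιMulti A (e + 1) (M := L)).map_update_sub (Fin.cons x w) 0 x y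
  simp only [Fin.update_cons_zero] at h
  simp only [spencerTmul, h, TensorProduct.tmul_sub]

/-- Two left `R`-linear maps on `R ⊗_A ⋀ᵉ L` that agree on all `P ⊗ (v₁ ∧ ⋯ ∧ vₑ)` are equal. -/
theorem spencerTerm_hom_ext {L : Submodule A R} {e : ℕ} {T : Type} [AddCommGroup T] [Module R T]
    {f g : SpencerTerm L e →ₗ[R] T}
    (h : ∀ (P : R) (v : Fin e → L), f (spencerTmul P v) = g (spencerTmul P v)) : f = g := by
  ext t
  induction t using TensorProduct.induction_on with
  | zero => simp
  | add x y hx hy => rw [map_add, map_add, hx, hy]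
  | tmul P ω =>
    have hω : ω ∈ Submodule.span A (Set.range (exteriorPower.ιMulti A e (M := L))) := by
      rw [exteriorPower.ιMulti_span]; trivial
    induction hω using Submodule.span_induction generalizing P with
    | mem x hx =>
      obtain ⟨v, rfl⟩ := hx
      exact h P v
    | zero => simp
    | add x y _ _ hx hy => rw [TensorProduct.tmul_add, map_add, map_add, hx, hy]
    | smul a x _ hx => rw [← TensorProduct.smul_tmul]; exact hx _

/-- Extension of an alternating map on `L` to a left `R`-linear map on `R ⊗_A ⋀ᵉ L`. -/
theorem exists_spencer_lift {L : Submodule A R} {e : ℕ} {T : Type} [AddCommGroup T] [Module R T]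
    (F : L [⋀^Fin e]→ₗ[ℤ] T)
    (hF : ∀ (v : Fin e → L) (i : Fin e) (a : A) (x : L),
      F (Function.update v i (a • x)) = (a • (1 : R)) • F (Function.update v i x)) :
    ∃ d : SpencerTerm L e →ₗ[R] T, ∀ (P : R) (v : Fin e → L), d (spencerTmul P v) = P • F v := by
  let ι : A →+* R :=
    { toFun := fun a => a • (1 : R)
      map_one' := one_smul _ _
      map_mul' := fun a b => by rw [smul_mul_assoc, one_mul, smul_smul]
      map_zero' := zero_smul _ _
      map_add' := fun a b => add_smul _ _ _ }
  let _ : Module A T := Module.compHom T ι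
  let F' : L [⋀^Fin e]→ₗ[A] T :=
    { toFun := F
      map_update_add' := fun {inst} v i x y => by
        have : inst = instDecidableEqFin e := Subsingleton.elim _ _
        subst this
        exact F.map_update_add v i x y
      map_update_smul' := fun {inst} v i a x => by
        have : inst = instDecidableEqFin e := Subsingleton.elim _ _
        subst this
        exact hF v i a x
      map_eq_zero_of_eq' := F.map_eq_zero_of_eq' }
  let g : (⋀[A]^e L) →ₗ[A] T := exteriorPower.alternatingMapLinearEquiv F'
  have hg : ∀ v, g (exteriorPower.ιMulti A e v) = F v := fun v =>
    exteriorPower.alternatingMapLinearEquiv_apply_ιMulti F' v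
  let b : RightMod A R →+ (⋀[A]^e L) →+ T :=
    AddMonoidHom.mk' (fun P => AddMonoidHom.mk' (fun ω => ((toRight A R).symm P) • g ω)
      (fun x y => by rw [map_add, smul_add]))
      (fun P Q => by ext ω; simp [add_smul])
  have hb : ∀ (a : A) (P : RightMod A R) (ω : ⋀[A]^e L), b (a • P) ω = b P (a • ω) := by
    intro a P ω
    change ((toRight A R).symm P * (a • (1 : R))) • g ω = (toRight A R).symm P • g (a • ω)
    rw [map_smul, mul_smul]
    rfl
  let D : SpencerTerm L e →+ T := TensorProduct.liftAddHom b hb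
  refine ⟨{ toFun := D, map_add' := map_add D, map_smul' := ?_ }, ?_⟩
  · intro Q t
    rw [RingHom.id_apply]
    induction t using TensorProduct.induction_on with
    | zero => simp
    | add x y hx hy => rw [smul_add, map_add, hx, hy, map_add, smul_add]
    | tmul P ω => exact mul_smul Q ((toRight A R).symm P) (g ω)
  · intro P v
    change P • g (exteriorPower.ιMulti A e v) = P • F v
    rw [hg]

/-- It is enough to check the homogeneity of an alternating map in its first argument. -/
theorem update_smul_of_cons_smul {L : Submodule A R} {e : ℕ} {T : Type} [AddCommGroup T]
    [Module R T] (F : L [⋀^Fin (e + 1)]→ₗ[ℤ] T)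
    (hF : ∀ (w : Fin e → L) (a : A) (x : L),
      F (Fin.cons (a • x) w) = (a • (1 : R)) • F (Fin.cons x w))
    (v : Fin (e + 1) → L) (i : Fin (e + 1)) (a : A) (x : L) :
    F (Function.update v i (a • x)) = (a • (1 : R)) • F (Function.update v i x) := by
  have key : ∀ y : L, F (Function.update v i y) =
      (-1 : ℤ) ^ (i : ℕ) • F (Fin.cons y (i.removeNth v)) := by
    intro y
    rw [← Fin.insertNth_removeNth, AlternatingMap.map_insertNth]
    rfl
  rw [key, key, hF, smul_comm]

/-- The value of the Spencer differential on `P ⊗ (v₁ ∧ ⋯ ∧ vₑ₊₁)`. In the double sum, the pair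
`i ≤ j` stands for the pair of positions `i < j + 1` of the tuple `v`; positions are counted
from `0`, and `Fin.removeNth` omits an entry. -/
def spencerFormula {L : Submodule A R} (hL : IsLieRinehart L) :
    (e : ℕ) → R → (Fin (e + 1) → L) → SpencerTerm L e
  | 0, P, v => spencerTmul (P * (v 0 : R)) Fin.elim0
  | e + 1, P, v =>
    ∑ i : Fin (e + 2), (-1 : ℤ) ^ (i : ℕ) • spencerTmul (P * (v i : R)) (i.removeNth v) +
    ∑ i : Fin (e + 1), ∑ j ∈ Finset.Ici i, (-1 : ℤ) ^ ((i : ℕ) + ((j : ℕ) + 1)) •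
      spencerTmul P (Fin.cons (hL.bracket (v i.castSucc) (v j.succ))
        (j.removeNth (i.castSucc.removeNth v)))

theorem smul_spencerFormula {L : Submodule A R} (hL : IsLieRinehart L) (e : ℕ) (P Q : R)
    (v : Fin (e + 1) → L) :
    Q • spencerFormula hL e P v = spencerFormula hL e (Q * P) v := by
  cases e with
  | zero => simp only [spencerFormula, smul_spencerTmul, mul_assoc]
  | succ e =>
    simp only [spencerFormula, smul_add, Finset.smul_sum, smul_comm Q, smul_spencerTmul, mul_assoc]

theorem removeNth_succ_cons {α : Type} {n : ℕ} (k : Fin (n + 1)) (x : α) (w : Fin (n + 1) → α) :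
    k.succ.removeNth (Fin.cons x w : Fin (n + 2) → α) = Fin.cons x (k.removeNth w) := by
  ext i
  refine Fin.cases ?_ (fun i => ?_) i <;> simp [Fin.removeNth_apply]

theorem spencerFormula_cons_smul {L : Submodule A R} (hL : IsLieRinehart L) (e : ℕ)
    (w : Fin e → L) (a : A) (x : L) :
    spencerFormula hL e 1 (Fin.cons (a • x) w) =
      (a • (1 : R)) • spencerFormula hL e 1 (Fin.cons x w) := by
  have ha : ∀ r : R, a • r = (a • (1 : R)) * r := fun r => by rw [smul_mul_assoc, one_mul]
  cases e with
  | zero =>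
    simp only [spencerFormula, smul_spencerTmul, Fin.cons_zero, one_mul, Submodule.coe_smul]
    rw [ha]
  | succ e =>
    choose b hb using fun k : Fin (e + 1) => hL.anchor (w k) (w k).2 a
    have hb' : ∀ k, (w k : R) * (a • (1 : R)) = (a • (1 : R)) * (w k : R) + b k • (1 : R) := by
      intro k
      rw [← hb k, Ring.lie_def]; abel
    have hbr : ∀ k, hL.bracket (a • x) (w k) = a • hL.bracket x (w k) - b k • x := by
      intro k
      apply Subtype.ext
      change ⁅a • (x : R), (w k : R)⁆ = a • ⁅(x : R), (w k : R)⁆ - b k • (x : R)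
      have h1 : b k • (x : R) = (b k • (1 : R)) * x := by rw [smul_mul_assoc, one_mul]
      rw [h1, ← hb k, Ring.lie_def, Ring.lie_def, Ring.lie_def, ha (x : R), ha (_ - _)]
      generalize a • (1 : R) = a'
      noncomm_ring
    have hIci : Finset.Ici (0 : Fin (e + 1)) = Finset.univ := by ext; simp
    have hlast : ∑ i : Fin e, ∑ j ∈ Finset.Ici i.succ,
          (-1 : ℤ) ^ ((i : ℕ) + 1 + ((j : ℕ) + 1)) •
            spencerTmul 1 (Fin.cons (hL.bracket ((Fin.cons (a • x) w : Fin (e + 2) → L)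
              i.succ.castSucc) (w j))
              (j.removeNth (i.succ.castSucc.removeNth (Fin.cons (a • x) w : Fin (e + 2) → L)))) =
        ∑ i : Fin e, ∑ j ∈ Finset.Ici i.succ,
          (-1 : ℤ) ^ ((i : ℕ) + 1 + ((j : ℕ) + 1)) •
            spencerTmul (a • (1 : R)) (Fin.cons (hL.bracket ((Fin.cons x w : Fin (e + 2) → L)
              i.succ.castSucc) (w j))
              (j.removeNth (i.succ.castSucc.removeNth (Fin.cons x w : Fin (e + 2) → L)))) := by
      refine Finset.sum_congr rfl fun i _ => Finset.sum_congr rfl fun j hj => ?_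
      congr 1
      cases e with
      | zero => exact i.elim0
      | succ e =>
        obtain ⟨j, rfl⟩ := Fin.exists_succ_eq.2 (show j ≠ 0 by
          rintro rfl
          simp at hj)
        rw [← Fin.succ_castSucc, removeNth_succ_cons, removeNth_succ_cons, removeNth_succ_cons,
          removeNth_succ_cons, spencerTmul_cons_cons_smul, Fin.cons_succ, Fin.cons_succ, one_mul]
    have h1 : ∀ y : L, ∑ i : Fin (e + 2), (-1 : ℤ) ^ (i : ℕ) •
          spencerTmul ((Fin.cons y w : Fin (e + 2) → L) i : R)
            (i.removeNth (Fin.cons y w : Fin (e + 2) → L)) =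
        spencerTmul (y : R) w + ∑ k : Fin (e + 1), (-1 : ℤ) ^ ((k : ℕ) + 1) •
          spencerTmul (e := e + 1) (w k : R) (Fin.cons y (k.removeNth w)) := by
      intro y
      rw [Fin.sum_univ_succ]
      simp only [removeNth_succ_cons, Fin.cons_succ, Fin.cons_zero, Fin.removeNth_zero,
        Fin.tail_cons, Fin.val_zero, Fin.val_succ, pow_zero, one_smul]
    have h2 : ∀ y : L, ∑ i : Fin (e + 1), ∑ j ∈ Finset.Ici i,
          (-1 : ℤ) ^ ((i : ℕ) + ((j : ℕ) + 1)) •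
          spencerTmul 1 (Fin.cons (hL.bracket ((Fin.cons y w : Fin (e + 2) → L) i.castSucc)
            ((Fin.cons y w : Fin (e + 2) → L) j.succ))
            (j.removeNth (i.castSucc.removeNth (Fin.cons y w : Fin (e + 2) → L)))) =
        ∑ k : Fin (e + 1), (-1 : ℤ) ^ ((k : ℕ) + 1) •
          spencerTmul (e := e + 1) 1 (Fin.cons (hL.bracket y (w k)) (k.removeNth w)) +
        ∑ i : Fin e, ∑ j ∈ Finset.Ici i.succ,
          (-1 : ℤ) ^ ((i : ℕ) + 1 + ((j : ℕ) + 1)) •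
            spencerTmul 1 (Fin.cons (hL.bracket ((Fin.cons y w : Fin (e + 2) → L)
              i.succ.castSucc) (w j))
              (j.removeNth (i.succ.castSucc.removeNth (Fin.cons y w : Fin (e + 2) → L)))) := by
      intro y
      rw [Fin.sum_univ_succ]
      simp only [hIci, Fin.cons_succ, Fin.cons_zero, Fin.castSucc_zero, Fin.removeNth_zero,
        Fin.tail_cons, Fin.val_zero, Fin.val_succ, zero_add]
    simp only [spencerFormula, one_mul]
    rw [h1, h1, h2, h2, hlast]
    simp only [Submodule.coe_smul, spencerTmul_cons_smul, hb', hbr,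
      spencerTmul_add, spencerTmul_cons_sub, smul_add, smul_sub, Finset.sum_add_distrib,
      Finset.sum_sub_distrib, one_mul, smul_spencerTmul, Finset.smul_sum,
      smul_comm (a • (1 : R)), mul_one]
    rw [ha]
    abel

/-- The alternating map `v ↦ d (1 ⊗ (v₁ ∧ ⋯ ∧ vₑ₊₁))`. -/
theorem exists_spencer_alternating [Algebra ℂ R] {L : Submodule A R} (hL : IsLieRinehart L)
    (e : ℕ) :
    ∃ F : L [⋀^Fin (e + 1)]→ₗ[ℤ] SpencerTerm L e, ∀ v, F v = spencerFormula hL e 1 v := by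
  cases e with
  | zero =>
    refine ⟨AlternatingMap.ofSubsingleton ℤ L (SpencerTerm L 0) (0 : Fin 1)
      (AddMonoidHom.mk' (fun x : L => spencerTmul (x : R) Fin.elim0) ?_).toIntLinearMap, ?_⟩
    · intro x y
      rw [Submodule.coe_add, spencerTmul_add]
    · intro v
      simp [spencerFormula]
  | succ e =>
    let G : ∀ k, R → L [⋀^Fin k]→ₗ[ℤ] SpencerTerm L k := fun k P =>
      let g := (TensorProduct.mk A (RightMod A R) (⋀[A]^k L) (toRight A R P)).compAlternatingMap
        (exteriorPower.ιMulti A k)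
      { g.toMultilinearMap.restrictScalars ℤ with map_eq_zero_of_eq' := g.map_eq_zero_of_eq' }
    have hG : ∀ k P v, G k P v = spencerTmul P v := fun k P v => rfl
    let f₁ : L →ₗ[ℤ] L [⋀^Fin (e + 1)]→ₗ[ℤ] SpencerTerm L (e + 1) :=
      (AddMonoidHom.mk' (fun x : L => G (e + 1) (x : R)) (fun x y => by
        ext v
        simp [hG, spencerTmul_add])).toIntLinearMap
    let br : L →ₗ[ℤ] L →ₗ[ℤ] L :=
      (AddMonoidHom.mk' (fun x : L => (AddMonoidHom.mk' (fun y : L => hL.bracket x y)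
        (fun y z => Subtype.ext (by simp [IsLieRinehart.bracket, Ring.lie_def]; noncomm_ring))).toIntLinearMap)
        (fun x y => by
          ext z
          simp [IsLieRinehart.bracket, Ring.lie_def]
          noncomm_ring)).toIntLinearMap
    let f₂ : L →ₗ[ℤ] L →ₗ[ℤ] L [⋀^Fin e]→ₗ[ℤ] SpencerTerm L (e + 1) :=
      LinearMap.compr₂ br (G (e + 1) 1).curryLeft
    have hf₂ : ∀ x y v, f₂ x y v =
      spencerTmul (e := e + 1) 1 (Fin.cons (hL.bracket x y) v) := fun x y v => rfl
    have hskew : ∀ x y v, f₂ y x v = - f₂ x y v := by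
      intro x y v
      have : br y x = - br x y := by
        apply Subtype.ext
        change ⁅(y : R), (x : R)⁆ = -⁅(x : R), (y : R)⁆
        rw [Ring.lie_def, Ring.lie_def, neg_sub]
      change (G (e + 1) 1).curryLeft (br y x) v = - (G (e + 1) 1).curryLeft (br x y) v
      rw [this, map_neg]; rfl
    refine ⟨AlternatingMap.alternatizeUncurryFin f₁ - (algebraMap ℂ R (1 / 2)) •
      AlternatingMap.alternatizeUncurryFin (AlternatingMap.alternatizeUncurryFinLM ∘ₗ f₂), ?_⟩
    intro v
    rw [AlternatingMap.sub_apply, AlternatingMap.smul_apply,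
      AlternatingMap.alternatizeUncurryFin_alternatizeUncurryFinLM_comp_apply,
      AlternatingMap.alternatizeUncurryFin_apply]
    rw [sub_eq_add_neg]
    simp only [spencerFormula, one_mul]
    congr 1
    have half : ∀ t : SpencerTerm L (e + 1), (algebraMap ℂ R (1 / 2)) • (t + t) = t := by
      intro t
      rw [← two_smul R t, smul_smul, show (2 : R) = algebraMap ℂ R 2 from (map_ofNat _ 2).symm, ← map_mul]
      norm_num
    rw [Finset.smul_sum, ← Finset.sum_neg_distrib]
    refine Finset.sum_congr rfl fun i _ => ?_
    rw [Finset.smul_sum, ← Finset.sum_neg_distrib]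
    refine Finset.sum_congr rfl fun j _ => ?_
    rw [hskew (v i.castSucc) (v j.succ), sub_neg_eq_add, smul_comm, half, hf₂, ← add_assoc, pow_succ, mul_neg_one, neg_smul]

/-- There is exactly one left `R`-linear map `R ⊗_A ⋀ᵉ⁺¹ L → R ⊗_A ⋀ᵉ L` with the values given by
the formula of the Spencer differential. -/
theorem existsUnique_spencerDiff [Algebra ℂ R] {L : Submodule A R} (hL : IsLieRinehart L)
    (e : ℕ) :
    ∃! d : SpencerTerm L (e + 1) →ₗ[R] SpencerTerm L e,
      ∀ (P : R) (v : Fin (e + 1) → L), d (spencerTmul P v) = spencerFormula hL e P v := by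
  obtain ⟨F, hF⟩ := exists_spencer_alternating hL e
  obtain ⟨d, hd⟩ := exists_spencer_lift F (update_smul_of_cons_smul F (fun w a x => by
    rw [hF, hF, spencerFormula_cons_smul]))
  refine ⟨d, fun P v => ?_, fun d' hd' => spencerTerm_hom_ext fun P v => ?_⟩
  · rw [hd, hF, smul_spencerFormula, mul_one]
  · rw [hd', hd, hF, smul_spencerFormula, mul_one]

/-- The differential `R ⊗_A ⋀ᵉ⁺¹ L → R ⊗_A ⋀ᵉ L` of the Spencer complex: the left `R`-linear map
given by `spencerFormula`. -/
def spencerDiff [Algebra ℂ R] {L : Submodule A R} (hL : IsLieRinehart L) (e : ℕ) :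
    SpencerTerm L (e + 1) →ₗ[R] SpencerTerm L e :=
  (existsUnique_spencerDiff hL e).choose

theorem spencerDiff_apply [Algebra ℂ R] {L : Submodule A R} (hL : IsLieRinehart L) (e : ℕ)
    (P : R) (v : Fin (e + 1) → L) :
    spencerDiff hL e (spencerTmul P v) = spencerFormula hL e P v :=
  (existsUnique_spencerDiff hL e).choose_spec.1 P v

theorem existsUnique_spencerAug {L : Submodule A R} (I : Submodule R R) :
    ∃! ε : SpencerTerm L 0 →ₗ[R] R ⧸ I,
      ∀ (P : R) (v : Fin 0 → L), ε (spencerTmul P v) = I.mkQ P := by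
  obtain ⟨d, hd⟩ := exists_spencer_lift (L := L) (e := 0)
    (AlternatingMap.constOfIsEmpty ℤ L (Fin 0) (I.mkQ (1 : R))) (fun _ i => i.elim0)
  have hd' : ∀ (P : R) (v : Fin 0 → L), d (spencerTmul P v) = I.mkQ P := by
    intro P v
    rw [hd]
    change P • I.mkQ 1 = I.mkQ P
    rw [← map_smul, smul_eq_mul, mul_one]
  exact ⟨d, hd', fun f hf => spencerTerm_hom_ext fun P v => by rw [hf, hd']⟩

/-- The augmentation `R = R ⊗_A ⋀⁰ L → R / I`, sending `P ⊗ 1` to the class of `P`. -/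
def spencerAug (L : Submodule A R) (I : Submodule R R) : SpencerTerm L 0 →ₗ[R] R ⧸ I :=
  (existsUnique_spencerAug (L := L) I).choose

theorem spencerAug_apply (L : Submodule A R) (I : Submodule R R) (P : R) (v : Fin 0 → L) :
    spencerAug L I (spencerTmul P v) = I.mkQ P :=
  (existsUnique_spencerAug (L := L) I).choose_spec.1 P v

end Spencer

/-- The complex `⋯ → T 2 → T 1 → T 0` of left `R`-modules, with augmentation `ε : T 0 → N`, is a
free resolution of `N`. -/
structure IsFreeResolution {R : Type} [Ring R] {T : ℕ → Type} [∀ e, AddCommGroup (T e)]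
    [∀ e, Module R (T e)] (d : ∀ e, T (e + 1) →ₗ[R] T e) {N : Type} [AddCommGroup N] [Module R N]
    (ε : T 0 →ₗ[R] N) : Prop where
  free : ∀ e, Module.Free R (T e)
  exact : ∀ e, Function.Exact (d (e + 1)) (d e)
  exact_augmentation : Function.Exact (d 0) ε
  surjective : Function.Surjective ε

/-! ### The ring of differential operators on affine space -/

open MvPolynomial

/-- The ring of algebraic differential operators of affine `N`-space over `ℂ`: the algebra of
endomorphisms of `ℂ[x₁, …, x_N]` generated by the multiplications by polynomials and by the partial
derivatives. -/
def weylSubalgebra (N : ℕ) : Subalgebra ℂ (Module.End ℂ (MvPolynomial (Fin N) ℂ)) :=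
  Algebra.adjoin ℂ
    (Set.range (fun a : MvPolynomial (Fin N) ℂ => LinearMap.mulLeft ℂ a) ∪
      Set.range (fun i : Fin N =>
        ((pderiv i : Derivation ℂ (MvPolynomial (Fin N) ℂ) (MvPolynomial (Fin N) ℂ)) :
          MvPolynomial (Fin N) ℂ →ₗ[ℂ] MvPolynomial (Fin N) ℂ)))

/-- The ring of algebraic differential operators of affine `N`-space over `ℂ`. -/
def Weyl (N : ℕ) : Type := weylSubalgebra N

instance (N : ℕ) : Ring (Weyl N) := inferInstanceAs (Ring (weylSubalgebra N))

instance (N : ℕ) : Algebra ℂ (Weyl N) := inferInstanceAs (Algebra ℂ (weylSubalgebra N))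

/-- The endomorphism of the polynomial ring that underlies a differential operator. -/
def Weyl.toEnd {N : ℕ} (P : Weyl N) : Module.End ℂ (MvPolynomial (Fin N) ℂ) := P.1

theorem smul_mem_weyl {N : ℕ} (a : MvPolynomial (Fin N) ℂ)
    (P : Module.End ℂ (MvPolynomial (Fin N) ℂ)) (hP : P ∈ weylSubalgebra N) :
    a • P ∈ weylSubalgebra N :=
  (weylSubalgebra N).mul_mem (Algebra.subset_adjoin (Or.inl ⟨a, rfl⟩)) hP

/-- Polynomials act on differential operators by left multiplication: `(a • P) f = a * P f`. -/
instance (N : ℕ) : Module (MvPolynomial (Fin N) ℂ) (Weyl N) where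
  smul a P := ⟨a • P.toEnd, smul_mem_weyl a P.toEnd P.2⟩
  one_smul P := Subtype.ext (one_smul _ P.toEnd)
  mul_smul a b P := Subtype.ext (mul_smul a b P.toEnd)
  smul_zero a := Subtype.ext (smul_zero (A := Module.End ℂ (MvPolynomial (Fin N) ℂ)) a)
  smul_add a P Q := Subtype.ext (smul_add a P.toEnd Q.toEnd)
  add_smul a b P := Subtype.ext (add_smul a b P.toEnd)
  zero_smul P := Subtype.ext (zero_smul (MvPolynomial (Fin N) ℂ) P.toEnd)

instance (N : ℕ) : IsScalarTower (MvPolynomial (Fin N) ℂ) (Weyl N) (Weyl N) where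
  smul_assoc _ _ _ := rfl

/-- A polynomial as a differential operator of order `0`. -/
def opOfPoly {N : ℕ} (a : MvPolynomial (Fin N) ℂ) : Weyl N :=
  ⟨LinearMap.mulLeft ℂ a, Algebra.subset_adjoin (Or.inl ⟨a, rfl⟩)⟩

theorem derivation_mem_weyl {N : ℕ}
    (δ : Derivation ℂ (MvPolynomial (Fin N) ℂ) (MvPolynomial (Fin N) ℂ)) :
    (δ : Module.End ℂ (MvPolynomial (Fin N) ℂ)) ∈ weylSubalgebra N := by
  have hsum : ∀ (D : Fin N → Derivation ℂ (MvPolynomial (Fin N) ℂ) (MvPolynomial (Fin N) ℂ))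
      (f : MvPolynomial (Fin N) ℂ), (∑ i, D i) f = ∑ i, D i f := by
    intro D f
    rw [← Derivation.coeFnAddMonoidHom_apply, map_sum, Finset.sum_apply]
    rfl
  have h : δ = ∑ i, δ (X i) • pderiv i := by
    apply MvPolynomial.derivation_ext
    intro j
    rw [hsum, Finset.sum_eq_single j]
    · simp
    · intro i _ hij
      simp [pderiv_X_of_ne hij.symm]
    · simp
  have h2 : (δ : Module.End ℂ (MvPolynomial (Fin N) ℂ)) = ∑ i, δ (X i) •
      ((pderiv i : Derivation ℂ (MvPolynomial (Fin N) ℂ) (MvPolynomial (Fin N) ℂ)) :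
        Module.End ℂ (MvPolynomial (Fin N) ℂ)) := by
    refine LinearMap.ext fun f => ?_
    rw [LinearMap.sum_apply]
    exact (congrArg (fun D => D f) h).trans (hsum _ f)
  rw [h2]
  exact Subalgebra.sum_mem _ fun i _ =>
    smul_mem_weyl _ _ (Algebra.subset_adjoin (Or.inr ⟨i, rfl⟩))

/-- A vector field as a differential operator of order `1`. -/
def opOfDer {N : ℕ} (δ : Derivation ℂ (MvPolynomial (Fin N) ℂ) (MvPolynomial (Fin N) ℂ)) : Weyl N :=
  ⟨(δ : Module.End ℂ (MvPolynomial (Fin N) ℂ)), derivation_mem_weyl δ⟩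

/-! ### Logarithmic vector fields and the deformed operators -/

/-- The module `Der(-log D)` of the vector fields `δ` with `δ(h) ∈ (h)`, for `D = {h = 0}`. -/
def logDer {N : ℕ} (h : MvPolynomial (Fin N) ℂ) :
    Submodule (MvPolynomial (Fin N) ℂ)
      (Derivation ℂ (MvPolynomial (Fin N) ℂ) (MvPolynomial (Fin N) ℂ)) where
  carrier := {δ | h ∣ δ h}
  zero_mem' := dvd_zero h
  add_mem' := fun ha hb => dvd_add ha hb
  smul_mem' := fun a _ hδ => dvd_mul_of_dvd_right hδ a

/-- The weighted Euler vector field `∑ pᵢ wᵢ ∂ᵢ`. -/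
def eulerDer {N : ℕ} (p : Fin N → ℚ) :
    Derivation ℂ (MvPolynomial (Fin N) ℂ) (MvPolynomial (Fin N) ℂ) :=
  mkDerivation ℂ fun i => C (p i : ℂ) * X i

/-- The symbol `∑ δ(wᵢ) ξᵢ` of the vector field `δ = ∑ δ(wᵢ) ∂ᵢ` in the graded ring
`ℂ[w₁, …, w_N][ξ₁, …, ξ_N]` of the order filtration. -/
def symbol {N : ℕ} (δ : Derivation ℂ (MvPolynomial (Fin N) ℂ) (MvPolynomial (Fin N) ℂ)) :
    MvPolynomial (Fin N) (MvPolynomial (Fin N) ℂ) :=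
  ∑ i, C (δ (X i)) * X i

/-- The strong Koszul condition: the symbols of `h, δ₁, δ₂, …` form a regular sequence in the
graded ring of the order filtration. -/
def StronglyKoszul {N m : ℕ} (h : MvPolynomial (Fin N) ℂ)
    (δ : Fin m → Derivation ℂ (MvPolynomial (Fin N) ℂ) (MvPolynomial (Fin N) ℂ)) : Prop :=
  RingTheory.Sequence.IsRegular (MvPolynomial (Fin N) (MvPolynomial (Fin N) ℂ))
    (C h :: List.ofFn fun i => symbol (δ i))

/-- The polynomial `h - c w₀ᵈ` on `ℂ × V`. The coordinates of `ℂ × V` are `w₀ = X 0` and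
`wᵢ = X i.succ`. -/
def hTilde {N : ℕ} (h : MvPolynomial (Fin N) ℂ) (c : ℂ) (d : ℕ) : MvPolynomial (Fin (N + 1)) ℂ :=
  rename Fin.succ h - C c * X 0 ^ d

/-- A vector field on `V`, regarded as a vector field on `ℂ × V` without `∂₀`-component. -/
def liftDer {N : ℕ} (δ : Derivation ℂ (MvPolynomial (Fin N) ℂ) (MvPolynomial (Fin N) ℂ)) :
    Derivation ℂ (MvPolynomial (Fin (N + 1)) ℂ) (MvPolynomial (Fin (N + 1)) ℂ) :=
  mkDerivation ℂ (Fin.cons 0 fun i => rename Fin.succ (δ (X i)))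

/-- The vector field `χ + w₀ ∂₀` on `ℂ × V`, where `χ` is the weighted Euler vector field. -/
def chiTilde {N : ℕ} (p : Fin N → ℚ) :
    Derivation ℂ (MvPolynomial (Fin (N + 1)) ℂ) (MvPolynomial (Fin (N + 1)) ℂ) :=
  liftDer (eulerDer p) + (X 0 : MvPolynomial (Fin (N + 1)) ℂ) • pderiv 0

/-- The sequence of differential operators `h - c w₀ᵈ, δ₁, …, δₘ, χ + w₀ ∂₀ - d β` on `ℂ × V`. -/
def gens {N m : ℕ} (h : MvPolynomial (Fin N) ℂ) (p : Fin N → ℚ) (d : ℕ)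
    (δ : Fin m → Derivation ℂ (MvPolynomial (Fin N) ℂ) (MvPolynomial (Fin N) ℂ)) (c β : ℂ) :
    Fin (m + 2) → Weyl (N + 1) :=
  Fin.cons (opOfPoly (hTilde h c d))
    (Fin.snoc (fun i => opOfDer (liftDer (δ i)))
      (opOfDer (chiTilde p) - algebraMap ℂ (Weyl (N + 1)) (d * β)) : Fin (m + 1) → Weyl (N + 1))

/-- The module generated by `gens` over the polynomials on `ℂ × V`. -/
abbrev lieGens {N m : ℕ} (h : MvPolynomial (Fin N) ℂ) (p : Fin N → ℚ) (d : ℕ)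
    (δ : Fin m → Derivation ℂ (MvPolynomial (Fin N) ℂ) (MvPolynomial (Fin N) ℂ)) (c β : ℂ) :
    Submodule (MvPolynomial (Fin (N + 1)) ℂ) (Weyl (N + 1)) :=
  Submodule.span _ (Set.range (gens h p d δ c β))

/-- The left ideal `I(β)` of differential operators on `ℂ × V` generated by `gens`. The left module
`N(β)` is the quotient `Weyl (N + 1) ⧸ idealI h p d δ c β`. -/
abbrev idealI {N m : ℕ} (h : MvPolynomial (Fin N) ℂ) (p : Fin N → ℚ) (d : ℕ)
    (δ : Fin m → Derivation ℂ (MvPolynomial (Fin N) ℂ) (MvPolynomial (Fin N) ℂ)) (c β : ℂ) :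
    Submodule (Weyl (N + 1)) (Weyl (N + 1)) :=
  Submodule.span _ (Set.range (gens h p d δ c β))

end SpencerRes

end

noncomputable section

namespace SpencerRes

/-! ### Wedge products, contractions and Lie derivatives on the total Spencer complex -/

section Total

variable {A R : Type} [CommRing A] [Ring R] [Module A R] [IsScalarTower A R R]
variable {L : Submodule A R}

/-! The Spencer complex is compared, through the order filtration, with the Koszul complex of the
symbols of the generators. Normal ordering (`normalOp`) is an additive bijection from symbols, that
is polynomials in ξ over the functions on ℂ × V, to differential operators. Since the generators r_k
are independent, it extends to a bijection `quant` from Koszul chains to the finitely supported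
elements of the total Spencer complex. To leading order, right multiplication by r_k is
multiplication by its symbol s_k, and brackets lower the degree. So, with e_k placed in the degree
of s_k, the Spencer differential is the Koszul differential plus terms of lower degree
(`diffT_sub_mem`).

If the s_k form a regular sequence, the leading part of a Spencer cycle of positive exterior degree
is a Koszul boundary (`koszul_exact`). Subtracting the matching Spencer boundary lowers the degree,
and the process ends at zero (`exists_diffT_quant_eq`). That the Spencer differential squares to
zero follows from Cartan calculus (`diffT_diffT`).

Regularity is proved in the order δ_1, …, δ_m, h - c w₀^d, χ + w₀∂₀ - dβ. On V, the strong Koszul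
condition makes h injective modulo the first k symbols of the δ_i, for each k ≤ m
(`InjMod.sup_span`). A matrix inverse to the coefficients of the logarithmic basis up to the factor
h then makes these symbols a regular sequence themselves (`injMod_symbolSeq`). On ℂ × V the
variables w₀ and ξ₀ are added: h - c w₀^d has a unit as leading coefficient in w₀, and the last
symbol is linear in ξ₀ with leading coefficient w₀, which is injective modulo the earlier entries
because h is injective modulo the symbols of the δ_i (`InjMod.X_mod`, `regularSeq_extendedSeq`).

The span is closed under brackets because the fields annihilating h are exactly the combinations of
the δ_i, and because h - c w₀^d is killed by each δ_i and is an eigenvector of χ + w₀∂₀. Properness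
of the strong Koszul sequence forces d > 0 (`degree_pos`), which enters throughout. -/

theorem spencerTerm_addHom_ext {e : ℕ} {T : Type} [AddCommGroup T]
    {f g : SpencerTerm L e →+ T}
    (h : ∀ (P : R) (v : Fin e → L), f (spencerTmul P v) = g (spencerTmul P v)) : f = g := by
  ext t
  induction t using TensorProduct.induction_on with
  | zero => simp
  | add x y hx hy => rw [map_add, map_add, hx, hy]
  | tmul P ω =>
    have hω : ω ∈ Submodule.span A (Set.range (exteriorPower.ιMulti A e (M := L))) := by
      rw [exteriorPower.ιMulti_span]; trivial
    induction hω using Submodule.span_induction generalizing P with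
    | mem x hx =>
      obtain ⟨v, rfl⟩ := hx
      exact h P v
    | zero => simp
    | add x y _ _ hx hy => rw [TensorProduct.tmul_add, map_add, map_add, hx, hy]
    | smul a x _ hx => rw [← TensorProduct.smul_tmul]; exact hx _

theorem base_smul_spencerTmul {e : ℕ} (a : A) (P : R) (v : Fin e → L) :
    a • spencerTmul P v = spencerTmul (P * (a • (1 : R))) v := by
  simp only [spencerTmul, TensorProduct.smul_tmul']
  rfl

/-- The map `P ⊗ ω ↦ P ⊗ (x ∧ ω)`. -/
def wedge (x : L) (e : ℕ) : SpencerTerm L e →ₗ[A] SpencerTerm L (e + 1) :=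
  LinearMap.lTensor (RightMod A R)
    (exteriorPower.alternatingMapLinearEquiv ((exteriorPower.ιMulti A (e + 1)).curryLeft x))

theorem wedge_tmul (x : L) {e : ℕ} (P : R) (v : Fin e → L) :
    wedge x e (spencerTmul P v) = spencerTmul (e := e + 1) P (Fin.cons x v) := by
  rw [wedge, spencerTmul, LinearMap.lTensor_tmul,
    exteriorPower.alternatingMapLinearEquiv_apply_ιMulti]
  rfl

/-- The contraction of `R ⊗_A ⋀ᵉ⁺¹ L` with a linear form on `L`. -/
def contr (φ : L →ₗ[A] A) (e : ℕ) : SpencerTerm L (e + 1) →ₗ[A] SpencerTerm L e :=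
  LinearMap.lTensor (RightMod A R)
    (exteriorPower.alternatingMapLinearEquiv
      (AlternatingMap.alternatizeUncurryFin (φ.smulRight (exteriorPower.ιMulti A e))))

theorem contr_tmul (φ : L →ₗ[A] A) {e : ℕ} (P : R) (v : Fin (e + 1) → L) :
    contr φ e (spencerTmul P v) =
      ∑ i : Fin (e + 1), (-1 : ℤ) ^ (i : ℕ) • φ (v i) • spencerTmul P (i.removeNth v) := by
  rw [contr, spencerTmul, LinearMap.lTensor_tmul,
    exteriorPower.alternatingMapLinearEquiv_apply_ιMulti,
    AlternatingMap.alternatizeUncurryFin_apply, TensorProduct.tmul_sum]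
  refine Finset.sum_congr rfl fun i _ => ?_
  simp only [spencerTmul, LinearMap.smulRight_apply, AlternatingMap.smul_apply]
  rw [TensorProduct.tmul_smul, TensorProduct.tmul_smul]

theorem contr_wedge_zero (φ : L →ₗ[A] A) (x : L) (t : SpencerTerm L 0) :
    contr φ 0 (wedge x 0 t) = φ x • t := by
  refine DFunLike.congr_fun (spencerTerm_addHom_ext
    (f := ((contr φ 0).comp (wedge x 0)).toAddMonoidHom)
    (g := (φ x • LinearMap.id (R := A) (M := SpencerTerm L 0)).toAddMonoidHom) fun P v => ?_) t
  simp only [LinearMap.toAddMonoidHom_coe, LinearMap.comp_apply, wedge_tmul, contr_tmul,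
    LinearMap.smul_apply, LinearMap.id_apply]
  simp

/-- Contraction is an antiderivation. This is what later isolates the coefficient of a single
generator, in `quant_injective`. -/
theorem contr_wedge_succ (φ : L →ₗ[A] A) (x : L) (e : ℕ) (t : SpencerTerm L (e + 1)) :
    contr φ (e + 1) (wedge x (e + 1) t) = φ x • t - wedge x e (contr φ e t) := by
  refine DFunLike.congr_fun (spencerTerm_addHom_ext
    (f := ((contr φ (e + 1)).comp (wedge x (e + 1))).toAddMonoidHom)
    (g := (φ x • LinearMap.id - (wedge x e).comp (contr φ e)).toAddMonoidHom) fun P v => ?_) t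
  simp only [LinearMap.toAddMonoidHom_coe, LinearMap.comp_apply, wedge_tmul, contr_tmul,
    LinearMap.sub_apply, LinearMap.smul_apply, LinearMap.id_apply, map_sum, map_zsmul, map_smul]
  rw [Fin.sum_univ_succ]
  simp only [removeNth_succ_cons, Fin.cons_succ, Fin.cons_zero, Fin.removeNth_zero,
    Fin.tail_cons, Fin.val_zero, Fin.val_succ, pow_zero, one_smul, pow_succ, mul_neg_one, neg_smul,
    Finset.sum_neg_distrib, sub_eq_add_neg]

theorem spencerTmul_cons_cons_swap {e : ℕ} (P : R) (x y : L) (v : Fin e → L) :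
    spencerTmul (e := e + 2) P (Fin.cons x (Fin.cons y v : Fin (e + 1) → L)) =
      -spencerTmul (e := e + 2) P (Fin.cons y (Fin.cons x v : Fin (e + 1) → L)) := by
  have h := (exteriorPower.ιMulti A (e + 2) (M := L)).map_swap
    (Fin.cons y (Fin.cons x v : Fin (e + 1) → L)) (show (0 : Fin (e + 2)) ≠ 1 by simp)
  have h2 : (Fin.cons y (Fin.cons x v : Fin (e + 1) → L) : Fin (e + 2) → L) ∘ Equiv.swap 0 1 =
      Fin.cons x (Fin.cons y v : Fin (e + 1) → L) := by
    ext i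
    refine Fin.cases ?_ (fun i => Fin.cases ?_ (fun i => ?_) i) i
    · simp
    · simp
    · rw [Function.comp_apply, Equiv.swap_apply_of_ne_of_ne (by simp) (by simp [Fin.ext_iff])]
      simp
  rw [h2] at h
  simp only [spencerTmul, h, TensorProduct.tmul_neg]

theorem wedge_wedge (x y : L) (e : ℕ) (t : SpencerTerm L e) :
    wedge x (e + 1) (wedge y e t) = -wedge y (e + 1) (wedge x e t) := by
  refine DFunLike.congr_fun (spencerTerm_addHom_ext
    (f := ((wedge x (e + 1)).comp (wedge y e)).toAddMonoidHom)
    (g := (-(wedge y (e + 1)).comp (wedge x e)).toAddMonoidHom) fun P v => ?_) t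
  simp only [LinearMap.toAddMonoidHom_coe, LinearMap.comp_apply, wedge_tmul, LinearMap.neg_apply]
  exact spencerTmul_cons_cons_swap P x y v

theorem wedge_self (x : L) (e : ℕ) (t : SpencerTerm L e) :
    wedge x (e + 1) (wedge x e t) = 0 := by
  refine DFunLike.congr_fun (spencerTerm_addHom_ext
    (f := ((wedge x (e + 1)).comp (wedge x e)).toAddMonoidHom)
    (g := 0) fun P v => ?_) t
  simp only [LinearMap.toAddMonoidHom_coe, LinearMap.comp_apply, wedge_tmul,
    AddMonoidHom.zero_apply]
  rw [spencerTmul, (exteriorPower.ιMulti A (e + 2)).map_eq_zero_of_eq _ (i := 0) (j := 1)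
    (by simp) (by simp), TensorProduct.tmul_zero]

theorem wedge_add (x y : L) (e : ℕ) (t : SpencerTerm L e) :
    wedge (x + y) e t = wedge x e t + wedge y e t := by
  refine DFunLike.congr_fun (spencerTerm_addHom_ext
    (f := (wedge (x + y) e).toAddMonoidHom)
    (g := (wedge x e + wedge y e).toAddMonoidHom) fun P v => ?_) t
  simp only [LinearMap.toAddMonoidHom_coe, wedge_tmul, LinearMap.add_apply]
  have h := (exteriorPower.ιMulti A (e + 1) (M := L)).map_update_add (Fin.cons x v) 0 x y
  simp only [Fin.update_cons_zero] at h
  simp only [spencerTmul, h, TensorProduct.tmul_add]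

theorem wedge_smul (a : A) (x : L) (e : ℕ) (t : SpencerTerm L e) :
    wedge (a • x) e t = wedge x e (a • t) := by
  refine DFunLike.congr_fun (spencerTerm_addHom_ext
    (f := (wedge (a • x) e).toAddMonoidHom)
    (g := ((wedge x e).comp (a • LinearMap.id)).toAddMonoidHom) fun P v => ?_) t
  simp only [LinearMap.toAddMonoidHom_coe, wedge_tmul, LinearMap.comp_apply, LinearMap.smul_apply,
    LinearMap.id_apply, base_smul_spencerTmul]
  exact spencerTmul_cons_smul P v a x

/-- Moving the entry at position k to the front costs the sign (-1)^k. The bracket terms of the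
Spencer formula thereby become substitutions, on which the Lie derivative is visibly a derivation.
-/
theorem neg_one_pow_smul_spencerTmul_cons {e : ℕ} (P : R) (w : Fin (e + 1) → L)
    (k : Fin (e + 1)) (z : L) :
    (-1 : ℤ) ^ (k : ℕ) • spencerTmul (e := e + 1) P (Fin.cons z (k.removeNth w)) =
      spencerTmul P (Function.update w k z) := by
  rw [← Fin.insertNth_removeNth]
  simp only [spencerTmul]
  rw [AlternatingMap.map_insertNth, ← TensorProduct.tmul_smul]
  rfl

variable [Algebra ℂ R] (hL : IsLieRinehart L)

/-- Cartan's formula: the anticommutator of the Spencer differential with the wedge product by `x`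
is the Lie derivative along `x`. -/
theorem spencerDiff_cons_add {e : ℕ} (P : R) (x : L) (w : Fin (e + 1) → L) :
    spencerDiff hL (e + 1) (spencerTmul (e := e + 2) P (Fin.cons x w)) +
      wedge x e (spencerDiff hL e (spencerTmul P w)) =
    spencerTmul (P * (x : R)) w -
      ∑ k, spencerTmul P (Function.update w k (hL.bracket x (w k))) := by
  have hIci : Finset.Ici (0 : Fin (e + 1)) = Finset.univ := by ext; simp
  have key : ∑ k, spencerTmul P (Function.update w k (hL.bracket x (w k))) =
      ∑ k : Fin (e + 1), (-1 : ℤ) ^ (k : ℕ) •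
        spencerTmul (e := e + 1) P (Fin.cons (hL.bracket x (w k)) (k.removeNth w)) :=
    Finset.sum_congr rfl fun k _ => (neg_one_pow_smul_spencerTmul_cons P w k _).symm
  rw [spencerDiff_apply, spencerDiff_apply, key]
  cases e with
  | zero =>
    simp only [spencerFormula, wedge_tmul, Fin.sum_univ_succ, hIci]
    have h1 : Fin.removeNth 1 (Fin.cons x w : Fin 2 → L) = Fin.cons x Fin.elim0 := by
      ext i
      rw [Subsingleton.elim i 0]
      rfl
    simp [Fin.removeNth_zero, h1]
    abel
  | succ e =>
    -- These are the brackets that do not involve x. Shifting both positions by one keeps the sign,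
    -- and moving x in front of the bracket reverses it, so they cancel against the bracket part of
    -- x ∧ d.
    have hlast : ∑ i : Fin (e + 1), ∑ j ∈ Finset.Ici i.succ,
          (-1 : ℤ) ^ ((i : ℕ) + 1 + ((j : ℕ) + 1)) •
            spencerTmul P (Fin.cons (hL.bracket ((Fin.cons x w : Fin (e + 3) → L)
              i.succ.castSucc) (w j))
              (j.removeNth (i.succ.castSucc.removeNth (Fin.cons x w : Fin (e + 3) → L)))) =
        - ∑ i : Fin (e + 1), ∑ j ∈ Finset.Ici i, (-1 : ℤ) ^ ((i : ℕ) + ((j : ℕ) + 1)) •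
          wedge x (e + 1) (spencerTmul P (Fin.cons (hL.bracket (w i.castSucc) (w j.succ))
            (j.removeNth (i.castSucc.removeNth w)))) := by
      rw [← Finset.sum_neg_distrib]
      refine Finset.sum_congr rfl fun i _ => ?_
      rw [← Finset.sum_neg_distrib]
      have : Finset.Ici i.succ = (Finset.Ici i).map (Fin.succEmb (e + 1)) := by
        ext j
        simp only [Finset.mem_Ici, Finset.mem_map, Fin.coe_succEmb]
        constructor
        · intro hj
          obtain ⟨j, rfl⟩ := Fin.exists_succ_eq.2 (show j ≠ 0 by
            rintro rfl
            simp at hj)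
          exact ⟨j, by simpa using hj, rfl⟩
        · rintro ⟨j, hj, rfl⟩
          simpa using hj
      rw [this, Finset.sum_map]
      refine Finset.sum_congr rfl fun j _ => ?_
      rw [wedge_tmul, Fin.coe_succEmb, ← Fin.succ_castSucc, removeNth_succ_cons,
        removeNth_succ_cons, Fin.cons_succ, spencerTmul_cons_cons_swap, Fin.val_succ, smul_neg]
      congr 2
      ring
    simp only [spencerFormula]
    rw [Fin.sum_univ_succ (n := e + 2), Fin.sum_univ_succ (n := e + 1)
      (f := fun i : Fin (e + 2) => ∑ j ∈ Finset.Ici i, _)]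
    simp only [removeNth_succ_cons, Fin.cons_succ, Fin.cons_zero, Fin.removeNth_zero,
        Fin.tail_cons, Fin.val_zero, Fin.val_succ, pow_zero, one_smul, hIci,
        Fin.castSucc_zero, zero_add, hlast, map_add, map_sum, map_zsmul, wedge_tmul]
    simp only [pow_succ, mul_neg_one, neg_smul, Finset.sum_neg_distrib]
    abel

theorem lieRinehart_jacobi (x y z : L) :
    hL.bracket (hL.bracket x y) z =
      hL.bracket x (hL.bracket y z) - hL.bracket y (hL.bracket x z) := by
  apply Subtype.ext
  simp only [IsLieRinehart.bracket, Submodule.coe_sub, Ring.lie_def]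
  noncomm_ring

/-! #### The total complex -/

variable (L) in
/-- The product of all terms of the Spencer complex. -/
abbrev SpencerTotal : Type := ∀ e, SpencerTerm L e

/-- The wedge product by `x` on the total complex. -/
def wedgeT (x : L) : SpencerTotal L →ₗ[A] SpencerTotal L where
  toFun t := fun
    | 0 => 0
    | e + 1 => wedge x e (t e)
  map_add' s t := by ext e; cases e <;> simp
  map_smul' a t := by ext e; cases e <;> simp

theorem wedgeT_zero (x : L) (t : SpencerTotal L) : wedgeT x t 0 = 0 := rfl

theorem wedgeT_succ (x : L) (t : SpencerTotal L) (e : ℕ) :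
    wedgeT x t (e + 1) = wedge x e (t e) := rfl

/-- The contraction with a linear form on the total complex. -/
def contrT (φ : L →ₗ[A] A) : SpencerTotal L →ₗ[A] SpencerTotal L where
  toFun t := fun e => contr φ e (t (e + 1))
  map_add' s t := by ext e; simp
  map_smul' a t := by ext e; simp

theorem contrT_apply (φ : L →ₗ[A] A) (t : SpencerTotal L) (e : ℕ) :
    contrT φ t e = contr φ e (t (e + 1)) := rfl

/-- The Spencer differential on the total complex. -/
def diffT : SpencerTotal L →+ SpencerTotal L where
  toFun t := fun e => spencerDiff hL e (t (e + 1))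
  map_zero' := by ext e; simp
  map_add' s t := by ext e; simp

theorem diffT_apply (t : SpencerTotal L) (e : ℕ) :
    diffT hL t e = spencerDiff hL e (t (e + 1)) := rfl

/-- The element `P ⊗ 1` of degree `0`. -/
def scalarT : R →+ SpencerTotal L where
  toFun P := fun
    | 0 => spencerTmul P Fin.elim0
    | _ + 1 => 0
  map_zero' := by
    ext e
    cases e
    · simp [spencerTmul]
    · rfl
  map_add' P Q := by
    ext e
    cases e
    · simp [spencerTmul_add]
    · simp

theorem scalarT_zero (P : R) : (scalarT P : SpencerTotal L) 0 = spencerTmul P Fin.elim0 := rfl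

theorem scalarT_succ (P : R) (e : ℕ) : (scalarT P : SpencerTotal L) (e + 1) = 0 := rfl

theorem smul_scalarT (a : A) (P : R) :
    a • (scalarT P : SpencerTotal L) = scalarT (P * (a • (1 : R))) := by
  ext e
  cases e
  · rw [Pi.smul_apply, scalarT_zero, scalarT_zero, base_smul_spencerTmul]
  · simp [scalarT_succ]

/-- The augmentation for the zero ideal recovers P from P ⊗ 1. -/
theorem scalarT_injective : Function.Injective (scalarT : R →+ SpencerTotal L) := by
  intro P Q h
  have h0 := congrArg (spencerAug L ⊥) (congrFun h 0)
  rw [scalarT_zero, scalarT_zero, spencerAug_apply, spencerAug_apply] at h0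
  have := (Submodule.Quotient.eq _).1 h0
  rwa [Submodule.mem_bot, sub_eq_zero] at this

theorem diffT_scalarT (P : R) : diffT hL (scalarT P) = 0 := by
  ext e
  rw [diffT_apply, scalarT_succ, map_zero, Pi.zero_apply]

theorem contrT_scalarT (φ : L →ₗ[A] A) (P : R) :
    contrT φ (scalarT P : SpencerTotal L) = 0 := by
  ext e
  rw [contrT_apply, scalarT_succ, map_zero, Pi.zero_apply]

theorem contrT_wedgeT (φ : L →ₗ[A] A) (x : L) (t : SpencerTotal L) :
    contrT φ (wedgeT x t) = φ x • t - wedgeT x (contrT φ t) := by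
  ext e
  cases e with
  | zero => simp [contrT_apply, wedgeT_succ, wedgeT_zero, contr_wedge_zero]
  | succ e => simp [contrT_apply, wedgeT_succ, contr_wedge_succ]

theorem wedgeT_wedgeT (x y : L) (t : SpencerTotal L) :
    wedgeT x (wedgeT y t) = -wedgeT y (wedgeT x t) := by
  ext e
  match e with
  | 0 => simp [wedgeT_zero]
  | 1 => simp [wedgeT_zero, wedgeT_succ]
  | e + 2 => simp only [wedgeT_succ, Pi.neg_apply, wedge_wedge x y]

theorem wedgeT_self (x : L) (t : SpencerTotal L) : wedgeT x (wedgeT x t) = 0 := by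
  ext e
  match e with
  | 0 => simp [wedgeT_zero]
  | 1 => simp [wedgeT_zero, wedgeT_succ]
  | e + 2 => simp only [wedgeT_succ, Pi.zero_apply, wedge_self]

theorem wedgeT_add (x y : L) (t : SpencerTotal L) :
    wedgeT (x + y) t = wedgeT x t + wedgeT y t := by
  ext e
  cases e
  · simp [wedgeT_zero]
  · simp only [wedgeT_succ, Pi.add_apply, wedge_add]

theorem wedgeT_smul (a : A) (x : L) (t : SpencerTotal L) :
    wedgeT (a • x) t = wedgeT x (a • t) := by
  ext e
  cases e
  · simp [wedgeT_zero]
  · simp only [wedgeT_succ, Pi.smul_apply, wedge_smul]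

/-- Wedge products with a fixed element of the total complex, as a function of the vector. -/
def wedgeLeft (t : SpencerTotal L) : L →+ SpencerTotal L :=
  AddMonoidHom.mk' (fun x => wedgeT x t) fun x y => wedgeT_add x y t

theorem wedgeLeft_apply (x : L) (t : SpencerTotal L) : wedgeLeft t x = wedgeT x t := rfl

theorem wedgeT_sub (x y : L) (t : SpencerTotal L) :
    wedgeT (x - y) t = wedgeT x t - wedgeT y t :=
  map_sub (wedgeLeft t) x y

/-- The element `P ⊗ (x₁ ∧ ⋯ ∧ xₑ)` of the total complex. -/
def monoT (P : R) (l : List L) : SpencerTotal L :=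
  l.foldr (fun x t => wedgeT x t) (scalarT P)

theorem monoT_cons (P : R) (x : L) (l : List L) : monoT P (x :: l) = wedgeT x (monoT P l) := rfl

/-- Lists suit induction on the number of factors, while the differential is given by a formula on
tuples; this passes between the two. -/
theorem monoT_ofFn (P : R) {e : ℕ} (v : Fin e → L) :
    monoT P (List.ofFn v) = Pi.single e (spencerTmul P v) := by
  induction e with
  | zero =>
    rw [List.ofFn_zero]
    ext e
    cases e with
    | zero =>
      rw [Pi.single_eq_same, Subsingleton.elim v Fin.elim0]
      rfl
    | succ e =>
      rw [Pi.single_eq_of_ne (by simp)]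
      rfl
  | succ n ih =>
    rw [List.ofFn_succ, monoT_cons, ih]
    ext e
    cases e with
    | zero =>
      rw [Pi.single_eq_of_ne (by simp), wedgeT_zero]
    | succ e =>
      rw [wedgeT_succ]
      by_cases h : e = n
      · subst h
        rw [Pi.single_eq_same, Pi.single_eq_same, wedge_tmul]
        congr 1
        exact Fin.cons_self_tail v
      · rw [Pi.single_eq_of_ne h, Pi.single_eq_of_ne (by simpa using h), map_zero]

/-- The Lie derivative along `x` on the total complex. -/
def lieT (x : L) : SpencerTotal L →+ SpencerTotal L :=
  (diffT hL).comp (wedgeT x).toAddMonoidHom + (wedgeT x).toAddMonoidHom.comp (diffT hL)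

theorem lieT_apply (x : L) (t : SpencerTotal L) :
    lieT hL x t = diffT hL (wedgeT x t) + wedgeT x (diffT hL t) := rfl

theorem diffT_wedgeT (x : L) (t : SpencerTotal L) :
    diffT hL (wedgeT x t) = lieT hL x t - wedgeT x (diffT hL t) := by
  rw [lieT_apply, add_sub_cancel_right]

theorem lieT_scalarT (x : L) (P : R) :
    lieT hL x (scalarT P : SpencerTotal L) = scalarT (P * (x : R)) := by
  rw [lieT_apply, diffT_scalarT, map_zero, add_zero]
  ext e
  cases e with
  | zero =>
    rw [diffT_apply, wedgeT_succ, scalarT_zero, wedge_tmul, spencerDiff_apply]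
    rfl
  | succ e => rw [diffT_apply, wedgeT_succ, scalarT_succ, map_zero, map_zero, scalarT_succ]

theorem lieT_single (x : L) {e : ℕ} (P : R) (v : Fin e → L) :
    lieT hL x (Pi.single e (spencerTmul P v)) = Pi.single e (spencerTmul (P * (x : R)) v -
      ∑ k, spencerTmul P (Function.update v k (hL.bracket x (v k)))) := by
  cases e with
  | zero =>
    have h := monoT_ofFn (P * (x : R)) v
    rw [← monoT_ofFn]
    simp only [Finset.univ_eq_empty, Finset.sum_empty, sub_zero]
    rw [← monoT_ofFn, List.ofFn_zero]
    exact lieT_scalarT hL x P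
  | succ e =>
    rw [← spencerDiff_cons_add hL]
    ext n
    rw [lieT_apply, Pi.add_apply, diffT_apply, wedgeT_succ]
    by_cases h : n = e + 1
    · subst h
      rw [Pi.single_eq_same, Pi.single_eq_same, wedgeT_succ, diffT_apply, Pi.single_eq_same,
        wedge_tmul]
    · rw [Pi.single_eq_of_ne h, Pi.single_eq_of_ne h, map_zero, map_zero, zero_add]
      cases n with
      | zero => rw [wedgeT_zero]
      | succ n => rw [wedgeT_succ, diffT_apply, Pi.single_eq_of_ne h, map_zero, map_zero]

theorem wedgeT_single (x : L) {e : ℕ} (t : SpencerTerm L e) :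
    wedgeT x (Pi.single e t) = Pi.single (e + 1) (wedge x e t) := by
  ext n
  cases n with
  | zero => rw [wedgeT_zero, Pi.single_eq_of_ne (by simp)]
  | succ n =>
    rw [wedgeT_succ]
    by_cases h : n = e
    · subst h
      rw [Pi.single_eq_same, Pi.single_eq_same]
    · rw [Pi.single_eq_of_ne h, Pi.single_eq_of_ne (by simpa using h), map_zero]

/-- In `lieT_single` the substitution at position 0 gives the bracket term, and the remaining terms
act on the other factors only. -/
theorem lieT_wedgeT_monoT (x y : L) (P : R) (l : List L) :
    lieT hL x (wedgeT y (monoT P l)) =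
      wedgeT y (lieT hL x (monoT P l)) - wedgeT (hL.bracket x y) (monoT P l) := by
  obtain ⟨e, v, rfl⟩ : ∃ (e : ℕ) (v : Fin e → L), l = List.ofFn v :=
    ⟨l.length, l.get, (List.ofFn_get l).symm⟩
  rw [monoT_ofFn, lieT_single]
  simp only [wedgeT_single, wedge_tmul, lieT_single, map_sub, map_sum]
  rw [← Pi.single_sub]
  congr 1
  rw [Fin.sum_univ_succ]
  simp only [Fin.cons_zero, Fin.cons_succ, Fin.update_cons_zero, ← Fin.cons_update]
  abel

variable (L) in
/-- The elements of finite support of the total complex. -/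
def finT : AddSubgroup (SpencerTotal L) :=
  AddSubgroup.closure {t | ∃ (P : R) (l : List L), monoT P l = t}

theorem monoT_mem_finT (P : R) (l : List L) : monoT P l ∈ finT L :=
  AddSubgroup.subset_closure ⟨P, l, rfl⟩

/-- The decomposable elements generate only elements of finite support in the product, hence the
restriction to `finT` here and in the Cartan identities below. -/
theorem eq_of_mem_finT {T : Type} [AddCommGroup T] {f g : SpencerTotal L →+ T}
    (h : ∀ (P : R) (l : List L), f (monoT P l) = g (monoT P l)) {t : SpencerTotal L}
    (ht : t ∈ finT L) : f t = g t := by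
  induction ht using AddSubgroup.closure_induction with
  | mem t ht =>
    obtain ⟨P, l, rfl⟩ := ht
    exact h P l
  | zero => simp
  | add s t _ _ hs ht => rw [map_add, map_add, hs, ht]
  | neg t _ ht => rw [map_neg, map_neg, ht]

theorem single_mem_finT {e : ℕ} (t : SpencerTerm L e) : Pi.single e t ∈ finT L := by
  -- Membership becomes the vanishing of an additive map to the quotient, so that it can be tested
  -- on decomposable tensors.
  rw [← QuotientAddGroup.eq_zero_iff]
  refine DFunLike.congr_fun (spencerTerm_addHom_ext
    (f := (QuotientAddGroup.mk' (finT L)).comp (AddMonoidHom.single (SpencerTerm L) e))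
    (g := 0) fun P v => ?_) t
  simp only [AddMonoidHom.comp_apply, AddMonoidHom.single_apply, AddMonoidHom.zero_apply]
  rw [← monoT_ofFn]
  exact (QuotientAddGroup.eq_zero_iff _).2 (monoT_mem_finT P _)

theorem wedgeT_mem_finT (x : L) {t : SpencerTotal L} (ht : t ∈ finT L) :
    wedgeT x t ∈ finT L := by
  induction ht using AddSubgroup.closure_induction with
  | mem t ht =>
    obtain ⟨P, l, rfl⟩ := ht
    exact monoT_mem_finT P (x :: l)
  | zero => rw [map_zero]; exact zero_mem _
  | add s t _ _ hs ht => rw [map_add]; exact add_mem hs ht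
  | neg t _ ht => rw [map_neg]; exact neg_mem ht

theorem lieT_wedgeT (x y : L) {t : SpencerTotal L} (ht : t ∈ finT L) :
    lieT hL x (wedgeT y t) = wedgeT y (lieT hL x t) - wedgeT (hL.bracket x y) t :=
  eq_of_mem_finT (f := (lieT hL x).comp (wedgeT y).toAddMonoidHom)
    (g := (wedgeT y).toAddMonoidHom.comp (lieT hL x) - (wedgeT (hL.bracket x y)).toAddMonoidHom)
    (lieT_wedgeT_monoT hL x y) ht

theorem lieT_mem_finT (x : L) {t : SpencerTotal L} (ht : t ∈ finT L) :
    lieT hL x t ∈ finT L := by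
  induction ht using AddSubgroup.closure_induction with
  | mem t ht =>
    obtain ⟨P, l, rfl⟩ := ht
    induction l with
    | nil => exact (lieT_scalarT hL x P).symm ▸ monoT_mem_finT (P * (x : R)) []
    | cons y l ih =>
      rw [monoT_cons, lieT_wedgeT_monoT]
      exact sub_mem (wedgeT_mem_finT y ih) (wedgeT_mem_finT _ (monoT_mem_finT P l))
  | zero => rw [map_zero]; exact zero_mem _
  | add s t _ _ hs ht => rw [map_add]; exact add_mem hs ht
  | neg t _ ht => rw [map_neg]; exact neg_mem ht

/-- Operators act on P from the right, so the order of composition is reversed. On P ⊗ 1 both sides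
are right multiplication by the commutator, and the Jacobi identity carries the formula past one
more factor. -/
theorem lieT_lieT_monoT (x y : L) (P : R) (l : List L) :
    lieT hL y (lieT hL x (monoT P l)) - lieT hL x (lieT hL y (monoT P l)) =
      lieT hL (hL.bracket x y) (monoT P l) := by
  induction l with
  | nil =>
    change lieT hL y (lieT hL x (scalarT P)) - lieT hL x (lieT hL y (scalarT P)) =
      lieT hL (hL.bracket x y) (scalarT P)
    simp only [lieT_scalarT, ← map_sub]
    congr 1
    simp only [IsLieRinehart.bracket, Ring.lie_def]
    noncomm_ring
  | cons z l ih =>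
    have hm := monoT_mem_finT P l
    rw [monoT_cons, lieT_wedgeT hL x z hm, lieT_wedgeT hL y z hm, lieT_wedgeT hL _ z hm, map_sub,
      map_sub, lieT_wedgeT hL y z (lieT_mem_finT hL x hm),
      lieT_wedgeT hL x z (lieT_mem_finT hL y hm), lieT_wedgeT hL y _ hm, lieT_wedgeT hL x _ hm,
      ← ih, lieRinehart_jacobi, wedgeT_sub, map_sub]
    abel

theorem diffT_monoT_mem_finT (P : R) (l : List L) : diffT hL (monoT P l) ∈ finT L := by
  induction l with
  | nil => exact (diffT_scalarT hL P).symm ▸ zero_mem _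
  | cons x l ih =>
    rw [monoT_cons, diffT_wedgeT]
    exact sub_mem (lieT_mem_finT hL x (monoT_mem_finT P l)) (wedgeT_mem_finT x ih)

/-- Expanding both sides on y ∧ t, everything cancels by induction except L_y L_x - L_x L_y against
L_[x,y], which is `lieT_lieT_monoT`. -/
theorem diffT_lieT_monoT (x : L) (P : R) (l : List L) :
    diffT hL (lieT hL x (monoT P l)) = lieT hL x (diffT hL (monoT P l)) := by
  induction l with
  | nil =>
    change diffT hL (lieT hL x (scalarT P)) = lieT hL x (diffT hL (scalarT P))
    rw [lieT_scalarT, diffT_scalarT, diffT_scalarT, map_zero]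
  | cons y l ih =>
    have hm := monoT_mem_finT P l
    have hd := diffT_monoT_mem_finT hL P l
    rw [monoT_cons, lieT_wedgeT hL x y hm, map_sub, diffT_wedgeT, diffT_wedgeT, diffT_wedgeT,
      map_sub, lieT_wedgeT hL x y hd, ih, ← lieT_lieT_monoT]
    abel

/-- By Cartan's formula d d (x ∧ t) = d L_x t - L_x d t + x ∧ d d t. The first two terms cancel and
the last vanishes by induction on the number of factors. -/
theorem diffT_diffT {t : SpencerTotal L} (ht : t ∈ finT L) : diffT hL (diffT hL t) = 0 := by
  refine eq_of_mem_finT (f := (diffT hL).comp (diffT hL)) (g := 0) (fun P l => ?_) ht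
  simp only [AddMonoidHom.comp_apply, AddMonoidHom.zero_apply]
  induction l with
  | nil => exact (diffT_scalarT hL P).symm ▸ map_zero _
  | cons x l ih =>
    rw [monoT_cons, diffT_wedgeT, map_sub, diffT_lieT_monoT, diffT_wedgeT, ih, map_zero]
    abel

end Total

/-! ### Koszul chains -/

section Koszul

/-- The chains of the Koszul complex on `k` elements with coefficients in `X`. The pair `(a, b)`
stands for `a + e_k ∧ b`. -/
def Chain (X : Type) : ℕ → Type
  | 0 => X
  | k + 1 => Chain X k × Chain X k

instance Chain.addCommGroup (X : Type) [AddCommGroup X] : ∀ k, AddCommGroup (Chain X k)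
  | 0 => inferInstanceAs (AddCommGroup X)
  | k + 1 =>
    let _ := Chain.addCommGroup X k
    inferInstanceAs (AddCommGroup (Chain X k × Chain X k))

instance Chain.module (G : Type) [CommRing G] : ∀ k, Module G (Chain G k)
  | 0 => inferInstanceAs (Module G G)
  | k + 1 =>
    let _ := Chain.module G k
    inferInstanceAs (Module G (Chain G k × Chain G k))

/-- The chain `a + e_k ∧ b`. -/
def Chain.mk {X : Type} {k : ℕ} (a b : Chain X k) : Chain X (k + 1) := (a, b)

theorem Chain.exists_mk {X : Type} {k : ℕ} (x : Chain X (k + 1)) : ∃ a b, x = Chain.mk a b :=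
  ⟨x.1, x.2, rfl⟩

section

variable {X : Type} [AddCommGroup X] {k : ℕ}

theorem Chain.mk_zero : Chain.mk (0 : Chain X k) 0 = 0 := rfl

end

variable {G : Type} [CommRing G]

theorem Chain.smul_mk {k : ℕ} (g : G) (a b : Chain G k) :
    g • Chain.mk a b = Chain.mk (g • a) (g • b) := rfl

/-- The Koszul differential. -/
def koszul (s : ℕ → G) : ∀ k, Chain G k →ₗ[G] Chain G k
  | 0 => 0
  | k + 1 =>
    ((koszul s k).coprod (s k • LinearMap.id)).prod ((0 : Chain G k →ₗ[G] Chain G k).coprod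
      (-koszul s k))

theorem koszul_zero (s : ℕ → G) (x : Chain G 0) : koszul s 0 x = 0 := rfl

theorem koszul_mk (s : ℕ → G) {k : ℕ} (a b : Chain G k) :
    koszul s (k + 1) (Chain.mk a b) = Chain.mk (koszul s k a + s k • b) (-koszul s k b) := by
  refine Prod.ext rfl ?_
  change (0 : Chain G k →ₗ[G] Chain G k) a + (-koszul s k) b = _
  rw [LinearMap.zero_apply, zero_add]
  rfl

theorem koszul_koszul (s : ℕ → G) : ∀ (k : ℕ) (x : Chain G k), koszul s k (koszul s k x) = 0
  | 0, x => rfl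
  | k + 1, x => by
    obtain ⟨a, b, rfl⟩ := x.exists_mk
    rw [koszul_mk, koszul_mk, map_add, koszul_koszul s k, map_neg, koszul_koszul s k, map_smul,
      smul_neg, zero_add, add_neg_cancel, neg_zero, neg_zero, Chain.mk_zero]

/-- The component of exterior degree `0` of a chain. -/
def Chain.scalar {X : Type} [AddCommGroup X] : ∀ k, Chain X k →+ X
  | 0 => AddMonoidHom.id X
  | k + 1 => (Chain.scalar k).comp (AddMonoidHom.fst _ _)

theorem Chain.scalar_mk {X : Type} [AddCommGroup X] {k : ℕ} (a b : Chain X k) :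
    Chain.scalar (k + 1) (Chain.mk a b) = Chain.scalar k a := rfl

theorem Chain.scalar_smul (g : G) : ∀ {k : ℕ} (x : Chain G k),
    Chain.scalar k (g • x) = g * Chain.scalar k x
  | 0, _ => rfl
  | _ + 1, x => Chain.scalar_smul g x.1

/-- A chain of exterior degree `0`. -/
def Chain.const {X : Type} [AddCommGroup X] (g : X) : ∀ k, Chain X k
  | 0 => g
  | k + 1 => Chain.mk (Chain.const g k) 0

theorem Chain.scalar_const {X : Type} [AddCommGroup X] (g : X) :
    ∀ k, Chain.scalar k (Chain.const g k) = g
  | 0 => rfl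
  | k + 1 => Chain.scalar_const g k

/-- The chains without components of exterior degree `0` and `1`. -/
def Chain.NoScalarNoVector {X : Type} [AddCommGroup X] : ∀ k, Chain X k → Prop
  | 0, x => x = 0
  | k + 1, x => Chain.NoScalarNoVector k x.1 ∧ Chain.scalar k x.2 = 0

theorem scalar_eq_zero_of_noScalarNoVector {X : Type} [AddCommGroup X] :
    ∀ (k : ℕ) {x : Chain X k}, Chain.NoScalarNoVector k x → Chain.scalar k x = 0
  | 0, _, h => h
  | k + 1, _, h => scalar_eq_zero_of_noScalarNoVector k h.1

/-- The ideal generated by the first `k` terms of a sequence. -/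
def initialIdeal (s : ℕ → G) (k : ℕ) : Ideal G := Ideal.span (s '' {i | i < k})

theorem initialIdeal_succ (s : ℕ → G) (k : ℕ) :
    initialIdeal s (k + 1) = initialIdeal s k ⊔ Ideal.span {s k} := by
  rw [initialIdeal, initialIdeal, ← Ideal.span_union, ← Set.image_singleton, ← Set.image_union]
  congr 2
  ext i
  simp [Order.lt_add_one_iff, le_iff_eq_or_lt]

theorem initialIdeal_zero (s : ℕ → G) : initialIdeal s 0 = ⊥ := by
  simp [initialIdeal]

theorem scalar_koszul_mem (s : ℕ → G) : ∀ (k : ℕ) (x : Chain G k),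
    Chain.scalar k (koszul s k x) ∈ initialIdeal s k
  | 0, _ => zero_mem _
  | k + 1, x => by
    obtain ⟨a, b, rfl⟩ := x.exists_mk
    rw [koszul_mk, Chain.scalar_mk, map_add, Chain.scalar_smul, initialIdeal_succ]
    exact add_mem (Ideal.mem_sup_left (scalar_koszul_mem s k a))
      (Ideal.mem_sup_right (Ideal.mul_mem_right _ _ (Ideal.mem_span_singleton_self _)))

/-- The combination ∑ g_i s_i is the image of the vector ∑ g_i e_i, which has no component of
exterior degree 0. -/
theorem exists_scalar_koszul_eq (s : ℕ → G) : ∀ (k : ℕ) {g : G}, g ∈ initialIdeal s k →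
    ∃ x : Chain G k, Chain.scalar k x = 0 ∧ Chain.scalar k (koszul s k x) = g
  | 0, g, hg => ⟨0, map_zero _, by
      rw [initialIdeal_zero, Ideal.mem_bot] at hg
      rw [hg, map_zero, map_zero]⟩
  | k + 1, g, hg => by
    rw [initialIdeal_succ] at hg
    obtain ⟨g₁, h₁, g₂, h₂, rfl⟩ := Submodule.mem_sup.1 hg
    obtain ⟨t, rfl⟩ := Ideal.mem_span_singleton'.1 h₂
    obtain ⟨a, ha, ha'⟩ := exists_scalar_koszul_eq s k h₁
    refine ⟨Chain.mk a (Chain.const t k), ha, ?_⟩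
    rw [koszul_mk, Chain.scalar_mk, map_add, ha', Chain.scalar_smul, Chain.scalar_const, mul_comm]

/-- Multiplication by `s k` is injective modulo the ideal of the previous terms, for `k < M`. -/
def RegularSeq (s : ℕ → G) (M : ℕ) : Prop :=
  ∀ k < M, ∀ g, s k * g ∈ initialIdeal s k → g ∈ initialIdeal s k

/-- The Koszul complex of a regular sequence is exact in positive degrees. -/
theorem koszul_exact {s : ℕ → G} {M : ℕ} (hs : RegularSeq s M) : ∀ k ≤ M, ∀ x : Chain G k,
    Chain.scalar k x = 0 → koszul s k x = 0 →
    ∃ y, Chain.NoScalarNoVector k y ∧ koszul s k y = x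
  | 0, _, x, h₁, _ => ⟨0, rfl, h₁.symm⟩
  | k + 1, hk, x, h₁, h₂ => by
    have ih := koszul_exact hs k (by omega)
    obtain ⟨a, b, rfl⟩ := x.exists_mk
    rw [Chain.scalar_mk] at h₁
    rw [koszul_mk, ← Chain.mk_zero] at h₂
    obtain ⟨h₃, h₄⟩ := Prod.ext_iff.1 h₂
    change koszul s k a + s k • b = 0 at h₃
    change -koszul s k b = 0 at h₄
    rw [neg_eq_zero] at h₄
    -- The cycle condition puts s_k times the scalar part of b into the ideal of the earlier terms.
    -- This is the only use of regularity.
    have hb : Chain.scalar k b ∈ initialIdeal s k := by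
      apply hs k (by omega)
      rw [← Chain.scalar_smul, ← neg_eq_of_add_eq_zero_right h₃, map_neg]
      exact neg_mem (scalar_koszul_mem s k a)
    -- Subtracting the boundary of z removes the scalar part of b, so that the induction hypothesis
    -- applies to the difference.
    obtain ⟨z, hz, hz'⟩ := exists_scalar_koszul_eq s k hb
    obtain ⟨y, hy, hy'⟩ := ih (b - koszul s k z) (by rw [map_sub, hz', sub_self])
      (by rw [map_sub, h₄, koszul_koszul, sub_zero])
    have hb' : koszul s k (y + z) = b := by rw [map_add, hy', sub_add_cancel]
    have hyz : Chain.scalar k (y + z) = 0 := by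
      rw [map_add, hz, scalar_eq_zero_of_noScalarNoVector k hy, add_zero]
    obtain ⟨y', hy₁, hy₂⟩ := ih (a + s k • (y + z))
      (by rw [map_add, h₁, Chain.scalar_smul, hyz, mul_zero, add_zero])
      (by rw [map_add, map_smul, hb', h₃])
    -- The sign undoes the minus of the differential on the e_k component and removes the summand
    -- s_k (y + z) from the first component.
    refine ⟨Chain.mk y' (-(y + z)), ⟨hy₁, ?_⟩, ?_⟩
    · change Chain.scalar k (-(y + z)) = 0
      rw [map_neg, hyz, neg_zero]
    · rw [koszul_mk, hy₂, map_neg, hb', neg_neg, smul_neg, add_neg_cancel_right]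

/-- An exhaustive increasing filtration by additive subgroups `lt l` ("degree less than `l`"),
starting at `lt 0 = 0`, with projections to the homogeneous components. -/
structure GradedFiltration (G : Type) [AddCommGroup G] where
  lt : ℤ → AddSubgroup G
  proj : ℤ → G →+ G
  mono : Monotone lt
  lt_zero : lt 0 = ⊥
  exhaust : ∀ g, ∃ l : ℕ, g ∈ lt l
  proj_proj : ∀ l g, proj l (proj l g) = proj l g
  proj_mem : ∀ l g, proj l g ∈ lt (l + 1)
  sub_proj_mem : ∀ l, ∀ g ∈ lt (l + 1), g - proj l g ∈ lt l
  proj_eq_zero : ∀ l, ∀ g ∈ lt l, proj l g = 0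

variable (𝓕 : GradedFiltration G) (w : ℕ → ℕ)

/-- The chains of degree less than `l`, where `e_k` has degree `w k`. -/
def chainLt : ∀ (k : ℕ) (_ : ℤ), AddSubgroup (Chain G k)
  | 0, l => 𝓕.lt l
  | k + 1, l => (chainLt k l).prod (chainLt k (l - w k))

/-- The homogeneous component of degree `l` of a chain. -/
def chainProj : ∀ (k : ℕ) (_ : ℤ), Chain G k →+ Chain G k
  | 0, l => 𝓕.proj l
  | k + 1, l => (chainProj k l).prodMap (chainProj k (l - w k))

theorem mk_mem_chainLt {k : ℕ} {l : ℤ} {a b : Chain G k} :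
    Chain.mk a b ∈ chainLt 𝓕 w (k + 1) l ↔ a ∈ chainLt 𝓕 w k l ∧ b ∈ chainLt 𝓕 w k (l - w k) :=
  AddSubgroup.mem_prod

theorem chainProj_mk {k : ℕ} {l : ℤ} (a b : Chain G k) :
    chainProj 𝓕 w (k + 1) l (Chain.mk a b) =
      Chain.mk (chainProj 𝓕 w k l a) (chainProj 𝓕 w k (l - w k) b) := rfl

theorem chainLt_mono : ∀ k, Monotone (chainLt 𝓕 w k)
  | 0 => 𝓕.mono
  | k + 1 => fun _ _ h => AddSubgroup.prod_mono (chainLt_mono k h)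
      (chainLt_mono k (sub_le_sub_right h _))

theorem eq_zero_of_mem_chainLt : ∀ (k : ℕ) {l : ℤ}, l ≤ 0 → ∀ {x : Chain G k},
    x ∈ chainLt 𝓕 w k l → x = 0
  | 0, _, hl, x, hx => by
    have : x ∈ 𝓕.lt 0 := 𝓕.mono hl hx
    rw [𝓕.lt_zero] at this
    exact this
  | k + 1, _, hl, _, hx =>
    Prod.ext (eq_zero_of_mem_chainLt k hl hx.1)
      (eq_zero_of_mem_chainLt k (by omega) hx.2)

theorem exists_mem_chainLt : ∀ (k : ℕ) (x : Chain G k), ∃ l : ℕ, x ∈ chainLt 𝓕 w k l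
  | 0, x => 𝓕.exhaust x
  | k + 1, x => by
    obtain ⟨l₁, h₁⟩ := exists_mem_chainLt k x.1
    obtain ⟨l₂, h₂⟩ := exists_mem_chainLt k x.2
    refine ⟨l₁ + l₂ + w k, chainLt_mono 𝓕 w k ?_ h₁, chainLt_mono 𝓕 w k ?_ h₂⟩
    · push_cast; omega
    · push_cast; omega

theorem chainProj_chainProj : ∀ (k : ℕ) (l : ℤ) (x : Chain G k),
    chainProj 𝓕 w k l (chainProj 𝓕 w k l x) = chainProj 𝓕 w k l x
  | 0, l, x => 𝓕.proj_proj l x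
  | k + 1, l, x => Prod.ext (chainProj_chainProj k l x.1) (chainProj_chainProj k _ x.2)

theorem chainProj_mem : ∀ (k : ℕ) (l : ℤ) (x : Chain G k),
    chainProj 𝓕 w k l x ∈ chainLt 𝓕 w k (l + 1)
  | 0, l, x => 𝓕.proj_mem l x
  | k + 1, l, x => ⟨chainProj_mem k l x.1, by
      have h := chainProj_mem k (l - w k) x.2
      rwa [sub_add_eq_add_sub] at h⟩

theorem sub_chainProj_mem : ∀ (k : ℕ) (l : ℤ) {x : Chain G k}, x ∈ chainLt 𝓕 w k (l + 1) →
    x - chainProj 𝓕 w k l x ∈ chainLt 𝓕 w k l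
  | 0, l, x, hx => 𝓕.sub_proj_mem l x hx
  | k + 1, l, x, hx => ⟨sub_chainProj_mem k l hx.1, sub_chainProj_mem k (l - w k) (by
      have h := hx.2
      rwa [← sub_add_eq_add_sub] at h)⟩

theorem chainProj_eq_zero : ∀ (k : ℕ) (l : ℤ) {x : Chain G k}, x ∈ chainLt 𝓕 w k l →
    chainProj 𝓕 w k l x = 0
  | 0, l, x, hx => 𝓕.proj_eq_zero l x hx
  | k + 1, l, _, hx => Prod.ext (chainProj_eq_zero k l hx.1) (chainProj_eq_zero k _ hx.2)

theorem scalar_chainProj : ∀ (k : ℕ) (l : ℤ) (x : Chain G k),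
    Chain.scalar k (chainProj 𝓕 w k l x) = 𝓕.proj l (Chain.scalar k x)
  | 0, _, _ => rfl
  | k + 1, l, x => scalar_chainProj k l x.1

theorem noScalarNoVector_chainProj : ∀ (k : ℕ) (l : ℤ) {x : Chain G k},
    Chain.NoScalarNoVector k x → Chain.NoScalarNoVector k (chainProj 𝓕 w k l x)
  | 0, l, _, hx => by
    rw [Chain.NoScalarNoVector] at hx
    rw [hx, map_zero]
    rfl
  | k + 1, l, x, hx => ⟨noScalarNoVector_chainProj k l hx.1,
      (scalar_chainProj 𝓕 w k _ x.2).trans (by rw [hx.2, map_zero])⟩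

theorem chainProj_smul {g : G} {n : ℕ} (hg : ∀ l x, 𝓕.proj l (g * x) = g * 𝓕.proj (l - n) x) :
    ∀ (k : ℕ) (l : ℤ) (x : Chain G k),
      chainProj 𝓕 w k l (g • x) = g • chainProj 𝓕 w k (l - n) x
  | 0, l, x => hg l x
  | k + 1, l, x => Prod.ext (chainProj_smul hg k l x.1) (by
      have h := chainProj_smul hg k (l - w k) x.2
      rw [sub_right_comm] at h
      exact h)

variable {s : ℕ → G}

/-- Giving e_k the same degree as s_k makes the Koszul differential preserve degrees. -/
theorem koszul_chainProj (hp : ∀ k l x, 𝓕.proj l (s k * x) = s k * 𝓕.proj (l - w k) x) :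
    ∀ (k : ℕ) (l : ℤ) (x : Chain G k),
      koszul s k (chainProj 𝓕 w k l x) = chainProj 𝓕 w k l (koszul s k x)
  | 0, _, _ => (map_zero (chainProj 𝓕 w 0 _)).symm
  | k + 1, l, x => by
    obtain ⟨a, b, rfl⟩ := x.exists_mk
    rw [chainProj_mk, koszul_mk, koszul_mk, chainProj_mk, map_add, map_neg,
      koszul_chainProj hp k, koszul_chainProj hp k, chainProj_smul 𝓕 w (hp k)]

/-- A chain of positive exterior degree which is a cycle up to terms of lower degree is a boundary
up to terms of lower degree. -/
theorem koszul_exact_filtered {M : ℕ} (hs : RegularSeq s M)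
    (hp : ∀ k l x, 𝓕.proj l (s k * x) = s k * 𝓕.proj (l - w k) x) {l : ℤ} {x : Chain G M}
    (hx : x ∈ chainLt 𝓕 w M (l + 1)) (hx₀ : Chain.scalar M x = 0)
    (hdx : koszul s M x ∈ chainLt 𝓕 w M l) :
    ∃ y ∈ chainLt 𝓕 w M (l + 1), Chain.NoScalarNoVector M y ∧
      x - koszul s M y ∈ chainLt 𝓕 w M l := by
  -- Only the leading component of x need be a Koszul cycle, so exactness is applied to that
  -- component alone.
  obtain ⟨y, hy, hxy⟩ := koszul_exact hs M le_rfl (chainProj 𝓕 w M l x)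
    (by rw [scalar_chainProj, hx₀, map_zero])
    (by rw [koszul_chainProj 𝓕 w hp, chainProj_eq_zero 𝓕 w M l hdx])
  refine ⟨chainProj 𝓕 w M l y, chainProj_mem 𝓕 w M l y, noScalarNoVector_chainProj 𝓕 w M l hy, ?_⟩
  rw [koszul_chainProj 𝓕 w hp, hxy, chainProj_chainProj]
  exact sub_chainProj_mem 𝓕 w M l hx

end Koszul

/-! ### The filtered comparison of the Spencer complex with the Koszul complex of symbols -/

section Comparison

variable {A R : Type} [CommRing A] [Ring R] [Module A R] [IsScalarTower A R R] [Algebra ℂ R]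
variable {L : Submodule A R} (hL : IsLieRinehart L)
variable {G : Type} [CommRing G] (𝓕 : GradedFiltration G) (Q : G ≃+ R) (r : ℕ → L) (s : ℕ → G)
  (w : ℕ → ℕ) (M : ℕ)

/-- The additive bijection `Q` from symbols to operators turns the multiplication by `s k` into the
right multiplication by `r k` up to terms of lower degree, where `r 0, …, r (M - 1)` generate `L`
and have degrees `w 0, …, w (M - 1)`, which the bracket lowers. -/
structure IsQuantization : Prop where
  mul_gen : ∀ k < M, ∀ (l : ℤ), ∀ g ∈ 𝓕.lt (l + 1),
    ∃ z ∈ 𝓕.lt (l + w k), Q g * (r k : R) - Q (s k * g) = Q z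
  mul_base : ∀ (a : A) (l : ℤ), ∀ g ∈ 𝓕.lt l, ∃ z ∈ 𝓕.lt l, Q g * (a • (1 : R)) = Q z
  bracket : ∀ i < M, ∀ j < M, ∃ c : ℕ → A,
    hL.bracket (r i) (r j) = ∑ k ∈ Finset.range M, c k • r k ∧
      ∀ k < M, c k ≠ 0 → w k + 1 ≤ w i + w j
  span : ∀ x : L, ∃ c : ℕ → A, x = ∑ k ∈ Finset.range M, c k • r k
  dual : ∃ φ : ℕ → L →ₗ[A] A, ∀ i < M, ∀ j < M, φ i (r j) = if i = j then 1 else 0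
  symbol_homogeneous : ∀ k l x, 𝓕.proj l (s k * x) = s k * 𝓕.proj (l - w k) x
  symbol_regular : RegularSeq s M

/-- The additive map that sends `g e_{i₁} ∧ ⋯ ∧ e_{iₑ}` to `Q g ⊗ (r i₁ ∧ ⋯ ∧ r iₑ)`. -/
def quant : ∀ k, Chain G k →+ SpencerTotal L
  | 0 => scalarT.comp Q.toAddMonoidHom
  | k + 1 => (quant k).coprod ((wedgeT (r k)).toAddMonoidHom.comp (quant k))

theorem quant_mk {k : ℕ} (a b : Chain G k) :
    quant Q r (k + 1) (Chain.mk a b) = quant Q r k a + wedgeT (r k) (quant Q r k b) := rfl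

theorem quant_apply_zero : ∀ (k : ℕ) (x : Chain G k),
    quant Q r k x 0 = spencerTmul (Q (Chain.scalar k x)) Fin.elim0
  | 0, _ => rfl
  | k + 1, x => by
    obtain ⟨a, b, rfl⟩ := x.exists_mk
    rw [quant_mk, Pi.add_apply, wedgeT_zero, add_zero, quant_apply_zero k a]
    rfl

theorem scalar_eq_zero_iff (k : ℕ) (x : Chain G k) :
    Chain.scalar k x = 0 ↔ quant Q r k x 0 = 0 := by
  rw [quant_apply_zero, ← scalarT_zero]
  constructor
  · intro h
    rw [h, map_zero, map_zero, Pi.zero_apply]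
  · intro h
    have h2 : (scalarT (Q (Chain.scalar k x)) : SpencerTotal L) = scalarT 0 := by
      ext e
      cases e with
      | zero => rw [h, map_zero, Pi.zero_apply]
      | succ e => rfl
    simpa using scalarT_injective h2

/-- This guarantees that the Spencer boundary of such an element has no component in degree 0, so
correcting a cycle by it preserves the vanishing of its scalar part. -/
theorem quant_apply_one : ∀ (k : ℕ) {x : Chain G k}, Chain.NoScalarNoVector k x →
    quant Q r k x 1 = 0
  | 0, _, _ => rfl
  | k + 1, x, h => by
    obtain ⟨a, b, rfl⟩ := x.exists_mk
    rw [quant_mk, Pi.add_apply, wedgeT_succ, (scalar_eq_zero_iff Q r k b).1 h.2, map_zero, add_zero]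
    exact quant_apply_one k h.1

theorem scalarT_mem_finT (P : R) : scalarT P ∈ finT L := monoT_mem_finT P []

theorem quant_mem_finT : ∀ (k : ℕ) (x : Chain G k), quant Q r k x ∈ finT L
  | 0, _ => scalarT_mem_finT _
  | k + 1, x => add_mem (quant_mem_finT k x.1) (wedgeT_mem_finT _ (quant_mem_finT k x.2))

variable {hL 𝓕 Q r s w M}

theorem contrT_quant {φ : L →ₗ[A] A} : ∀ (k : ℕ), (∀ j < k, φ (r j) = 0) → ∀ x : Chain G k,
    contrT φ (quant Q r k x) = 0
  | 0, _, _ => contrT_scalarT φ _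
  | k + 1, h, x => by
    have ih := contrT_quant k fun j hj => h j (by omega)
    obtain ⟨a, b, rfl⟩ := x.exists_mk
    rw [quant_mk, map_add, contrT_wedgeT, ih, ih, h k (by omega), zero_smul, map_zero, sub_zero,
      add_zero]

namespace IsQuantization

variable (H : IsQuantization hL 𝓕 Q r s w M)

include H in
-- Contraction with the form dual to r_k kills everything built from the earlier generators, so it
-- recovers b from a + r_k ∧ b. Hence b = 0, and then a = 0 by induction.
theorem quant_injective : ∀ k ≤ M, Function.Injective (quant Q r k)
  | 0, _ => scalarT_injective.comp Q.injective
  | k + 1, hk => by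
    obtain ⟨φ, hφ⟩ := H.dual
    rw [injective_iff_map_eq_zero]
    intro x hx
    obtain ⟨a, b, rfl⟩ := x.exists_mk
    have hc := contrT_quant (Q := Q) (r := r) (φ := φ k) k fun j hj => by
      rw [hφ k (by omega) j (by omega), if_neg (by omega)]
    have ih := (injective_iff_map_eq_zero _).1 (quant_injective k (by omega))
    have hb : b = 0 := by
      apply ih
      have h := congrArg (contrT (φ k)) hx
      rwa [quant_mk, map_add, contrT_wedgeT, hc, hc, hφ k (by omega) k (by omega), if_pos rfl,
        one_smul, map_zero, sub_zero, zero_add, map_zero] at h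
    rw [quant_mk, hb, map_zero, map_zero, add_zero] at hx
    rw [ih a hx, hb, Chain.mk_zero]

end IsQuantization

variable (𝓕 Q r w) in
/-- The elements of degree less than `l` of the total complex. -/
def levelT (M : ℕ) (l : ℤ) : AddSubgroup (SpencerTotal L) :=
  (chainLt 𝓕 w M l).map (quant Q r M)

theorem levelT_mono : Monotone (levelT 𝓕 Q r w M) := fun _ _ h =>
  AddSubgroup.map_mono (chainLt_mono 𝓕 w M h)

theorem levelT_le_levelT {k : ℕ} (hk : k ≤ M) (l : ℤ) :
    levelT 𝓕 Q r w k l ≤ levelT 𝓕 Q r w M l := by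
  induction M, hk using Nat.le_induction with
  | base => exact le_rfl
  | succ M hM ih =>
    refine ih.trans ?_
    rintro _ ⟨x, hx, rfl⟩
    exact ⟨Chain.mk x 0, ⟨hx, zero_mem _⟩, by rw [quant_mk, map_zero, map_zero, add_zero]⟩

/-- The factor r_j is sorted into its place: it anticommutes with the later generators, and it kills
the part that already contains it. -/
theorem wedgeT_mem_levelT {j : ℕ} : ∀ {k : ℕ}, j < k → ∀ {l : ℤ} {t : SpencerTotal L},
    t ∈ levelT 𝓕 Q r w k l → wedgeT (r j) t ∈ levelT 𝓕 Q r w k (l + w j)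
  | 0, hj, _, _, _ => by omega
  | k + 1, hj, l, t, ht => by
    obtain ⟨x, hx, rfl⟩ := ht
    obtain ⟨a, b, rfl⟩ := x.exists_mk
    obtain ⟨ha, hb⟩ := (mk_mem_chainLt 𝓕 w).1 hx
    rw [quant_mk, map_add]
    rcases Nat.lt_succ_iff_lt_or_eq.1 hj with hj | rfl
    · obtain ⟨a', ha', ha''⟩ := wedgeT_mem_levelT hj ⟨a, ha, rfl⟩
      obtain ⟨b', hb', hb''⟩ := wedgeT_mem_levelT hj ⟨b, hb, rfl⟩
      refine ⟨Chain.mk a' (-b'), (mk_mem_chainLt 𝓕 w).2 ⟨ha', neg_mem ?_⟩, ?_⟩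
      · rwa [← sub_add_eq_add_sub]
      · rw [quant_mk, map_neg, map_neg, ha'', hb'', wedgeT_wedgeT (r j) (r k)]
    · refine ⟨Chain.mk 0 a, (mk_mem_chainLt 𝓕 w).2 ⟨zero_mem _, ?_⟩, ?_⟩
      · rwa [add_sub_cancel_right]
      · rw [quant_mk, map_zero, zero_add, wedgeT_self, add_zero]

namespace IsQuantization

variable (H : IsQuantization hL 𝓕 Q r s w M)
include H

/-- The base ring acts through right multiplication on P, so this is not formal: it rests on
`mul_base`. -/
theorem smul_mem_levelT (a : A) : ∀ {k : ℕ} {l : ℤ} {t : SpencerTotal L},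
    t ∈ levelT 𝓕 Q r w k l → a • t ∈ levelT 𝓕 Q r w k l
  | 0, l, t, ht => by
    obtain ⟨g, hg, rfl⟩ := ht
    obtain ⟨z, hz, hz'⟩ := H.mul_base a l g hg
    refine ⟨z, hz, ?_⟩
    change scalarT (Q z) = a • scalarT (Q g)
    rw [smul_scalarT, hz']
  | k + 1, l, t, ht => by
    obtain ⟨x, hx, rfl⟩ := ht
    obtain ⟨p, q, rfl⟩ := x.exists_mk
    obtain ⟨hp, hq⟩ := (mk_mem_chainLt 𝓕 w).1 hx
    obtain ⟨p', hp', hp''⟩ := smul_mem_levelT a ⟨p, hp, rfl⟩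
    obtain ⟨q', hq', hq''⟩ := smul_mem_levelT a ⟨q, hq, rfl⟩
    refine ⟨Chain.mk p' q', (mk_mem_chainLt 𝓕 w).2 ⟨hp', hq'⟩, ?_⟩
    rw [quant_mk, quant_mk, hp'', hq'', smul_add, map_smul]

omit H in
theorem wedgeT_sum (c : ℕ → A) (t : SpencerTotal L) :
    wedgeT (∑ k ∈ Finset.range M, c k • r k) t =
      ∑ k ∈ Finset.range M, wedgeT (r k) (c k • t) := by
  rw [← wedgeLeft_apply, map_sum]
  exact Finset.sum_congr rfl fun k _ => wedgeT_smul _ _ _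

theorem exists_quant_wedgeT (x : L) (y : Chain G M) :
    ∃ z, quant Q r M z = wedgeT x (quant Q r M y) := by
  obtain ⟨l, hl⟩ := exists_mem_chainLt 𝓕 w M y
  obtain ⟨c, rfl⟩ := H.span x
  rw [wedgeT_sum]
  have h : ∀ k ∈ Finset.range M, wedgeT (r k) (c k • quant Q r M y) ∈ (quant Q r M).range := by
    intro k hk
    obtain ⟨z, -, hz⟩ := wedgeT_mem_levelT (Finset.mem_range.1 hk)
      (H.smul_mem_levelT (c k) ⟨y, hl, rfl⟩)
    exact ⟨z, hz⟩
  exact sum_mem h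

/-- Together with `quant_injective` and `quant_mem_finT`, this identifies Koszul chains with the
elements of finite support. -/
theorem exists_quant_eq {t : SpencerTotal L} (ht : t ∈ finT L) : ∃ z, quant Q r M z = t := by
  suffices h : finT L ≤ (quant Q r M).range from h ht
  rw [finT, AddSubgroup.closure_le]
  rintro _ ⟨P, l, rfl⟩
  induction l with
  | nil =>
    obtain ⟨z, -, hz⟩ := levelT_le_levelT (𝓕 := 𝓕) (Q := Q) (r := r) (w := w) (Nat.zero_le M)
      ((𝓕.exhaust (Q.symm P)).choose : ℤ)
      ⟨Q.symm P, (𝓕.exhaust (Q.symm P)).choose_spec, rfl⟩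
    exact ⟨z, hz.trans (congrArg scalarT (Q.apply_symm_apply P))⟩
  | cons x l ih =>
    obtain ⟨y, hy⟩ := ih
    obtain ⟨z, hz⟩ := H.exists_quant_wedgeT x y
    exact ⟨z, by rw [hz, hy, monoT_cons]⟩

/-- On scalars this is `mul_gen`. Passing a factor r_k creates the extra term [r_j, r_k], which is
of lower degree by the bracket condition. -/
theorem lieT_sub_mem {j : ℕ} (hj : j < M) : ∀ k ≤ M, ∀ (l : ℤ) (x : Chain G k),
    x ∈ chainLt 𝓕 w k (l + 1) →
      lieT hL (r j) (quant Q r k x) - quant Q r k (s j • x) ∈ levelT 𝓕 Q r w M (l + w j)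
  | 0, _, l, g, hg => by
    obtain ⟨z, hz, hz'⟩ := H.mul_gen j hj l g hg
    refine levelT_le_levelT (Nat.zero_le M) _ ⟨z, hz, ?_⟩
    change scalarT (Q z) = lieT hL (r j) (scalarT (Q g)) - scalarT (Q (s j * (show G from g)))
    rw [← hz', lieT_scalarT, map_sub]
  | k + 1, hk, l, x, hx => by
    obtain ⟨a, b, rfl⟩ := x.exists_mk
    obtain ⟨ha, hb⟩ := (mk_mem_chainLt 𝓕 w).1 hx
    have hb' : b ∈ chainLt 𝓕 w k (l - w k + 1) := by rwa [sub_add_eq_add_sub]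
    have iha := lieT_sub_mem hj k (by omega) l a ha
    have ihb := lieT_sub_mem hj k (by omega) (l - w k) b hb'
    have hbq : quant Q r k b ∈ levelT 𝓕 Q r w M (l + 1 - w k) :=
      levelT_le_levelT (by omega) _ ⟨b, hb, rfl⟩
    have h₁ := wedgeT_mem_levelT (show k < M by omega) ihb
    rw [sub_add_eq_add_sub, sub_add_cancel] at h₁
    have h₂ : wedgeT (hL.bracket (r j) (r k)) (quant Q r k b) ∈
        levelT 𝓕 Q r w M (l + w j) := by
      obtain ⟨c, hc, hc'⟩ := H.bracket j hj k (by omega)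
      rw [hc, wedgeT_sum]
      refine sum_mem fun i hi => ?_
      have hi' := Finset.mem_range.1 hi
      by_cases h0 : c i = 0
      · rw [h0, zero_smul, map_zero]
        exact zero_mem _
      · have := hc' i hi' h0
        -- The bound w i + 1 ≤ w j + w k gives l + 1 - w k + w i ≤ l + w j: the unit drop of the
        -- bracket absorbs the shift from l to l + 1.
        exact levelT_mono (by omega) (wedgeT_mem_levelT hi' (H.smul_mem_levelT (c i) hbq))
    rw [Chain.smul_mk, quant_mk, quant_mk, map_add, lieT_wedgeT hL _ _ (quant_mem_finT Q r k b)]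
    have e : ∀ p q u v x : SpencerTotal L,
        p + (q - u) - (v + x) = p - v + (q - x) - u := fun p q u v x => by abel
    rw [e, ← map_sub]
    exact sub_mem (add_mem iha h₁) h₂

/-- On a + r_k ∧ b, Cartan's formula gives da + L b - r_k ∧ db with L the Lie derivative along r_k.
The Koszul differential has the same shape with s_k b in place of L b, and `lieT_sub_mem` compares
the two. -/
theorem diffT_sub_mem : ∀ k ≤ M, ∀ (l : ℤ) (x : Chain G k), x ∈ chainLt 𝓕 w k (l + 1) →
    diffT hL (quant Q r k x) - quant Q r k (koszul s k x) ∈ levelT 𝓕 Q r w M l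
  | 0, _, l, g, hg => by
    rw [koszul_zero, map_zero, sub_zero]
    exact (diffT_scalarT hL (Q g)).symm ▸ zero_mem _
  | k + 1, hk, l, x, hx => by
    obtain ⟨a, b, rfl⟩ := x.exists_mk
    obtain ⟨ha, hb⟩ := (mk_mem_chainLt 𝓕 w).1 hx
    rw [← sub_add_eq_add_sub] at hb
    have iha := diffT_sub_mem k (by omega) l a ha
    have ihb := diffT_sub_mem k (by omega) (l - w k) b hb
    have h₁ := wedgeT_mem_levelT (show k < M by omega) ihb
    have h₂ := H.lieT_sub_mem (show k < M by omega) k (by omega) (l - w k) b hb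
    rw [sub_add_cancel] at h₁ h₂
    rw [quant_mk, koszul_mk, quant_mk, map_add, map_add, map_neg, map_neg, diffT_wedgeT]
    have e : ∀ p q u v x y : SpencerTotal L,
        p + (q - u) - (v + x + -y) = p - v + (q - x) - (u - y) := fun p q u v x y => by abel
    rw [e, ← map_sub (wedgeT (r k))]
    exact sub_mem (add_mem iha h₂) h₁

/-- Induction on the degree of the cycle: its leading part is a Koszul boundary, and subtracting the
corresponding Spencer boundary leaves a cycle of smaller degree. -/
theorem exists_diffT_quant_eq (l : ℕ) : ∀ x ∈ chainLt 𝓕 w M l, Chain.scalar M x = 0 →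
    diffT hL (quant Q r M x) = 0 → ∃ y, diffT hL (quant Q r M y) = quant Q r M x := by
  induction l with
  | zero =>
    intro x hx _ _
    exact ⟨0, by rw [eq_zero_of_mem_chainLt 𝓕 w M le_rfl hx, map_zero, map_zero]⟩
  | succ l ih =>
    intro x hx hx₀ hdx
    have hinj := H.quant_injective M le_rfl
    push_cast at hx
    -- As the Spencer differential of x vanishes, the comparison error is, up to sign, the Koszul
    -- boundary itself; injectivity of `quant` transfers the bound to chains.
    have hk : koszul s M x ∈ chainLt 𝓕 w M l := by
      have h := neg_mem (H.diffT_sub_mem M le_rfl l x hx)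
      rw [hdx, zero_sub, neg_neg] at h
      obtain ⟨z, hz, hz'⟩ := h
      rwa [← hinj hz']
    obtain ⟨y, hy, hy', hxy⟩ := koszul_exact_filtered 𝓕 w H.symbol_regular H.symbol_homogeneous
      hx hx₀ hk
    obtain ⟨z, hz, hz'⟩ := H.diffT_sub_mem M le_rfl l y hy
    have hq : quant Q r M (x - koszul s M y - z) =
        quant Q r M x - diffT hL (quant Q r M y) := by
      rw [map_sub, map_sub, hz']
      abel
    obtain ⟨y', h'⟩ := ih (x - koszul s M y - z) (sub_mem hxy hz) (by
      rw [scalar_eq_zero_iff Q r, hq, Pi.sub_apply, (scalar_eq_zero_iff Q r M x).1 hx₀, diffT_apply,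
        quant_apply_one Q r M hy', map_zero, sub_zero]) (by
      rw [hq, map_sub, hdx, diffT_diffT hL (quant_mem_finT Q r M y), sub_zero])
    exact ⟨y' + y, by rw [map_add, map_add, h', hq, sub_add_cancel]⟩

/-- The Spencer complex is exact in negative degrees if the symbols form a regular sequence. -/
theorem exact_spencerDiff (e : ℕ) :
    Function.Exact (spencerDiff hL (e + 1)) (spencerDiff hL e) := by
  intro u
  constructor
  · intro hu
    obtain ⟨x, hx⟩ := H.exists_quant_eq (single_mem_finT u)
    obtain ⟨l, hl⟩ := exists_mem_chainLt 𝓕 w M x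
    obtain ⟨y, hy⟩ := H.exists_diffT_quant_eq l x hl
      (by rw [scalar_eq_zero_iff Q r, hx, Pi.single_eq_of_ne (by simp)]) (by
        rw [hx]
        ext n
        rw [diffT_apply]
        by_cases h : n = e
        · subst h
          rw [Pi.single_eq_same, hu, Pi.zero_apply]
        · rw [Pi.single_eq_of_ne (by simpa using h), map_zero, Pi.zero_apply])
    -- The primitive need not be homogeneous in exterior degree; only its component in degree e + 2
    -- matters.
    refine ⟨quant Q r M y (e + 2), ?_⟩
    rw [← diffT_apply, hy, hx, Pi.single_eq_same]
  · rintro ⟨v, rfl⟩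
    have h := congrFun (diffT_diffT hL (single_mem_finT v)) e
    rwa [diffT_apply, diffT_apply, Pi.single_eq_same] at h

end IsQuantization

end Comparison

open MvPolynomial

/-! ### The filtration of a polynomial ring by the degree -/

section DegreeFiltration

variable (σ B : Type) [CommRing B]

/-- The polynomials of degree less than `l`. -/
def degreeLt (l : ℤ) : AddSubgroup (MvPolynomial σ B) where
  carrier := {g | ∀ α : σ →₀ ℕ, l ≤ α.degree → coeff α g = 0}
  zero_mem' := fun _ _ => coeff_zero _
  add_mem' := fun hf hg α h => by rw [coeff_add, hf α h, hg α h, add_zero]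
  neg_mem' := fun hf α h => by rw [coeff_neg, hf α h, neg_zero]

variable {σ B}

/-- The homogeneous component with index an integer. -/
def degreeProj (l : ℤ) : MvPolynomial σ B →+ MvPolynomial σ B :=
  if 0 ≤ l then (homogeneousComponent l.toNat).toAddMonoidHom else 0

theorem coeff_degreeProj (l : ℤ) (g : MvPolynomial σ B) (α : σ →₀ ℕ) :
    coeff α (degreeProj l g) = if (α.degree : ℤ) = l then coeff α g else 0 := by
  unfold degreeProj
  by_cases h : 0 ≤ l
  · rw [if_pos h]
    simp only [LinearMap.toAddMonoidHom_coe, coeff_homogeneousComponent]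
    congr 1
    simp only [eq_iff_iff]
    omega
  · rw [if_neg h, if_neg (by omega)]
    simp

theorem degreeProj_mul {s : MvPolynomial σ B} {n : ℕ} (hs : s.IsHomogeneous n) (l : ℤ)
    (x : MvPolynomial σ B) : degreeProj l (s * x) = s * degreeProj (l - n) x := by
  classical
  ext α
  have key : ∀ x' ∈ Finset.HasAntidiagonal.antidiagonal α,
      coeff x'.1 s * coeff x'.2 (degreeProj (l - n) x) =
      if (α.degree : ℤ) = l then coeff x'.1 s * coeff x'.2 x else 0 := by
    intro x' hx'
    rw [Finset.HasAntidiagonal.mem_antidiagonal] at hx'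
    by_cases h : coeff x'.1 s = 0
    · simp [h]
    · have h1 : x'.1.degree = n := by
        by_contra h'
        exact h (hs.coeff_eq_zero h')
      have h2 : (α.degree : ℤ) = n + x'.2.degree := by rw [← hx', map_add, h1]; push_cast; rfl
      rw [coeff_degreeProj, h2, mul_ite, mul_zero]
      congr 1
      simp only [eq_iff_iff]
      omega
  rw [coeff_degreeProj, coeff_mul, coeff_mul, Finset.sum_congr rfl key]
  split_ifs <;> simp

variable (σ B) in
/-- The filtration of a polynomial ring by the degree. -/
def degreeFiltration : GradedFiltration (MvPolynomial σ B) where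
  lt := degreeLt σ B
  proj := degreeProj
  mono l l' h g hg α hα := hg α (h.trans hα)
  lt_zero := by
    ext g
    rw [AddSubgroup.mem_bot]
    constructor
    · intro h
      ext α
      rw [h α (by positivity), coeff_zero]
    · rintro rfl
      exact zero_mem _
  exhaust g := ⟨g.totalDegree + 1, fun α hα => by
    apply coeff_eq_zero_of_totalDegree_lt
    rw [Finsupp.degree_apply] at hα
    omega⟩
  proj_proj l g := by
    ext α
    simp only [coeff_degreeProj]
    split_ifs <;> rfl
  proj_mem l g α hα := by
    rw [coeff_degreeProj, if_neg (by omega)]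
  sub_proj_mem l g hg α hα := by
    rw [coeff_sub, coeff_degreeProj]
    split_ifs with h
    · exact sub_self _
    · rw [hg α (by omega), sub_zero]
  proj_eq_zero l g hg := by
    ext α
    rw [coeff_degreeProj, coeff_zero]
    split_ifs with h
    · exact hg α h.ge
    · rfl

theorem mul_mem_degreeLt {s g : MvPolynomial σ B} {n : ℕ} (hs : s.IsHomogeneous n) {l : ℤ}
    (hg : g ∈ degreeLt σ B l) : s * g ∈ degreeLt σ B (l + n) := by
  classical
  intro α hα
  rw [coeff_mul]
  refine Finset.sum_eq_zero fun x hx => ?_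
  rw [Finset.HasAntidiagonal.mem_antidiagonal] at hx
  by_cases h : coeff x.1 s = 0
  · rw [h, zero_mul]
  · have h1 : x.1.degree = n := by
      by_contra h'
      exact h (hs.coeff_eq_zero h')
    rw [hg x.2, mul_zero]
    rw [← hx, map_add, h1] at hα
    push_cast at hα
    omega

theorem pderiv_mem_degreeLt (i : σ) {g : MvPolynomial σ B} {l : ℤ}
    (hg : g ∈ degreeLt σ B (l + 1)) : pderiv i g ∈ degreeLt σ B l := by
  classical
  intro α hα
  rw [coeff_pderiv, hg, zero_mul]
  rw [map_add, Finsupp.degree_single]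
  push_cast
  omega

end DegreeFiltration

/-! ### Normal ordering of differential operators -/

section Weyl

variable {N : ℕ}

local notation "𝔸" => MvPolynomial (Fin N) ℂ

theorem Weyl.ext {P P' : Weyl N} (h : ∀ f, P.toEnd f = P'.toEnd f) : P = P' :=
  Subtype.ext (LinearMap.ext h)

theorem Weyl.toEnd_mul (P P' : Weyl N) (f : 𝔸) : (P * P').toEnd f = P.toEnd (P'.toEnd f) := rfl

theorem Weyl.toEnd_add (P P' : Weyl N) (f : 𝔸) : (P + P').toEnd f = P.toEnd f + P'.toEnd f := rfl

theorem Weyl.toEnd_smul (a : 𝔸) (P : Weyl N) (f : 𝔸) : (a • P).toEnd f = a * P.toEnd f := rfl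

theorem toEnd_opOfPoly (a f : 𝔸) : (opOfPoly a).toEnd f = a * f := rfl

theorem toEnd_opOfDer (δ : Derivation ℂ 𝔸 𝔸) (f : 𝔸) : (opOfDer δ).toEnd f = δ f := rfl

theorem opOfPoly_mul (a : 𝔸) (P : Weyl N) : opOfPoly a * P = a • P := rfl

theorem smul_one_eq_opOfPoly (a : 𝔸) : a • (1 : Weyl N) = opOfPoly a := by
  rw [← opOfPoly_mul, mul_one]

theorem opOfPoly_C (c : ℂ) : opOfPoly (C c : 𝔸) = algebraMap ℂ (Weyl N) c := by
  apply Weyl.ext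
  intro f
  rw [toEnd_opOfPoly, ← smul_eq_C_mul]
  rfl

theorem opOfPoly_add (a b : 𝔸) : opOfPoly (a + b) = opOfPoly a + opOfPoly b := by
  simp only [← smul_one_eq_opOfPoly, add_smul]

theorem opOfPoly_mul_opOfPoly (a b : 𝔸) : opOfPoly (a * b) = opOfPoly a * opOfPoly b := by
  rw [opOfPoly_mul, ← smul_one_eq_opOfPoly, mul_smul, smul_one_eq_opOfPoly b]

theorem opOfDer_mul_opOfPoly (δ : Derivation ℂ 𝔸 𝔸) (a : 𝔸) :
    opOfDer δ * opOfPoly a = opOfPoly a * opOfDer δ + opOfPoly (δ a) := by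
  apply Weyl.ext
  intro f
  simp only [Weyl.toEnd_mul, Weyl.toEnd_add, toEnd_opOfPoly, toEnd_opOfDer, Derivation.leibniz,
    smul_eq_mul]
  ring

theorem opOfDer_lie (δ δ' : Derivation ℂ 𝔸 𝔸) : opOfDer ⁅δ, δ'⁆ = ⁅opOfDer δ, opOfDer δ'⁆ := by
  apply Weyl.ext
  intro f
  rw [toEnd_opOfDer, Derivation.commutator_apply]
  rfl

theorem opOfDer_add (δ δ' : Derivation ℂ 𝔸 𝔸) : opOfDer (δ + δ') = opOfDer δ + opOfDer δ' := rfl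

theorem opOfDer_smul (a : 𝔸) (δ : Derivation ℂ 𝔸 𝔸) : opOfDer (a • δ) = a • opOfDer δ := rfl

/-- `δ ↦ δ` as a linear map from vector fields to differential operators. -/
def opOfDerₗ : Derivation ℂ 𝔸 𝔸 →ₗ[𝔸] Weyl N where
  toFun := opOfDer
  map_add' := opOfDer_add
  map_smul' := opOfDer_smul

theorem derivation_eq_sum (δ : Derivation ℂ 𝔸 𝔸) : δ = ∑ i, δ (X i) • pderiv i := by
  apply MvPolynomial.derivation_ext
  intro j
  rw [← Derivation.coeFnAddMonoidHom_apply (∑ i, δ (X i) • pderiv i), map_sum,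
    Finset.sum_apply, Finset.sum_eq_single j]
  · simp
  · intro i _ hij
    simp [pderiv_X_of_ne hij.symm]
  · simp

/-- The partial derivative as a differential operator. -/
def partialOp (i : Fin N) : Weyl N := opOfDer (pderiv i)

theorem opOfDer_eq_sum (δ : Derivation ℂ 𝔸 𝔸) : opOfDer δ = ∑ i, δ (X i) • partialOp i := by
  conv_lhs => rw [derivation_eq_sum δ]
  change opOfDerₗ _ = _
  rw [map_sum]
  rfl

theorem partialOp_commute (i j : Fin N) : partialOp i * partialOp j = partialOp j * partialOp i := by
  have h : ⁅(pderiv i : Derivation ℂ 𝔸 𝔸), (pderiv j : Derivation ℂ 𝔸 𝔸)⁆ = 0 := by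
    apply MvPolynomial.derivation_ext
    intro k
    classical
    rw [Derivation.commutator_apply, pderiv_X, pderiv_X]
    simp [Pi.single_apply, apply_ite]
  have h2 := opOfDer_lie (pderiv i : Derivation ℂ 𝔸 𝔸) (pderiv j)
  rw [h, Ring.lie_def] at h2
  exact (sub_eq_zero.1 h2.symm)

/-- The operators with constant coefficients. -/
def constCoeff (N : ℕ) : Subalgebra ℂ (Weyl N) :=
  Algebra.adjoin ℂ (Set.range partialOp)

/-- Polynomials in ξ can be evaluated at the partial derivatives only inside a commutative algebra,
which the Weyl algebra is not in general. -/
instance : IsMulCommutative (constCoeff N) :=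
  Algebra.isMulCommutative_adjoin ℂ (by
    rintro _ ⟨i, rfl⟩ _ ⟨j, rfl⟩
    exact partialOp_commute i j)

open scoped IsMulCommutative in
/-- The operator with a given constant-coefficient symbol. -/
def constOp : MvPolynomial (Fin N) ℂ →ₐ[ℂ] Weyl N :=
  (constCoeff N).val.comp
    (aeval fun i => (⟨partialOp i, Algebra.subset_adjoin ⟨i, rfl⟩⟩ : constCoeff N))

open scoped IsMulCommutative in
theorem constOp_X (i : Fin N) : constOp (X i) = partialOp i := by
  rw [constOp, AlgHom.comp_apply, aeval_X]
  rfl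

/-- The normally ordered operator `∑ a_α ∂^α` with full symbol `∑ a_α ξ^α`. -/
def normalOp : MvPolynomial (Fin N) 𝔸 →ₗ[𝔸] Weyl N :=
  (basisMonomials (Fin N) 𝔸).constr 𝔸 fun α => constOp (monomial α 1)

theorem normalOp_monomial (α : Fin N →₀ ℕ) (a : 𝔸) :
    normalOp (monomial α a) = a • constOp (monomial α 1) := by
  have h : monomial α a = a • basisMonomials (Fin N) 𝔸 α := by
    simp [coe_basisMonomials, smul_monomial]
  rw [h, map_smul, normalOp, Module.Basis.constr_basis]

theorem normalOp_C (a : 𝔸) : normalOp (C a) = opOfPoly a := by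
  rw [← monomial_zero', normalOp_monomial, monomial_zero', C_1, map_one, smul_one_eq_opOfPoly]

/-- Derivatives stand on the right in normal order, so there is no correction term. -/
theorem normalOp_mul_X (g : MvPolynomial (Fin N) 𝔸) (i : Fin N) :
    normalOp (g * X i) = normalOp g * partialOp i := by
  induction g using MvPolynomial.induction_on' with
  | monomial α a =>
    have h (B : Type) [CommRing B] (b : B) :
        monomial α b * X i = monomial (α + Finsupp.single i 1) b := by
      rw [X, monomial_mul, mul_one]
    rw [h, normalOp_monomial, normalOp_monomial, ← h, map_mul, constOp_X, smul_mul_assoc]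
  | add p q hp hq => rw [add_mul, map_add, hp, hq, map_add, add_mul]

/-- Moving a coordinate to the left past ∂^α differentiates the symbol in the dual variable ξ_i.
This drives both the leading-order estimate and the injectivity of normal ordering. -/
theorem normalOp_commutator (g : MvPolynomial (Fin N) 𝔸) (i : Fin N) :
    normalOp g * opOfPoly (X i) = normalOp (C (X i) * g + pderiv i g) := by
  induction g using MvPolynomial.induction_on with
  | C a =>
    rw [← map_mul, pderiv_C, add_zero, normalOp_C, normalOp_C, ← opOfPoly_mul_opOfPoly, mul_comm]
  | add p q hp hq =>
    rw [map_add normalOp, add_mul, hp, hq, ← map_add normalOp, map_add (pderiv i)]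
    exact congrArg normalOp (by ring)
  | mul_X p j hp =>
    have h : partialOp j * opOfPoly (X i) =
        opOfPoly (X i) * partialOp j + opOfPoly (pderiv j (X i)) := opOfDer_mul_opOfPoly _ _
    rw [normalOp_mul_X, mul_assoc, h, mul_add, ← mul_assoc, hp, ← normalOp_mul_X, Derivation.leibniz]
    classical
    rw [pderiv_X, pderiv_X]
    by_cases hij : i = j
    · subst hij
      rw [Pi.single_eq_same, Pi.single_eq_same, ← smul_one_eq_opOfPoly, one_smul, mul_one,
        ← map_add normalOp]
      refine congrArg normalOp ?_
      simp only [smul_eq_mul]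
      ring
    · rw [Pi.single_eq_of_ne hij, Pi.single_eq_of_ne (Ne.symm hij)]
      simp only [← smul_one_eq_opOfPoly, zero_smul, mul_zero, add_zero, smul_eq_mul, mul_zero,
        zero_add]
      exact congrArg normalOp (by ring)

/-- The polynomial is moved to the left one coordinate at a time; each move leaves a ξ-derivative of
the symbol, one degree lower. -/
theorem normalOp_mul_opOfPoly (a : 𝔸) : ∀ (l : ℤ), ∀ g ∈ degreeLt (Fin N) 𝔸 (l + 1),
    ∃ z ∈ degreeLt (Fin N) 𝔸 l, normalOp g * opOfPoly a - normalOp (C a * g) = normalOp z := by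
  induction a using MvPolynomial.induction_on with
  | C a =>
    intro l g hg
    refine ⟨0, zero_mem _, ?_⟩
    rw [← smul_eq_C_mul, map_smul, ← opOfPoly_mul, opOfPoly_C, (Algebra.commutes a _), sub_self,
      map_zero]
  | add a b ha hb =>
    intro l g hg
    obtain ⟨z, hz, hz'⟩ := ha l g hg
    obtain ⟨y, hy, hy'⟩ := hb l g hg
    refine ⟨z + y, add_mem hz hy, ?_⟩
    rw [map_add normalOp, ← hz', ← hy', opOfPoly_add, C_add, add_mul, map_add normalOp, mul_add]
    abel
  | mul_X a i ha =>
    intro l g hg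
    have h0 : C (X i) * g ∈ degreeLt (Fin N) 𝔸 (l + 1) := by
      simpa using mul_mem_degreeLt (isHomogeneous_C (Fin N) (X i : 𝔸)) hg
    have h1 := pderiv_mem_degreeLt i hg
    obtain ⟨z, hz, hz'⟩ := ha l _ h0
    obtain ⟨y, hy, hy'⟩ := ha (l - 1) (pderiv i g) (by rwa [sub_add_cancel])
    have h2 : C a * pderiv i g ∈ degreeLt (Fin N) 𝔸 l := by
      simpa using mul_mem_degreeLt (isHomogeneous_C (Fin N) a) h1
    refine ⟨z + y + C a * pderiv i g, add_mem (add_mem hz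
      ((degreeFiltration (Fin N) 𝔸).mono (by omega) hy)) h2, ?_⟩
    rw [map_add normalOp, map_add normalOp, ← hz', ← hy', mul_comm a, opOfPoly_mul_opOfPoly,
      ← mul_assoc, normalOp_commutator, map_add normalOp, add_mul, ← mul_assoc, ← C_mul, mul_comm a]
    abel

/-- If the operator vanishes, so does its commutator with each coordinate, and the ξ-derivatives of
the symbol vanish by induction on the degree. In characteristic 0 the symbol is then a function,
recovered by applying the operator to 1. -/
theorem normalOp_injective : Function.Injective (normalOp (N := N)) := by
  rw [injective_iff_map_eq_zero]
  suffices h : ∀ (n : ℕ), ∀ g ∈ degreeLt (Fin N) 𝔸 n, normalOp g = 0 → g = 0 by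
    intro g hg
    obtain ⟨n, hn⟩ := (degreeFiltration (Fin N) 𝔸).exhaust g
    exact h n g hn hg
  intro n
  induction n with
  | zero =>
    intro g hg _
    have h : g ∈ (degreeFiltration (Fin N) 𝔸).lt 0 := hg
    rwa [(degreeFiltration (Fin N) 𝔸).lt_zero] at h
  | succ n ih =>
    intro g hg h
    have hd : ∀ i, pderiv i g = 0 := by
      intro i
      apply ih _ (pderiv_mem_degreeLt i (by exact_mod_cast hg))
      have h2 := normalOp_commutator g i
      rwa [h, zero_mul, map_add, ← smul_eq_C_mul, map_smul, h, smul_zero, zero_add, eq_comm] at h2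
    have hC : g = C (coeff 0 g) := by
      ext1 α
      classical
      rw [coeff_C]
      split_ifs with h0
      · rw [h0]
      · obtain ⟨i, hi⟩ : ∃ i, α i ≠ 0 := by
          by_contra! h'
          exact h0 (by ext i; simp [h' i])
        have h1 := coeff_pderiv g (i := i) (α - Finsupp.single i 1)
        rw [hd i, coeff_zero, tsub_add_cancel_of_le (by
          rw [Finsupp.single_le_iff]; omega)] at h1
        exact (mul_eq_zero.1 h1.symm).resolve_right (Nat.cast_add_one_ne_zero _)
    rw [hC, normalOp_C] at h
    have h1 : (opOfPoly (coeff 0 g)).toEnd 1 = 0 := by rw [h]; rfl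
    rw [toEnd_opOfPoly, mul_one] at h1
    rw [hC, h1, map_zero]

theorem exists_normalOp_eq_mul (a : 𝔸) (g : MvPolynomial (Fin N) 𝔸) :
    ∃ z, normalOp g * opOfPoly a = normalOp z := by
  obtain ⟨n, hn⟩ := (degreeFiltration (Fin N) 𝔸).exhaust g
  obtain ⟨z, -, hz⟩ := normalOp_mul_opOfPoly a n g
    ((degreeFiltration (Fin N) 𝔸).mono (by omega) hn)
  exact ⟨z + C a * g, by rw [map_add, ← hz, sub_add_cancel]⟩

/-- The range contains 1 and is stable under right multiplication by functions and partial
derivatives, which generate the ring. -/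
theorem normalOp_surjective : Function.Surjective (normalOp (N := N)) := by
  have key : ∀ (P : Module.End ℂ 𝔸) (hP : P ∈ weylSubalgebra N) (g : MvPolynomial (Fin N) 𝔸),
      ∃ z, normalOp g * (show Weyl N from ⟨P, hP⟩) = normalOp z := by
    intro P hP
    induction hP using Algebra.adjoin_induction with
    | mem P hP =>
      intro g
      rcases hP with ⟨a, rfl⟩ | ⟨i, rfl⟩
      · exact exists_normalOp_eq_mul a g
      · exact ⟨g * X i, (normalOp_mul_X g i).symm⟩
    | algebraMap c =>
      intro g
      refine ⟨C (C c) * g, ?_⟩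
      rw [← smul_eq_C_mul, map_smul, ← opOfPoly_mul, opOfPoly_C, Algebra.commutes]
      rfl
    | add P P' hP hP' ih ih' =>
      intro g
      obtain ⟨z, hz⟩ := ih g
      obtain ⟨z', hz'⟩ := ih' g
      exact ⟨z + z', by rw [map_add, ← hz, ← hz', ← mul_add]; rfl⟩
    | mul P P' hP hP' ih ih' =>
      intro g
      obtain ⟨z, hz⟩ := ih g
      obtain ⟨z', hz'⟩ := ih' z
      exact ⟨z', by rw [← hz', ← hz, mul_assoc]; rfl⟩
  intro P
  obtain ⟨z, hz⟩ := key P.1 P.2 1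
  refine ⟨z, ?_⟩
  rw [← hz, ← C_1, normalOp_C, opOfPoly_mul, one_smul]
  rfl

/-- The bijection between full symbols and differential operators. -/
def normalOpEquiv : MvPolynomial (Fin N) 𝔸 ≃+ Weyl N :=
  AddEquiv.ofBijective normalOp ⟨normalOp_injective, normalOp_surjective⟩

theorem normalOp_mul_base (a : 𝔸) (l : ℤ) {g : MvPolynomial (Fin N) 𝔸}
    (hg : g ∈ degreeLt (Fin N) 𝔸 l) :
    ∃ z ∈ degreeLt (Fin N) 𝔸 l, normalOp g * (a • (1 : Weyl N)) = normalOp z := by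
  obtain ⟨z, hz, hz'⟩ := normalOp_mul_opOfPoly a (l - 1) g (by rwa [sub_add_cancel])
  have h2 : C a * g ∈ degreeLt (Fin N) 𝔸 l := by
    simpa using mul_mem_degreeLt (isHomogeneous_C (Fin N) a) hg
  exact ⟨z + C a * g, add_mem ((degreeFiltration (Fin N) 𝔸).mono (by omega) hz) h2,
    by rw [map_add, ← hz', sub_add_cancel, smul_one_eq_opOfPoly]⟩

/-- For δ = ∑ a_i ∂_i, the factor ∂_i multiplies exactly; only moving a_i to the left leaves an
error, of one order less. -/
theorem normalOp_mul_opOfDer (δ : Derivation ℂ 𝔸 𝔸) (l : ℤ) {g : MvPolynomial (Fin N) 𝔸}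
    (hg : g ∈ degreeLt (Fin N) 𝔸 (l + 1)) :
    ∃ z ∈ degreeLt (Fin N) 𝔸 (l + 1),
      normalOp g * opOfDer δ - normalOp (symbol δ * g) = normalOp z := by
  choose z hz hz' using fun i => normalOp_mul_opOfPoly (δ (X i)) l g hg
  refine ⟨∑ i, X i * z i, sum_mem fun i _ => ?_, ?_⟩
  · have := mul_mem_degreeLt (isHomogeneous_X 𝔸 i) (hz i)
    exact_mod_cast this
  · rw [opOfDer_eq_sum, symbol, Finset.mul_sum, Finset.sum_mul, map_sum normalOp, map_sum normalOp,
      ← Finset.sum_sub_distrib]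
    refine Finset.sum_congr rfl fun i _ => ?_
    have e : C (δ (X i)) * X i * g = C (δ (X i)) * g * X i := by ring
    rw [e, mul_comm (X i), normalOp_mul_X (z i), ← hz', sub_mul, ← normalOp_mul_X, ← opOfPoly_mul,
      ← mul_assoc (normalOp g)]

theorem symbol_isHomogeneous (δ : Derivation ℂ 𝔸 𝔸) : (symbol δ).IsHomogeneous 1 :=
  IsHomogeneous.sum _ _ _ fun i _ => by
    have h := (isHomogeneous_C (Fin N) (δ (X i))).mul (isHomogeneous_X 𝔸 i)
    rwa [zero_add] at h

end Weyl

/-! ### Regular sequences of symbols -/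

section InjMod

variable {B : Type} [CommRing B]

/-- Multiplication by `s` is injective modulo `J`. -/
def InjMod (J : Ideal B) (s : B) : Prop := ∀ g, s * g ∈ J → g ∈ J

theorem InjMod.pow {J : Ideal B} {s : B} (h : InjMod J s) (e : ℕ) : InjMod J (s ^ e) := by
  induction e with
  | zero => intro g hg; rwa [pow_zero, one_mul] at hg
  | succ e ih => intro g hg; rw [pow_succ, mul_assoc] at hg; exact h _ (ih _ hg)

/-- If `s` is injective modulo `(h) + J` and `h` is injective modulo `J`, then `h` is injective
modulo `J + (s)`. -/
theorem InjMod.sup_span {J : Ideal B} {h s : B} (hh : InjMod J h)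
    (hs : InjMod (Ideal.span {h} ⊔ J) s) : InjMod (J ⊔ Ideal.span {s}) h := by
  intro g hg
  obtain ⟨j, hj, y, hy, e⟩ := Submodule.mem_sup.1 hg
  obtain ⟨t, rfl⟩ := Ideal.mem_span_singleton'.1 hy
  -- From h g = j + t s, the hypothesis on s puts t into (h) + J. Writing t = t' h + j', the factor
  -- h cancels modulo J, so g is congruent to t' s.
  have ht : t ∈ Ideal.span {h} ⊔ J := by
    apply hs
    have : s * t = h * g - j := by rw [← e]; ring
    rw [this]
    exact sub_mem (Ideal.mem_sup_left (Ideal.mul_mem_right _ _ (Ideal.mem_span_singleton_self h)))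
      (Ideal.mem_sup_right hj)
  obtain ⟨z, hz, j', hj', rfl⟩ := Submodule.mem_sup.1 ht
  obtain ⟨t', rfl⟩ := Ideal.mem_span_singleton'.1 hz
  have h1 : g - t' * s ∈ J := by
    apply hh
    have : h * (g - t' * s) = j + j' * s := by linear_combination -e
    rw [this]
    exact add_mem hj (Ideal.mul_mem_right _ _ hj')
  have h2 := add_mem (Ideal.mem_sup_left (T := Ideal.span {s}) h1)
    (Ideal.mem_sup_right (S := J) (Ideal.mul_mem_left _ t' (Ideal.mem_span_singleton_self s)))
  rwa [sub_add_cancel] at h2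

theorem InjMod.map_C {J : Ideal B} {s : B} (h : InjMod J s) :
    InjMod (J.map Polynomial.C) (Polynomial.C s) := by
  intro g hg
  rw [Ideal.mem_map_C_iff] at hg ⊢
  intro n
  apply h
  simpa using hg n

/-- A polynomial `a + w X ^ d` is injective modulo `J` if `w` is. -/
theorem InjMod.C_add_C_mul_X_pow {J : Ideal B} {w : B} (hw : InjMod J w) (a : B) {d : ℕ}
    (hd : 0 < d) :
    InjMod (J.map Polynomial.C) (Polynomial.C a + Polynomial.C w * Polynomial.X ^ d) := by
  intro g hg
  rw [Ideal.mem_map_C_iff] at hg ⊢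
  -- Descending induction on n from above the degree of g: the coefficient of index n + d of the
  -- product is a g_(n+d) + w g_n, and g_(n+d) is already known to lie in J.
  suffices h : ∀ k n, g.natDegree < n + k → g.coeff n ∈ J from
    fun n => h (g.natDegree + 1) n (by omega)
  intro k
  induction k with
  | zero =>
    intro n hn
    rw [Polynomial.coeff_eq_zero_of_natDegree_lt (by omega)]
    exact zero_mem _
  | succ k ih =>
    intro n hn
    have h1 := hg (n + d)
    rw [add_mul, Polynomial.coeff_add, Polynomial.coeff_C_mul, mul_assoc, Polynomial.coeff_C_mul,
      Polynomial.coeff_X_pow_mul] at h1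
    exact hw _ ((Ideal.add_mem_iff_right _ (Ideal.mul_mem_left _ _ (ih (n + d) (by omega)))).1 h1)

/-- If `h` is injective modulo `J`, then the variable is injective modulo `J` and
`h + c X ^ d`. -/
theorem InjMod.X_mod {J : Ideal B} {h : B} (hh : InjMod J h) (c : B) {d : ℕ} (hd : 0 < d) :
    InjMod (J.map Polynomial.C ⊔
      Ideal.span {Polynomial.C h + Polynomial.C c * Polynomial.X ^ d}) Polynomial.X := by
  obtain ⟨d, rfl⟩ : ∃ d', d = d' + 1 := ⟨d - 1, by omega⟩
  intro f hf
  obtain ⟨j, hj, y, hy, e⟩ := Submodule.mem_sup.1 hf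
  obtain ⟨t, rfl⟩ := Ideal.mem_span_singleton'.1 hy
  have hj' := Ideal.mem_map_C_iff.1 hj
  -- Constant terms of X f = j + t (h + c X^d): since j has coefficients in J, the constant term of
  -- t times h lies in J, hence so does the constant term of t. Once it is split off, the identity
  -- can be divided by X.
  have e0 : j.coeff 0 + t.coeff 0 * h = 0 := by
    have := congrArg (fun q => Polynomial.coeff q 0) e
    simpa [Polynomial.mul_coeff_zero] using this
  have ht : t.coeff 0 ∈ J := by
    apply hh
    have : h * t.coeff 0 = -j.coeff 0 := by linear_combination e0
    rw [this]
    exact neg_mem (hj' 0)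
  have hjd : j.divX ∈ J.map Polynomial.C := by
    rw [Ideal.mem_map_C_iff]
    intro n
    rw [Polynomial.coeff_divX]
    exact hj' _
  have key : f = (j.divX + Polynomial.C (t.coeff 0) * (Polynomial.C c * Polynomial.X ^ d)) +
      t.divX * (Polynomial.C h + Polynomial.C c * Polynomial.X ^ (d + 1)) := by
    have hX := Polynomial.isRegular_X (R := B)
    apply hX.left
    change Polynomial.X * f = Polynomial.X * _
    have e1 := Polynomial.divX_mul_X_add j
    have e2 := Polynomial.divX_mul_X_add t
    have e3 : Polynomial.C (j.coeff 0) + Polynomial.C (t.coeff 0) * Polynomial.C h = 0 := by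
      rw [← Polynomial.C_mul, ← Polynomial.C_add, e0, Polynomial.C_0]
    linear_combination -e - e1 -
      (Polynomial.C h + Polynomial.C c * Polynomial.X ^ (d + 1)) * e2 + e3
  rw [key]
  refine add_mem (Ideal.mem_sup_left (add_mem hjd (Ideal.mul_mem_right _ _
    (Ideal.mem_map_of_mem _ ht)))) (Ideal.mem_sup_right (Ideal.mul_mem_left _ _
    (Ideal.mem_span_singleton_self _)))

theorem map_initialIdeal {B' : Type} [CommRing B'] (f : B →+* B') (s : ℕ → B) (k : ℕ) :
    (initialIdeal s k).map f = initialIdeal (f ∘ s) k := by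
  rw [initialIdeal, initialIdeal, Ideal.map_span, Set.image_comp]

theorem initialIdeal_congr {s t : ℕ → B} {k : ℕ} (h : ∀ i < k, s i = t i) :
    initialIdeal s k = initialIdeal t k := by
  rw [initialIdeal, initialIdeal, Set.image_congr (s := {i | i < k}) fun i hi => h i hi]

theorem RegularSeq.of_ringEquiv {B' : Type} [CommRing B'] (f : B ≃+* B') {s : ℕ → B} {M : ℕ}
    (h : RegularSeq (f ∘ s) M) : RegularSeq s M := by
  have key : ∀ k g, f g ∈ initialIdeal (f ∘ s) k ↔ g ∈ initialIdeal s k := by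
    intro k g
    have := map_initialIdeal (f : B →+* B') s k
    rw [show (f : B →+* B') ∘ s = f ∘ s from rfl] at this
    rw [← this]
    refine (Ideal.mem_map_of_equiv f _).trans ⟨?_, fun hg => ⟨g, hg, rfl⟩⟩
    rintro ⟨x, hx, hxg⟩
    rwa [← f.injective hxg]
  intro k hk g hg
  rw [← key, map_mul] at hg
  exact (key k g).1 (h k hk _ hg)

end InjMod

/-! ### Regularity of the symbols of a logarithmic basis -/

section Saito

variable {n : ℕ}

local notation "𝔸" => MvPolynomial (Fin n) ℂ
local notation "𝔹" => MvPolynomial (Fin n) (MvPolynomial (Fin n) ℂ)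

/-- The symbols of a finite family of vector fields, as a sequence. -/
def symbolSeq (D : Fin n → Derivation ℂ 𝔸 𝔸) (k : ℕ) : 𝔹 :=
  if hk : k < n then symbol (D ⟨k, hk⟩) else 0

/-- `b` is an inverse of the coefficient matrix of `D` up to the factor `h`. -/
structure IsAdjugate (D : Fin n → Derivation ℂ 𝔸 𝔸) (h : 𝔸) (b : Fin n → Fin n → 𝔸) : Prop where
  left : ∀ j l, ∑ i, b j i * D i (X l) = if j = l then h else 0
  right : ∀ i k, ∑ j, D i (X j) * b j k = if i = k then h else 0

theorem aeval_C_mul_X_of_isHomogeneous (h : 𝔸) {e : ℕ} {g : 𝔹} (hg : g.IsHomogeneous e) :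
    aeval (fun j => C h * X j : Fin n → 𝔹) g = C h ^ e * g := by
  have hm : ∀ α ∈ g.support, aeval (fun j => C h * X j : Fin n → 𝔹) (monomial α (coeff α g)) =
      C h ^ e * monomial α (coeff α g) := by
    intro α hα
    have hd : α.degree = e := by
      by_contra h'
      exact mem_support_iff.1 hα (hg.coeff_eq_zero h')
    rw [aeval_monomial, monomial_eq, ← hd]
    simp only [mul_pow, Finsupp.prod, Finset.prod_mul_distrib, Finset.prod_pow_eq_pow_sum,
      algebraMap_eq, Finsupp.degree_apply]
    ring
  conv_lhs => rw [g.as_sum, map_sum, Finset.sum_congr rfl hm, ← Finset.mul_sum, ← g.as_sum]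

/-- Where h is invertible the fields form a frame, so their symbols are coordinates. Algebraically,
Ψ substitutes the matrix b and sends the i-th symbol to h ξ_i, while Φ sends ξ_i to the i-th symbol.
Modulo the earlier ξ_i the variable ξ_k cancels, and Φ ∘ Ψ multiplies a form of degree e by h^e,
which is then cancelled by the hypothesis on h. -/
theorem injMod_symbolSeq {D : Fin n → Derivation ℂ 𝔸 𝔸} {h : 𝔸} {b : Fin n → Fin n → 𝔸}
    (hb : IsAdjugate D h b) (h0 : h ≠ 0) {k : ℕ} (hk : k < n)
    (hh : InjMod (initialIdeal (symbolSeq D) k) (C h)) :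
    InjMod (initialIdeal (symbolSeq D) k) (symbolSeq D k) := by
  let S : Set (Fin n) := {i | (i : ℕ) < k}
  have hJ : initialIdeal (symbolSeq D) k = Ideal.span ((fun i => symbol (D i)) '' S) := by
    rw [initialIdeal]
    congr 1
    ext x
    constructor
    · rintro ⟨i, hi, rfl⟩
      have hi' : i < n := lt_trans hi hk
      exact ⟨⟨i, hi'⟩, hi, by simp [symbolSeq, hi']⟩
    · rintro ⟨i, hi, rfl⟩
      exact ⟨i, hi, by simp [symbolSeq]⟩
  have hk' : symbolSeq D k = symbol (D ⟨k, hk⟩) := by simp [symbolSeq, hk]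
  let Φ : 𝔹 →ₐ[𝔸] 𝔹 := aeval fun i => symbol (D i)
  let Ψ : 𝔹 →ₐ[𝔸] 𝔹 := aeval fun j => ∑ i, C (b j i) * X i
  have hC : ∀ a : 𝔸, Ψ (C a) = C a := fun a => Ψ.commutes a
  have hC' : ∀ a : 𝔸, Φ (C a) = C a := fun a => Φ.commutes a
  have hΨ : ∀ i, Ψ (symbol (D i)) = C h * X i := by
    intro i
    simp only [symbol, map_sum, map_mul, hC]
    simp only [Ψ, aeval_X, Finset.mul_sum]
    rw [Finset.sum_comm]
    have : ∀ l, ∑ j, C (D i (X j)) * (C (b j l) * X l : 𝔹) = C (if i = l then h else 0) * X l := by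
      intro l
      rw [← hb.right, map_sum, Finset.sum_mul]
      simp only [map_mul, mul_assoc]
    rw [Finset.sum_congr rfl fun l _ => this l, Finset.sum_eq_single i]
    · simp
    · intro l _ hl
      simp [hl.symm]
    · simp
  have hΦΨ : ∀ g, Φ (Ψ g) = aeval (fun j => C h * X j : Fin n → 𝔹) g := by
    intro g
    suffices Φ.comp Ψ = aeval (fun j => C h * X j : Fin n → 𝔹) from DFunLike.congr_fun this g
    ext j : 1
    simp only [AlgHom.comp_apply, Ψ, aeval_X, map_sum, map_mul, hC']
    simp only [Φ, aeval_X, symbol, Finset.mul_sum]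
    rw [Finset.sum_comm]
    have : ∀ l, ∑ i, C (b j i) * (C (D i (X l)) * X l : 𝔹) = C (if j = l then h else 0) * X l := by
      intro l
      rw [← hb.left, map_sum, Finset.sum_mul]
      simp only [map_mul, mul_assoc]
    rw [Finset.sum_congr rfl fun l _ => this l, Finset.sum_eq_single j]
    · simp
    · intro l _ hl
      simp [hl.symm]
    · simp
  intro g hg
  have h1 : Ψ g ∈ Ideal.span (X '' S : Set 𝔹) := by
    have h2 : Ψ (symbolSeq D k * g) ∈ Ideal.span {(C h : 𝔹)} * Ideal.span (X '' S : Set 𝔹) := by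
      have h3 := Ideal.mem_map_of_mem (Ψ : 𝔹 →+* 𝔹) hg
      rw [hJ, Ideal.map_span] at h3
      refine (Ideal.span_le.2 ?_) h3
      rintro _ ⟨_, ⟨i, hi, rfl⟩, rfl⟩
      change Ψ (symbol (D i)) ∈ _
      rw [hΨ]
      exact Ideal.mul_mem_mul (Ideal.mem_span_singleton_self _) (Ideal.subset_span ⟨i, hi, rfl⟩)
    rw [map_mul, hk', hΨ, Ideal.mem_span_singleton_mul] at h2
    obtain ⟨y, hy, e⟩ := h2
    rw [mul_assoc] at e
    have e2 : y = X ⟨k, hk⟩ * Ψ g := mul_left_cancel₀ (by simpa using h0) e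
    -- The ideal of the ξ_i with i < k is monomial and ξ_k is not among its generators, so ξ_k can
    -- be cancelled monomial by monomial.
    rw [e2, mem_ideal_span_X_image] at hy
    rw [mem_ideal_span_X_image]
    intro α hα
    obtain ⟨i, hi, hi'⟩ := hy (Finsupp.single ⟨k, hk⟩ 1 + α) (by
      rw [mem_support_iff, coeff_X_mul]
      exact mem_support_iff.1 hα)
    refine ⟨i, hi, ?_⟩
    have hik : (⟨k, hk⟩ : Fin n) ≠ i := by
      rintro rfl
      exact lt_irrefl k hi
    simpa [Finsupp.single_eq_of_ne' hik] using hi'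
  -- The exponent of h in Φ ∘ Ψ depends on the degree, so g is treated one homogeneous component at
  -- a time.
  rw [← sum_homogeneousComponent g]
  refine sum_mem fun e he => ?_
  have hge : (homogeneousComponent e g).IsHomogeneous e := homogeneousComponent_isHomogeneous e g
  have hΨh : ∀ e' (p : 𝔹), p.IsHomogeneous e' → (Ψ p).IsHomogeneous e' := by
    intro e' p hp
    have := hp.aeval (fun j => ∑ i, C (b j i) * X i : Fin n → 𝔹) (n := 1) fun j =>
      IsHomogeneous.sum _ _ _ fun i _ => by
        have h := (isHomogeneous_C (Fin n) (b j i)).mul (isHomogeneous_X 𝔸 i)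
        rwa [zero_add] at h
    rwa [one_mul] at this
  have hcomp : homogeneousComponent e (Ψ g) = Ψ (homogeneousComponent e g) := by
    conv_lhs => rw [← sum_homogeneousComponent g, map_sum, map_sum]
    have : ∀ e', homogeneousComponent e (Ψ (homogeneousComponent e' g)) =
        if e = e' then Ψ (homogeneousComponent e' g) else 0 := fun e' => by
      rw [homogeneousComponent_of_mem (hΨh e' _ (homogeneousComponent_isHomogeneous e' g))]
    simp only [this, Finset.sum_ite_eq, he, if_true]
  have h4 : Ψ (homogeneousComponent e g) ∈ Ideal.span (X '' S : Set 𝔹) := by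
    rw [← hcomp, mem_ideal_span_X_image]
    rw [mem_ideal_span_X_image] at h1
    intro α hα
    apply h1
    rw [mem_support_iff, coeff_homogeneousComponent] at hα
    rw [mem_support_iff]
    intro h'
    simp [h'] at hα
  have h5 : Φ (Ψ (homogeneousComponent e g)) ∈ initialIdeal (symbolSeq D) k := by
    have h3 := Ideal.mem_map_of_mem (Φ : 𝔹 →+* 𝔹) h4
    rw [Ideal.map_span, ← Set.image_comp] at h3
    rw [hJ]
    have e1 : ((Φ : 𝔹 →+* 𝔹) ∘ X : Fin n → 𝔹) = fun i => symbol (D i) := by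
      ext1 i
      change Φ (X i) = _
      exact aeval_X _ _
    rwa [e1] at h3
  rw [hΦΨ, aeval_C_mul_X_of_isHomogeneous h hge] at h5
  exact hh.pow e _ h5

end Saito

/-! ### The symbols on `ℂ × V` -/

section Extension

theorem injMod_of_stronglyKoszul {n m : ℕ} {h : MvPolynomial (Fin n) ℂ}
    {δ : Fin m → Derivation ℂ (MvPolynomial (Fin n) ℂ) (MvPolynomial (Fin n) ℂ)}
    (hSK : StronglyKoszul h δ) {σ : ℕ → MvPolynomial (Fin n) (MvPolynomial (Fin n) ℂ)}
    (hσ : ∀ k : Fin m, σ k = symbol (δ k)) {k : ℕ} (hk : k < m) :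
    InjMod (Ideal.span {C h} ⊔ initialIdeal σ k) (σ k) := by
  -- The index is shifted by one because h occupies position 0 of the Koszul list.
  have h1 := hSK.regular_mod_prev (k + 1) (by simpa using hk)
  rw [isSMulRegular_quotient_iff_mem_of_smul_mem] at h1
  have e1 : (C h :: List.ofFn fun i => symbol (δ i))[k + 1]'(by simpa using hk) = σ k := by
    simp [← hσ]
  have e2 : (Ideal.ofList ((C h :: List.ofFn fun i => symbol (δ i)).take (k + 1)) •
      (⊤ : Submodule (MvPolynomial (Fin n) (MvPolynomial (Fin n) ℂ)) _)) =
      Ideal.span {C h} ⊔ initialIdeal σ k := by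
    rw [Ideal.smul_top_eq_map, Algebra.algebraMap_self, Ideal.map_id, List.take_succ_cons,
      Ideal.ofList_cons, initialIdeal, Ideal.ofList]
    rw [Submodule.restrictScalars_self]
    congr 2
    ext x
    simp only [Set.mem_ofPred_eq, List.mem_take_iff_getElem, Set.mem_image, List.getElem_ofFn,
      List.length_ofFn]
    constructor
    · rintro ⟨i, hi, rfl⟩
      exact ⟨i, by omega, hσ ⟨i, by omega⟩⟩
    · rintro ⟨i, hi, rfl⟩
      exact ⟨i, by omega, (hσ ⟨i, by omega⟩).symm⟩
  rw [e1, e2] at h1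
  exact h1

/-- The entry h is moved from the front of the regular sequence to the back, past one symbol at a
time. -/
theorem injMod_C_of_stronglyKoszul {n m : ℕ} {h : MvPolynomial (Fin n) ℂ} (h0 : h ≠ 0)
    {δ : Fin m → Derivation ℂ (MvPolynomial (Fin n) ℂ) (MvPolynomial (Fin n) ℂ)}
    (hSK : StronglyKoszul h δ) {σ : ℕ → MvPolynomial (Fin n) (MvPolynomial (Fin n) ℂ)}
    (hσ : ∀ k : Fin m, σ k = symbol (δ k)) {k : ℕ} (hk : k ≤ m) :
    InjMod (initialIdeal σ k) (C h) := by
  induction k with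
  | zero =>
    intro g hg
    rw [initialIdeal_zero, Ideal.mem_bot] at hg ⊢
    exact (mul_eq_zero.1 hg).resolve_left (by simpa using h0)
  | succ k ih =>
    rw [initialIdeal_succ]
    exact (ih (by omega)).sup_span (injMod_of_stronglyKoszul hSK hσ hk)

variable {B : Type} [CommRing B]

/-- The symbols of the generators, in the polynomial ring in `w₀` and `ξ₀` over `B`. -/
def extendedSeq (σ : ℕ → B) (h c : B) (d m k : ℕ) : Polynomial (Polynomial B) :=
  if k < m then Polynomial.C (Polynomial.C (σ k))
  else if k = m then
    Polynomial.C (Polynomial.C h + Polynomial.C c * Polynomial.X ^ d)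
  else Polynomial.C (Polynomial.C (σ m)) + Polynomial.C Polynomial.X * Polynomial.X ^ 1

/-- The σ_k with k < m stay injective after adjoining variables. The next entry has the unit c as
leading coefficient in the inner variable w₀. The last is linear in ξ₀ with leading coefficient w₀,
which is injective by `InjMod.X_mod`; nothing is asked of σ_m. -/
theorem regularSeq_extendedSeq {σ : ℕ → B} {h c : B} {d m : ℕ} (hd : 0 < d) (hc : IsUnit c)
    (hσ : ∀ k < m, InjMod (initialIdeal σ k) (σ k)) (hh : InjMod (initialIdeal σ m) h) :
    RegularSeq (extendedSeq σ h c d m) (m + 2) := by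
  have hlt : ∀ k < m, extendedSeq σ h c d m k = Polynomial.C (Polynomial.C (σ k)) :=
    fun k hk => if_pos hk
  have hm : extendedSeq σ h c d m m =
      Polynomial.C (Polynomial.C h + Polynomial.C c * Polynomial.X ^ d) := by
    simp [extendedSeq]
  have hI : ∀ k ≤ m, initialIdeal (extendedSeq σ h c d m) k =
      ((initialIdeal σ k).map Polynomial.C).map Polynomial.C := by
    intro k hk
    rw [map_initialIdeal, map_initialIdeal]
    exact initialIdeal_congr fun i hi => hlt i (by omega)
  intro k hk
  rcases lt_trichotomy k m with hkm | rfl | hkm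
  · rw [hI k hkm.le, hlt k hkm]
    exact (hσ k hkm).map_C.map_C
  · rw [hI k le_rfl, hm]
    refine InjMod.map_C (InjMod.C_add_C_mul_X_pow ?_ h hd)
    intro g hg
    exact (Ideal.unit_mul_mem_iff_mem _ hc).1 hg
  · obtain rfl : k = m + 1 := by omega
    rw [initialIdeal_succ, hI m le_rfl, hm]
    have e : extendedSeq σ h c d m (m + 1) =
        Polynomial.C (Polynomial.C (σ m)) + Polynomial.C Polynomial.X * Polynomial.X ^ 1 := by
      simp [extendedSeq]
    have e2 : ((initialIdeal σ m).map Polynomial.C).map Polynomial.C ⊔ Ideal.span {Polynomial.C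
          (Polynomial.C h + Polynomial.C c * Polynomial.X ^ d)} =
        ((initialIdeal σ m).map Polynomial.C ⊔
          Ideal.span {Polynomial.C h + Polynomial.C c * Polynomial.X ^ d}).map Polynomial.C := by
      rw [Ideal.map_sup, Ideal.map_span, Set.image_singleton]
    rw [e, e2]
    exact (hh.X_mod c hd).C_add_C_mul_X_pow _ one_pos

theorem regularSeq_of_extendedSeq {B' : Type} [CommRing B'] (f : B' ≃+* Polynomial (Polynomial B))
    {s : ℕ → B'} {σ : ℕ → B} {h c : B} {d m : ℕ} (hs : ∀ k, f (s k) = extendedSeq σ h c d m k)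
    (hd : 0 < d) (hc : IsUnit c) (hσ : ∀ k < m, InjMod (initialIdeal σ k) (σ k))
    (hh : InjMod (initialIdeal σ m) h) : RegularSeq s (m + 2) := by
  refine RegularSeq.of_ringEquiv f ?_
  rw [show f ∘ s = extendedSeq σ h c d m from funext hs]
  exact regularSeq_extendedSeq hd hc hσ hh

variable (n : ℕ)

/-- The extraction of the variable `w₀` from the coefficients. -/
def coeffEquiv : MvPolynomial (Fin n) (MvPolynomial (Fin (n + 1)) ℂ) ≃+*
    Polynomial (MvPolynomial (Fin n) (MvPolynomial (Fin n) ℂ)) :=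
  (MvPolynomial.mapEquiv (Fin n) (finSuccEquiv ℂ n).toRingEquiv).trans
    ((optionEquivRight (MvPolynomial (Fin n) ℂ) (Fin n)).symm.trans
      (optionEquivLeft (MvPolynomial (Fin n) ℂ) (Fin n))).toRingEquiv

/-- The identification of the graded ring of `ℂ × V` with the polynomial ring in `w₀` and `ξ₀` over
the graded ring of `V`. -/
def symbolEquiv : MvPolynomial (Fin (n + 1)) (MvPolynomial (Fin (n + 1)) ℂ) ≃+*
    Polynomial (Polynomial (MvPolynomial (Fin n) (MvPolynomial (Fin n) ℂ))) :=
  (finSuccEquiv (MvPolynomial (Fin (n + 1)) ℂ) n).toRingEquiv.trans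
    (Polynomial.mapEquiv (coeffEquiv n))

theorem coeffEquiv_apply (g : MvPolynomial (Fin n) (MvPolynomial (Fin (n + 1)) ℂ)) :
    coeffEquiv n g = optionEquivLeft (MvPolynomial (Fin n) ℂ) (Fin n)
      ((optionEquivRight (MvPolynomial (Fin n) ℂ) (Fin n)).symm
        (map (finSuccEquiv ℂ n : _ →+* _) g)) := rfl

theorem symbolEquiv_apply (g : MvPolynomial (Fin (n + 1)) (MvPolynomial (Fin (n + 1)) ℂ)) :
    symbolEquiv n g = Polynomial.map (coeffEquiv n : _ →+* _)
      (finSuccEquiv (MvPolynomial (Fin (n + 1)) ℂ) n g) := rfl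

theorem coeffEquiv_X (i : Fin n) : coeffEquiv n (X i) = Polynomial.C (X i) := by
  rw [coeffEquiv_apply, map_X, (AlgEquiv.symm_apply_eq _).2 (optionEquivRight_X_some _ _ i).symm,
    optionEquivLeft_X_some]

theorem coeffEquiv_C_X_zero : coeffEquiv n (C (X 0)) = Polynomial.X := by
  rw [coeffEquiv_apply, map_C, RingHom.coe_coe, finSuccEquiv_X_zero,
    (AlgEquiv.symm_apply_eq _).2 (optionEquivRight_X_none _ _).symm, optionEquivLeft_X_none]

theorem finSuccEquiv_C (R : Type) [CommRing R] (a : R) :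
    finSuccEquiv R n (C a) = Polynomial.C (C a) :=
  ((AlgEquiv.symm_apply_eq _).1 (DFunLike.congr_fun (finSuccEquiv_comp_C_eq_C n) a)).symm

theorem finSuccEquiv_rename_succ (a : MvPolynomial (Fin n) ℂ) :
    finSuccEquiv ℂ n (rename Fin.succ a) = Polynomial.C a := by
  induction a using MvPolynomial.induction_on with
  | C a => rw [rename_C, finSuccEquiv_C]
  | add p q hp hq => rw [map_add, map_add, hp, hq, Polynomial.C_add]
  | mul_X p i hp => rw [map_mul, map_mul, hp, rename_X, finSuccEquiv_X_succ, Polynomial.C_mul]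

theorem coeffEquiv_C_rename (a : MvPolynomial (Fin n) ℂ) :
    coeffEquiv n (C (rename Fin.succ a)) = Polynomial.C (C a) := by
  rw [coeffEquiv_apply, map_C, RingHom.coe_coe, finSuccEquiv_rename_succ,
    (AlgEquiv.symm_apply_eq _).2 (optionEquivRight_C _ _ a).symm, optionEquivLeft_C]

theorem symbolEquiv_X_zero : symbolEquiv n (X 0) = Polynomial.X := by
  rw [symbolEquiv_apply, finSuccEquiv_X_zero, Polynomial.map_X]

theorem symbolEquiv_X_succ (i : Fin n) :
    symbolEquiv n (X i.succ) = Polynomial.C (Polynomial.C (X i)) := by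
  rw [symbolEquiv_apply, finSuccEquiv_X_succ, Polynomial.map_C, RingHom.coe_coe, coeffEquiv_X]

theorem symbolEquiv_C_X_zero : symbolEquiv n (C (X 0)) = Polynomial.C Polynomial.X := by
  rw [symbolEquiv_apply, finSuccEquiv_C, Polynomial.map_C, RingHom.coe_coe, coeffEquiv_C_X_zero]

theorem symbolEquiv_C_rename (a : MvPolynomial (Fin n) ℂ) :
    symbolEquiv n (C (rename Fin.succ a)) = Polynomial.C (Polynomial.C (C a)) := by
  rw [symbolEquiv_apply, finSuccEquiv_C, Polynomial.map_C, RingHom.coe_coe, coeffEquiv_C_rename]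

variable {n}

theorem liftDer_X_zero (δ : Derivation ℂ (MvPolynomial (Fin n) ℂ) (MvPolynomial (Fin n) ℂ)) :
    liftDer δ (X 0) = 0 := by
  simp [liftDer, mkDerivation_X]

theorem liftDer_X_succ (δ : Derivation ℂ (MvPolynomial (Fin n) ℂ) (MvPolynomial (Fin n) ℂ))
    (i : Fin n) : liftDer δ (X i.succ) = rename Fin.succ (δ (X i)) := by
  simp [liftDer, mkDerivation_X]

theorem symbolEquiv_symbol_liftDer
    (δ : Derivation ℂ (MvPolynomial (Fin n) ℂ) (MvPolynomial (Fin n) ℂ)) :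
    symbolEquiv n (symbol (liftDer δ)) = Polynomial.C (Polynomial.C (symbol δ)) := by
  simp only [symbol, Fin.sum_univ_succ, liftDer_X_zero, liftDer_X_succ, map_zero, zero_mul,
    zero_add, map_sum, map_mul, symbolEquiv_C_rename, symbolEquiv_X_succ]

theorem symbol_add {N : ℕ}
    (δ δ' : Derivation ℂ (MvPolynomial (Fin N) ℂ) (MvPolynomial (Fin N) ℂ)) :
    symbol (δ + δ') = symbol δ + symbol δ' := by
  simp only [symbol, Derivation.add_apply, map_add, add_mul, Finset.sum_add_distrib]

theorem symbol_smul_pderiv {N : ℕ} (a : MvPolynomial (Fin N) ℂ) (i : Fin N) :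
    symbol (a • pderiv i) = C a * X i := by
  classical
  simp only [symbol, Derivation.smul_apply, pderiv_X, Pi.single_apply, smul_eq_mul, mul_ite,
    mul_one, mul_zero, apply_ite C, map_zero, ite_mul, zero_mul]
  simp [eq_comm]

theorem symbolEquiv_symbol_chiTilde (p : Fin n → ℚ) :
    symbolEquiv n (symbol (chiTilde p)) =
      Polynomial.C (Polynomial.C (symbol (eulerDer p))) +
        Polynomial.C Polynomial.X * Polynomial.X ^ 1 := by
  rw [chiTilde, symbol_add, symbol_smul_pderiv, map_add, map_mul, symbolEquiv_symbol_liftDer,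
    symbolEquiv_C_X_zero, symbolEquiv_X_zero, pow_one]

theorem symbolEquiv_C_hTilde (h : MvPolynomial (Fin n) ℂ) (c : ℂ) (d : ℕ) :
    symbolEquiv n (C (hTilde h c d)) = Polynomial.C (Polynomial.C (C h) +
      Polynomial.C (C (C (-c))) * Polynomial.X ^ d) := by
  have e : hTilde h c d = rename Fin.succ h + rename Fin.succ (C (-c)) * X 0 ^ d := by
    rw [hTilde, rename_C, map_neg]
    ring
  rw [e, map_add, map_add, map_mul, map_mul, map_pow, map_pow, symbolEquiv_C_rename,
    symbolEquiv_C_rename, symbolEquiv_C_X_zero, map_add Polynomial.C, map_mul Polynomial.C,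
    map_pow Polynomial.C]

/-- The symbols of the operators `δ₁, …, δₘ, h - c w₀ᵈ, χ + w₀ ∂₀ - d β`, in this order. -/
def symbolTilde {m : ℕ} (h : MvPolynomial (Fin n) ℂ) (p : Fin n → ℚ) (d : ℕ)
    (δ : Fin m → Derivation ℂ (MvPolynomial (Fin n) ℂ) (MvPolynomial (Fin n) ℂ)) (c : ℂ) (k : ℕ) :
    MvPolynomial (Fin (n + 1)) (MvPolynomial (Fin (n + 1)) ℂ) :=
  if hk : k < m then symbol (liftDer (δ ⟨k, hk⟩))
  else if k = m then C (hTilde h c d) else symbol (chiTilde p)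

end Extension

/-! ### Vector fields on `V` and on `ℂ × V` -/

section Euler

variable {N : ℕ}

theorem coeff_eulerDer (p : Fin N → ℚ) (f : MvPolynomial (Fin N) ℂ) (α : Fin N →₀ ℕ) :
    coeff α (eulerDer p f) = ((Finsupp.weight p α : ℚ) : ℂ) * coeff α f := by
  induction f using MvPolynomial.induction_on' with
  | add f g hf hg => rw [map_add, coeff_add, coeff_add, hf, hg, mul_add]
  | monomial γ a =>
    have key : eulerDer p (monomial γ a) = monomial γ (((Finsupp.weight p γ : ℚ) : ℂ) * a) := by
      rw [eulerDer, mkDerivation_monomial, Finsupp.sum, Finset.smul_sum, Finsupp.weight_apply,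
        Finsupp.sum, Rat.cast_sum, Finset.sum_mul, map_sum]
      refine Finset.sum_congr rfl fun i hi => ?_
      have hγ : γ - Finsupp.single i 1 + Finsupp.single i 1 = γ :=
        tsub_add_cancel_of_le (by
          rw [Finsupp.single_le_iff]
          exact Nat.one_le_iff_ne_zero.2 (Finsupp.mem_support_iff.1 hi))
      rw [smul_eq_mul, X, C_mul_monomial, monomial_mul, hγ, smul_monomial]
      congr 1
      simp only [smul_eq_mul, nsmul_eq_mul]
      push_cast
      ring
    classical
    rw [key, coeff_monomial, coeff_monomial]
    split_ifs with hα
    · rw [hα]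
    · rw [mul_zero]

theorem eulerDer_apply_of_isWeightedHomogeneous {p : Fin N → ℚ} {h : MvPolynomial (Fin N) ℂ}
    {d : ℕ} (hh : IsWeightedHomogeneous p h (d : ℚ)) : eulerDer p h = C (d : ℂ) * h := by
  ext α
  rw [coeff_eulerDer, coeff_C_mul]
  by_cases hα : coeff α h = 0
  · rw [hα, mul_zero, mul_zero]
  · rw [hh hα, Rat.cast_natCast]

/-- The Euler field with all weights 1 kills h, being a combination of partial derivatives, and
multiplies the coefficient at α by the degree of α. -/
theorem eq_C_of_pderiv_eq_zero {h : MvPolynomial (Fin N) ℂ} (hh : ∀ i, pderiv i h = 0) :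
    h = C (coeff 0 h) := by
  classical
  have h1 : ∀ α, coeff α (eulerDer (1 : Fin N → ℚ) h) = 0 := by
    intro α
    rw [← coeff_zero α]
    congr 1
    rw [derivation_eq_sum (eulerDer 1), ← Derivation.coeFnAddMonoidHom_apply, map_sum,
      Finset.sum_apply]
    exact Finset.sum_eq_zero fun i _ => by
      rw [Derivation.coeFnAddMonoidHom_apply, Derivation.smul_apply, hh i, smul_zero]
  ext α
  rw [coeff_C]
  split_ifs with hα
  · rw [hα]
  · have h2 := h1 α
    rw [coeff_eulerDer] at h2
    refine (mul_eq_zero.1 h2).resolve_left ?_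
    have h3 : Finsupp.weight (1 : Fin N → ℚ) α = (α.degree : ℚ) := by
      rw [Finsupp.weight_apply, Finsupp.degree_apply, Finsupp.sum]
      simp
    rw [h3]
    have h4 : α.degree ≠ 0 := fun h => hα ((Finsupp.degree_eq_zero_iff α).1 h).symm
    exact_mod_cast h4

end Euler

/-! ### Consequences of freeness of the logarithmic vector fields -/

section FreeDivisor

variable {m : ℕ}

local notation "𝔸" => MvPolynomial (Fin (m + 1)) ℂ

/-- The basis `δ₁, …, δₘ, χ` of the logarithmic vector fields. -/
abbrev logBasis (δ : Fin m → Derivation ℂ 𝔸 𝔸) (p : Fin (m + 1) → ℚ) :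
    Fin (m + 1) → Derivation ℂ 𝔸 𝔸 :=
  Fin.snoc δ (eulerDer p)

variable {h : MvPolynomial (Fin (m + 1)) ℂ} {p : Fin (m + 1) → ℚ}
  {δ : Fin m → Derivation ℂ (MvPolynomial (Fin (m + 1)) ℂ) (MvPolynomial (Fin (m + 1)) ℂ)}

theorem sum_derivation_apply {ι : Type} (t : Finset ι) {N : ℕ}
    (D : ι → Derivation ℂ (MvPolynomial (Fin N) ℂ) (MvPolynomial (Fin N) ℂ))
    (f : MvPolynomial (Fin N) ℂ) : (∑ i ∈ t, D i) f = ∑ i ∈ t, D i f := by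
  rw [← Derivation.coeFnAddMonoidHom_apply, map_sum, Finset.sum_apply]
  rfl

/-- The field h ∂_j is logarithmic for trivial reasons. Its coordinates supply the inverse of the
coefficient matrix up to h, without determinants. -/
theorem exists_smul_pderiv_eq (h_span : Submodule.span 𝔸 (Set.range (logBasis δ p)) = logDer h) :
    ∃ b : Fin (m + 1) → Fin (m + 1) → 𝔸, ∀ j, ∑ i, b j i • logBasis δ p i = h • pderiv j := by
  have key : ∀ j : Fin (m + 1), ∃ b : Fin (m + 1) → 𝔸,
      ∑ i, b i • logBasis δ p i = h • pderiv j := by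
    intro j
    rw [← Submodule.mem_span_range_iff_exists_fun, h_span]
    exact dvd_mul_right h _
  choose b hb using key
  exact ⟨b, hb⟩

/-- One product is read off by evaluating on coordinates. For the other, h times the i-th basis
field is expanded in the basis in two ways, and independence compares coefficients. -/
theorem exists_isAdjugate (h_indep : LinearIndependent 𝔸 (logBasis δ p))
    (h_span : Submodule.span 𝔸 (Set.range (logBasis δ p)) = logDer h) :
    ∃ b, IsAdjugate (logBasis δ p) h b := by
  classical
  obtain ⟨b, hb⟩ := exists_smul_pderiv_eq h_span
  refine ⟨b, ⟨fun j l => ?_, fun i k => ?_⟩⟩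
  · have h1 := DFunLike.congr_fun (hb j) (X l)
    rw [sum_derivation_apply] at h1
    simp only [Derivation.smul_apply, smul_eq_mul] at h1
    rw [h1, pderiv_X, Pi.single_apply, mul_ite, mul_one, mul_zero]
    simp only [eq_comm]
  · have h1 : ∑ k, (∑ j, logBasis δ p i (X j) * b j k - if i = k then h else 0) •
        logBasis δ p k = 0 := by
      have h2 : ∀ k, (∑ j, logBasis δ p i (X j) * b j k - if i = k then h else 0) •
          logBasis δ p k = ∑ j, logBasis δ p i (X j) • b j k • logBasis δ p k -
            if i = k then h • logBasis δ p k else 0 := by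
        intro k
        refine (sub_smul (∑ j, logBasis δ p i (X j) * b j k) (if i = k then h else 0)
          (logBasis δ p k)).trans ?_
        rw [Finset.sum_smul, ite_smul, zero_smul]
        simp only [mul_smul]
      rw [Finset.sum_congr rfl fun k _ => h2 k, Finset.sum_sub_distrib, Finset.sum_comm,
        Finset.sum_ite_eq, if_pos (Finset.mem_univ i), sub_eq_zero]
      trans ∑ j, logBasis δ p i (X j) • h • pderiv j
      · exact Finset.sum_congr rfl fun j _ => by rw [← hb, Finset.smul_sum]
      · conv_rhs => rw [derivation_eq_sum (logBasis δ p i), Finset.smul_sum]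
        exact Finset.sum_congr rfl fun j _ => smul_comm _ _ _
    exact sub_eq_zero.1 (Fintype.linearIndependent_iff.1 h_indep _ h1 k)

/-- If d = 0, every basis field kills h, hence so does each h ∂_j. Then h is a nonzero constant, and
a regular sequence cannot begin with a unit since it generates a proper ideal. -/
theorem degree_pos {d : ℕ} (h_red : h ≠ 0) (h_qh : IsWeightedHomogeneous p h (d : ℚ))
    (hδ : ∀ i, δ i h = 0) (h_span : Submodule.span 𝔸 (Set.range (logBasis δ p)) = logDer h)
    (hSK : StronglyKoszul h δ) : 0 < d := by
  rw [Nat.pos_iff_ne_zero]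
  rintro rfl
  have h1 : ∀ i, logBasis δ p i h = 0 := by
    intro i
    refine Fin.lastCases ?_ (fun i => ?_) i
    · rw [logBasis, Fin.snoc_last, eulerDer_apply_of_isWeightedHomogeneous h_qh]
      simp
    · rw [logBasis, Fin.snoc_castSucc, hδ]
  obtain ⟨b, hb⟩ := exists_smul_pderiv_eq h_span
  have h2 : ∀ j, pderiv j h = 0 := by
    intro j
    have h3 := DFunLike.congr_fun (hb j) h
    rw [sum_derivation_apply] at h3
    simp only [Derivation.smul_apply, h1, smul_eq_mul, mul_zero, Finset.sum_const_zero] at h3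
    exact (mul_eq_zero.1 h3.symm).resolve_left h_red
  have h4 := eq_C_of_pderiv_eq_zero h2
  have h5 : IsUnit h := by
    rw [h4]
    refine IsUnit.map C (isUnit_iff_ne_zero.2 fun h0 => h_red ?_)
    rw [h4, h0, C_0]
  refine hSK.top_ne_smul ?_
  rw [Ideal.ofList_cons, Ideal.span_singleton_eq_top.2 (h5.map C), top_sup_eq]
  exact (Submodule.top_smul _).symm

/-- Evaluating the expansion of η at h leaves only the χ-coefficient times d h, so that coefficient
vanishes. -/
theorem exists_sum_eq_of_apply_eq_zero {d : ℕ} (hd : 0 < d) (h_red : h ≠ 0)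
    (h_qh : IsWeightedHomogeneous p h (d : ℚ)) (hδ : ∀ i, δ i h = 0)
    (h_span : Submodule.span 𝔸 (Set.range (logBasis δ p)) = logDer h)
    {η : Derivation ℂ 𝔸 𝔸} (hη : η h = 0) : ∃ c : Fin m → 𝔸, η = ∑ i, c i • δ i := by
  have h1 : η ∈ Submodule.span 𝔸 (Set.range (logBasis δ p)) := by
    rw [h_span]
    change h ∣ η h
    rw [hη]
    exact dvd_zero h
  obtain ⟨c, hc⟩ := (Submodule.mem_span_range_iff_exists_fun _).1 h1
  rw [Fin.sum_univ_castSucc] at hc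
  simp only [logBasis, Fin.snoc_castSucc, Fin.snoc_last] at hc
  have h2 : c (Fin.last m) = 0 := by
    have h3 := DFunLike.congr_fun hc h
    rw [Derivation.add_apply, sum_derivation_apply, hη, Derivation.smul_apply,
      eulerDer_apply_of_isWeightedHomogeneous h_qh] at h3
    simp only [Derivation.smul_apply, hδ, smul_eq_mul, mul_zero, Finset.sum_const_zero,
      zero_add] at h3
    refine (mul_eq_zero.1 h3).resolve_right (mul_ne_zero ?_ h_red)
    rw [Ne, C_eq_zero]
    exact_mod_cast hd.ne'
  rw [h2, zero_smul, add_zero] at hc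
  exact ⟨_, hc.symm⟩

theorem lie_logBasis_apply {d : ℕ} (h_qh : IsWeightedHomogeneous p h (d : ℚ))
    (hδ : ∀ i, δ i h = 0) (i : Fin m) :
    ⁅eulerDer p, δ i⁆ h = 0 := by
  rw [Derivation.commutator_apply, hδ, map_zero, eulerDer_apply_of_isWeightedHomogeneous h_qh,
    C_mul', Derivation.map_smul, hδ, smul_zero, sub_zero]

end FreeDivisor

/-! ### Vector fields on ℂ × V, their brackets and their action on h - c w₀^d -/

section Lift

variable {n : ℕ}

local notation "𝔸" => MvPolynomial (Fin n) ℂ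

theorem liftDer_rename (δ : Derivation ℂ 𝔸 𝔸) (f : 𝔸) :
    liftDer δ (rename Fin.succ f) = rename Fin.succ (δ f) := by
  induction f using MvPolynomial.induction_on with
  | C a => rw [rename_C, derivation_C, derivation_C, map_zero]
  | add f g hf hg => simp only [map_add, hf, hg]
  | mul_X f i hf =>
    rw [map_mul, Derivation.leibniz, hf, rename_X, liftDer_X_succ, Derivation.leibniz, map_add]
    simp only [smul_eq_mul, map_mul, rename_X]

theorem liftDer_sum_smul {ι : Type} (t : Finset ι) (a : ι → 𝔸) (δ : ι → Derivation ℂ 𝔸 𝔸) :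
    liftDer (∑ i ∈ t, a i • δ i) = ∑ i ∈ t, rename Fin.succ (a i) • liftDer (δ i) := by
  refine derivation_ext fun j => ?_
  rw [sum_derivation_apply]
  refine Fin.cases ?_ (fun j => ?_) j
  · simp only [liftDer_X_zero, Derivation.smul_apply, smul_zero, Finset.sum_const_zero]
  · simp only [liftDer_X_succ, Derivation.smul_apply, sum_derivation_apply, map_sum, smul_eq_mul,
      map_mul]

theorem lie_liftDer (δ δ' : Derivation ℂ 𝔸 𝔸) : ⁅liftDer δ, liftDer δ'⁆ = liftDer ⁅δ, δ'⁆ := by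
  refine derivation_ext fun j => ?_
  rw [Derivation.commutator_apply]
  refine Fin.cases ?_ (fun j => ?_) j
  · simp only [liftDer_X_zero, map_zero, sub_zero]
  · simp only [liftDer_X_succ, liftDer_rename, Derivation.commutator_apply, map_sub]

theorem pderiv_zero_rename_succ (f : 𝔸) : pderiv 0 (rename Fin.succ f) = 0 := by
  induction f using MvPolynomial.induction_on with
  | C a => rw [rename_C, derivation_C]
  | add f g hf hg => simp only [map_add, hf, hg, add_zero]
  | mul_X f i hf =>
    rw [map_mul, Derivation.leibniz, hf, rename_X, pderiv_X_of_ne (Fin.succ_ne_zero i)]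
    simp

theorem chiTilde_rename (p : Fin n → ℚ) (f : 𝔸) :
    chiTilde p (rename Fin.succ f) = rename Fin.succ (eulerDer p f) := by
  rw [chiTilde, Derivation.add_apply, Derivation.smul_apply, pderiv_zero_rename_succ, smul_zero,
    add_zero, liftDer_rename]

theorem chiTilde_X_zero (p : Fin n → ℚ) : chiTilde p (X 0) = X 0 := by
  rw [chiTilde, Derivation.add_apply, Derivation.smul_apply, pderiv_X_self, liftDer_X_zero,
    zero_add, smul_eq_mul, mul_one]

theorem lie_chiTilde_liftDer (p : Fin n → ℚ) (δ : Derivation ℂ 𝔸 𝔸) :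
    ⁅chiTilde p, liftDer δ⁆ = liftDer ⁅eulerDer p, δ⁆ := by
  refine derivation_ext fun j => ?_
  rw [Derivation.commutator_apply]
  refine Fin.cases ?_ (fun j => ?_) j
  · simp only [liftDer_X_zero, chiTilde_X_zero, map_zero, sub_zero]
  · rw [liftDer_X_succ, liftDer_X_succ, chiTilde_rename, ← rename_X, chiTilde_rename,
      liftDer_rename, Derivation.commutator_apply, map_sub]

theorem liftDer_hTilde {δ : Derivation ℂ 𝔸 𝔸} {h : 𝔸} (hδ : δ h = 0) (c : ℂ) (d : ℕ) :
    liftDer δ (hTilde h c d) = 0 := by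
  rw [hTilde, map_sub, liftDer_rename, hδ, map_zero, C_mul', Derivation.map_smul, Derivation.leibniz_pow,
    liftDer_X_zero, smul_zero, smul_zero, smul_zero, sub_zero]

theorem chiTilde_hTilde {p : Fin n → ℚ} {h : 𝔸} {d : ℕ}
    (h_qh : IsWeightedHomogeneous p h (d : ℚ)) (c : ℂ) :
    chiTilde p (hTilde h c d) = C (d : ℂ) * hTilde h c d := by
  rw [hTilde, map_sub, chiTilde_rename, eulerDer_apply_of_isWeightedHomogeneous h_qh, C_mul',
    map_smul, C_mul', Derivation.map_smul, Derivation.leibniz_pow, chiTilde_X_zero, C_mul', smul_sub]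
  congr 1
  rw [smul_comm (d : ℂ), smul_eq_mul, Nat.cast_smul_eq_nsmul]
  -- The Leibniz rule produces the exponent d - 1 with truncated subtraction, so d = 0 is treated
  -- apart.
  rcases d with _ | d
  · simp
  · rw [Nat.add_sub_cancel, ← pow_succ]

theorem hTilde_ne_zero {h : 𝔸} (h0 : h ≠ 0) (c : ℂ) {d : ℕ} (hd : 0 < d) : hTilde h c d ≠ 0 := by
  intro h1
  have h2 := congrArg (finSuccEquiv ℂ n) h1
  rw [hTilde, map_sub, finSuccEquiv_rename_succ, map_mul, finSuccEquiv_C, map_pow,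
    finSuccEquiv_X_zero, map_zero] at h2
  have h3 := congrArg (fun f => Polynomial.coeff f 0) h2
  simp only [Polynomial.coeff_sub, Polynomial.coeff_C_zero, Polynomial.coeff_C_mul,
    Polynomial.coeff_X_pow, hd.ne, if_false, mul_zero, sub_zero, Polynomial.coeff_zero] at h3
  exact h0 h3

end Lift

/-! ### Freeness and augmentation of the Spencer complex -/

section Free

variable {A R : Type} [CommRing A] [Ring R] [Module A R] [IsScalarTower A R R]

/-- By the Leibniz rule, [x, c y] differs from c [x, y] by [x, c] y, and the anchor condition makes
[x, c] a function. So closure need only be checked on generators. -/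
theorem isLieRinehart_span {S : Set R}
    (hlie : ∀ x ∈ S, ∀ y ∈ S, ⁅x, y⁆ ∈ Submodule.span A S)
    (hanchor : ∀ x ∈ S, ∀ a : A, ∃ b : A, ⁅x, a • (1 : R)⁆ = b • (1 : R)) :
    IsLieRinehart (Submodule.span A S) := by
  have ha : ∀ (a : A) (x : R), a • x = (a • (1 : R)) * x := fun a x => by
    rw [smul_mul_assoc, one_mul]
  have h0 : ∀ x : R, ⁅(0 : R), x⁆ = 0 := fun x => by
    rw [Ring.lie_def, zero_mul, mul_zero, sub_zero]
  have h0' : ∀ x : R, ⁅x, (0 : R)⁆ = 0 := fun x => by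
    rw [Ring.lie_def, zero_mul, mul_zero, sub_zero]
  have hadd : ∀ x y z : R, ⁅x + y, z⁆ = ⁅x, z⁆ + ⁅y, z⁆ := fun x y z => by
    simp only [Ring.lie_def, add_mul, mul_add]
    abel
  have hadd' : ∀ x y z : R, ⁅x, y + z⁆ = ⁅x, y⁆ + ⁅x, z⁆ := fun x y z => by
    simp only [Ring.lie_def, add_mul, mul_add]
    abel
  have hanchor' : ∀ x ∈ Submodule.span A S, ∀ a : A, ∃ b : A, ⁅x, a • (1 : R)⁆ = b • (1 : R) := by
    intro x hx a
    induction hx using Submodule.span_induction with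
    | mem x hx => exact hanchor x hx a
    | zero => exact ⟨0, by rw [h0, zero_smul]⟩
    | add x y _ _ hx hy =>
      obtain ⟨b, hb⟩ := hx
      obtain ⟨b', hb'⟩ := hy
      exact ⟨b + b', by rw [hadd, hb, hb', add_smul]⟩
    | smul c x _ hx =>
      obtain ⟨b, hb⟩ := hx
      refine ⟨c * b, ?_⟩
      have h1 : (a • (1 : R)) * (c • (1 : R)) = (c • (1 : R)) * (a • (1 : R)) := by
        rw [← ha, ← ha, smul_comm]
      rw [mul_smul, ← hb, Ring.lie_def, Ring.lie_def, ha c x, ha c (_ - _), mul_sub, mul_assoc,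
        ← mul_assoc (a • (1 : R)), h1, mul_assoc]
  refine ⟨fun x hx y hy => ?_, hanchor'⟩
  have key : ∀ x ∈ S, ∀ y ∈ Submodule.span A S, ⁅x, y⁆ ∈ Submodule.span A S := by
    intro x hx y hy
    induction hy using Submodule.span_induction with
    | mem y hy => exact hlie x hx y hy
    | zero => rw [h0']; exact zero_mem _
    | add y z _ _ hy hz => rw [hadd']; exact add_mem hy hz
    | smul c y hy' hy =>
      obtain ⟨b, hb⟩ := hanchor x hx c
      have h1 : ⁅x, c • y⁆ = c • ⁅x, y⁆ + b • y := by
        rw [ha b, ← hb, ha c y, ha c ⁅x, y⁆, Ring.lie_def, Ring.lie_def, Ring.lie_def]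
        noncomm_ring
      rw [h1]
      exact add_mem (Submodule.smul_mem _ _ hy) (Submodule.smul_mem _ _ hy')
  induction hx using Submodule.span_induction with
  | mem x hx => exact key x hx y hy
  | zero => rw [h0]; exact zero_mem _
  | add x z _ _ hx hz => rw [hadd]; exact add_mem hx hz
  | smul c x hx' hx =>
    obtain ⟨b, hb⟩ := hanchor' y hy c
    have h1 : ⁅c • x, y⁆ = c • ⁅x, y⁆ - b • x := by
      rw [ha b, ← hb, ha c x, ha c ⁅x, y⁆, Ring.lie_def, Ring.lie_def, Ring.lie_def]
      noncomm_ring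
    rw [h1]
    exact sub_mem (Submodule.smul_mem _ _ hx) (Submodule.smul_mem _ _ hx')

/-- The coordinate function of `R ⊗_A M` that belongs to an element of a basis of `M`. -/
def tensorCoord {M I : Type} [AddCommGroup M] [Module A M] (b : Module.Basis I A M) (i : I) :
    RightMod A R ⊗[A] M →ₗ[A] RightMod A R :=
  (TensorProduct.rid A (RightMod A R)).toLinearMap ∘ₗ (b.coord i).lTensor (RightMod A R)

theorem tensorCoord_tmul {M I : Type} [AddCommGroup M] [Module A M] (b : Module.Basis I A M)
    (i : I) (P : RightMod A R) (x : M) : tensorCoord b i (P ⊗ₜ[A] x) = b.coord i x • P := by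
  rw [tensorCoord, LinearMap.comp_apply, LinearMap.lTensor_tmul]
  exact TensorProduct.rid_tmul _ _

/-- If `M` is a free `A`-module, then `R ⊗_A M` is a free left `R`-module. -/
theorem free_rightMod_tensor {M I : Type} [AddCommGroup M] [Module A M]
    (b : Module.Basis I A M) : Module.Free R (RightMod A R ⊗[A] M) := by
  classical
  have hs : ∀ (P : R) (x : M), P • (toRight A R 1 ⊗ₜ[A] x) = toRight A R P ⊗ₜ[A] x := by
    intro P x
    rw [TensorProduct.smul_tmul', ← map_smul, smul_eq_mul, mul_one]
  refine Module.Free.of_basis (Module.Basis.mk (v := fun i => toRight A R 1 ⊗ₜ[A] b i) ?_ ?_)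
  · rw [linearIndependent_iff']
    intro t g hg i hi
    have h1 := congrArg (tensorCoord b i) hg
    rw [map_sum, map_zero, Finset.sum_eq_single i] at h1
    · rw [hs, tensorCoord_tmul, b.coord_apply, b.repr_self, Finsupp.single_eq_same, one_smul] at h1
      exact h1
    · intro j _ hj
      rw [hs, tensorCoord_tmul, b.coord_apply, b.repr_self, Finsupp.single_eq_of_ne hj.symm,
        zero_smul]
    · exact fun h => absurd hi h
  · rintro x -
    induction x using TensorProduct.induction_on with
    | zero => exact zero_mem _
    | add x y hx hy => exact add_mem hx hy
    | tmul P x =>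
      have h1 : ∀ P : RightMod A R, P ⊗ₜ[A] x ∈
          Submodule.span R (Set.range fun i => toRight A R 1 ⊗ₜ[A] b i) := by
        have hx : x ∈ Submodule.span A (Set.range b) := by
          rw [b.span_eq]
          trivial
        induction hx using Submodule.span_induction with
        | zero => intro P; rw [TensorProduct.tmul_zero]; exact zero_mem _
        | add x y _ _ hx hy => intro P; rw [TensorProduct.tmul_add]; exact add_mem (hx P) (hy P)
        | smul a x _ hx => intro P; rw [← TensorProduct.smul_tmul]; exact hx _
        | mem x hx =>
          obtain ⟨i, rfl⟩ := hx
          intro P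
          have h2 := hs ((toRight A R).symm P) (b i)
          rw [LinearEquiv.apply_symm_apply] at h2
          rw [← h2]
          exact Submodule.smul_mem _ _ (Submodule.subset_span ⟨i, rfl⟩)
      exact h1 P

theorem free_spencerTerm {L : Submodule A R} {M : ℕ} (b : Module.Basis (Fin M) A L) (e : ℕ) :
    Module.Free R (SpencerTerm L e) :=
  free_rightMod_tensor (b.exteriorPower e)

theorem exists_spencerTmul_eq {L : Submodule A R} (t : SpencerTerm L 0) (v : Fin 0 → L) :
    ∃ P : R, spencerTmul P v = t := by
  induction t using TensorProduct.induction_on with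
  | zero => exact ⟨0, by simp [spencerTmul]⟩
  | add x y hx hy =>
    obtain ⟨P, rfl⟩ := hx
    obtain ⟨P', rfl⟩ := hy
    exact ⟨P + P', spencerTmul_add P P' v⟩
  | tmul P ω =>
    have hω : ω ∈ Submodule.span A (Set.range (exteriorPower.ιMulti A 0 (M := L))) := by
      rw [exteriorPower.ιMulti_span]; trivial
    induction hω using Submodule.span_induction generalizing P with
    | mem x hx =>
      obtain ⟨w, rfl⟩ := hx
      rw [Subsingleton.elim w v]
      exact ⟨(toRight A R).symm P, by rw [spencerTmul, LinearEquiv.apply_symm_apply]⟩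
    | zero => exact ⟨0, by simp [spencerTmul]⟩
    | add x y _ _ hx hy =>
      obtain ⟨Q, hQ⟩ := hx P
      obtain ⟨Q', hQ'⟩ := hy P
      exact ⟨Q + Q', by rw [spencerTmul_add, hQ, hQ', TensorProduct.tmul_add]⟩
    | smul a x _ hx => rw [← TensorProduct.smul_tmul]; exact hx _

variable [Algebra ℂ R]

/-- The last differential is P ⊗ x ↦ P x, so its image is the left ideal generated by S; replacing S
by its A-span does not enlarge this ideal. -/
theorem exact_spencerAug {S : Set R} (hL : IsLieRinehart (Submodule.span A S)) :
    Function.Exact (spencerDiff hL 0)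
      (spencerAug (Submodule.span A S) (Submodule.span R S)) := by
  intro t
  constructor
  · obtain ⟨P, rfl⟩ := exists_spencerTmul_eq t Fin.elim0
    rw [spencerAug_apply, Submodule.mkQ_apply, Submodule.Quotient.mk_eq_zero]
    intro hP
    induction hP using Submodule.span_induction with
    | mem x hx =>
      refine ⟨spencerTmul 1 fun _ => ⟨x, Submodule.subset_span hx⟩, ?_⟩
      rw [spencerDiff_apply, spencerFormula, one_mul]
    | zero => exact ⟨0, by rw [map_zero]; simp [spencerTmul]⟩
    | add x y _ _ hx hy =>
      obtain ⟨u, hu⟩ := hx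
      obtain ⟨u', hu'⟩ := hy
      exact ⟨u + u', by rw [map_add, hu, hu', spencerTmul_add]⟩
    | smul Q x _ hx =>
      obtain ⟨u, hu⟩ := hx
      exact ⟨Q • u, by rw [map_smul, hu, smul_spencerTmul, smul_eq_mul]⟩
  · rintro ⟨u, rfl⟩
    have hS : ∀ x ∈ Submodule.span A S, x ∈ Submodule.span R S := by
      intro x hx
      induction hx using Submodule.span_induction with
      | mem x hx => exact Submodule.subset_span hx
      | zero => exact zero_mem _
      | add x y _ _ hx hy => exact add_mem hx hy
      | smul a x _ hx =>
        have : a • x = (a • (1 : R)) • x := by rw [smul_eq_mul, smul_mul_assoc, one_mul]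
        rw [this]
        exact Submodule.smul_mem _ _ hx
    have h0 : spencerAug (Submodule.span A S) (Submodule.span R S) ∘ₗ spencerDiff hL 0 = 0 := by
      refine spencerTerm_hom_ext fun P v => ?_
      rw [LinearMap.comp_apply, spencerDiff_apply, spencerFormula, spencerAug_apply,
        LinearMap.zero_apply, Submodule.mkQ_apply, Submodule.Quotient.mk_eq_zero]
      exact Submodule.smul_mem _ P (hS _ (v 0).2)
    exact LinearMap.congr_fun h0 u

theorem spencerAug_surjective (L : Submodule A R) (I : Submodule R R) :
    Function.Surjective (spencerAug L I) := by
  intro x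
  obtain ⟨P, rfl⟩ := I.mkQ_surjective x
  exact ⟨spencerTmul P Fin.elim0, spencerAug_apply L I P _⟩

end Free

/-! ### The generators on `ℂ × V` -/

section Generators

variable {m : ℕ}

local notation "𝔸" => MvPolynomial (Fin (m + 1)) ℂ
local notation "𝔸₁" => MvPolynomial (Fin (m + 2)) ℂ

variable {h : MvPolynomial (Fin (m + 1)) ℂ} {p : Fin (m + 1) → ℚ} {d : ℕ}
  {δ : Fin m → Derivation ℂ (MvPolynomial (Fin (m + 1)) ℂ) (MvPolynomial (Fin (m + 1)) ℂ)}
  {c β : ℂ}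

theorem symbolSeq_logBasis_of_lt {k : ℕ} (hk : k < m) :
    symbolSeq (logBasis δ p) k = symbol (δ ⟨k, hk⟩) := by
  rw [symbolSeq, dif_pos (by omega)]
  congr 1
  exact Fin.snoc_castSucc (α := fun _ => Derivation ℂ 𝔸 𝔸) (eulerDer p) δ ⟨k, hk⟩

theorem symbolSeq_logBasis_self : symbolSeq (logBasis δ p) m = symbol (eulerDer p) := by
  rw [symbolSeq, dif_pos (by omega)]
  congr 1
  exact Fin.snoc_last (α := fun _ => Derivation ℂ 𝔸 𝔸) (eulerDer p) δ

theorem symbolTilde_of_lt {k : ℕ} (hk : k < m) :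
    symbolTilde h p d δ c k = symbol (liftDer (δ ⟨k, hk⟩)) := dif_pos hk

theorem symbolTilde_self : symbolTilde h p d δ c m = C (hTilde h c d) := by
  rw [symbolTilde, dif_neg (lt_irrefl m), if_pos rfl]

theorem symbolTilde_of_gt {k : ℕ} (hk : m < k) :
    symbolTilde h p d δ c k = symbol (chiTilde p) := by
  rw [symbolTilde, dif_neg (by omega), if_neg (by omega)]

theorem symbolEquiv_symbolTilde (k : ℕ) : symbolEquiv (m + 1) (symbolTilde h p d δ c k) =
    extendedSeq (symbolSeq (logBasis δ p)) (C h) (C (C (-c))) d m k := by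
  rcases lt_trichotomy k m with hk | rfl | hk
  · rw [symbolTilde_of_lt hk, symbolEquiv_symbol_liftDer, extendedSeq, if_pos hk,
      symbolSeq_logBasis_of_lt hk]
  · rw [symbolTilde_self, symbolEquiv_C_hTilde, extendedSeq, if_neg (lt_irrefl _), if_pos rfl]
  · rw [symbolTilde_of_gt hk, symbolEquiv_symbol_chiTilde, extendedSeq, if_neg (by omega),
      if_neg (by omega), symbolSeq_logBasis_self]

/-- Only the symbols of the δ_i need to be regular on V. The field χ serves to complete the
coefficient matrix; on ℂ × V its symbol is controlled by the term w₀ ξ₀ alone. -/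
theorem regularSeq_symbolTilde (hd : 0 < d) (h0 : h ≠ 0)
    (h_indep : LinearIndependent 𝔸 (logBasis δ p))
    (h_span : Submodule.span 𝔸 (Set.range (logBasis δ p)) = logDer h)
    (hSK : StronglyKoszul h δ) (hc : c ≠ 0) :
    RegularSeq (symbolTilde h p d δ c) (m + 2) := by
  obtain ⟨b, hb⟩ := exists_isAdjugate h_indep h_span
  have hσ : ∀ k : Fin m, symbolSeq (logBasis δ p) k = symbol (δ k) := fun k =>
    symbolSeq_logBasis_of_lt k.2
  refine regularSeq_of_extendedSeq (symbolEquiv (m + 1)) symbolEquiv_symbolTilde hd ?_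
    (fun k hk => ?_) (injMod_C_of_stronglyKoszul h0 hSK hσ le_rfl)
  · exact ((isUnit_iff_ne_zero.2 (neg_ne_zero.2 hc)).map C).map C
  · exact injMod_symbolSeq hb h0 (by omega) (injMod_C_of_stronglyKoszul h0 hSK hσ hk.le)

/-- The position in `gens` of the operator with symbol `symbolTilde k`. -/
def genIndex (m k : ℕ) : Fin (m + 2) :=
  if hk : k < m then Fin.succ (Fin.castSucc ⟨k, hk⟩) else if k = m then 0 else Fin.last (m + 1)

variable (h p d δ c β) in
/-- The operators `δ₁, …, δₘ, h - c w₀ᵈ, χ + w₀ ∂₀ - d β`, in this order. -/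
def genOp (k : ℕ) : Weyl (m + 2) := gens h p d δ c β (genIndex m k)

theorem genOp_of_lt {k : ℕ} (hk : k < m) :
    genOp h p d δ c β k = opOfDer (liftDer (δ ⟨k, hk⟩)) := by
  rw [genOp, genIndex, dif_pos hk, gens, Fin.cons_succ, Fin.snoc_castSucc]

theorem genOp_self : genOp h p d δ c β m = opOfPoly (hTilde h c d) := by
  rw [genOp, genIndex, dif_neg (lt_irrefl m), if_pos rfl, gens, Fin.cons_zero]

theorem genOp_of_gt {k : ℕ} (hk : m < k) : genOp h p d δ c β k =
    opOfDer (chiTilde p) - algebraMap ℂ (Weyl (m + 2)) (d * β) := by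
  rw [genOp, genIndex, dif_neg (by omega), if_neg (by omega), gens, ← Fin.succ_last,
    Fin.cons_succ, Fin.snoc_last]

theorem genIndex_injOn {i j : ℕ} (hi : i < m + 2) (hj : j < m + 2)
    (hij : genIndex m i = genIndex m j) : i = j := by
  have h1 := congrArg Fin.val hij
  unfold genIndex at h1
  split_ifs at h1 <;> simp at h1 <;> omega

theorem sum_genIndex {T : Type} [AddCommMonoid T] (f : Fin (m + 2) → T) :
    ∑ k ∈ Finset.range (m + 2), f (genIndex m k) = ∑ i, f i := by
  rw [Finset.sum_range]
  refine Function.Bijective.sum_comp (e := fun k : Fin (m + 2) => genIndex m k) ?_ f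
  rw [← Finite.injective_iff_bijective]
  exact fun i j hij => Fin.ext (genIndex_injOn i.2 j.2 hij)

/-- The evaluation of differential operators at a polynomial. -/
def evalAt {N : ℕ} (f : MvPolynomial (Fin N) ℂ) :
    Weyl N →ₗ[MvPolynomial (Fin N) ℂ] MvPolynomial (Fin N) ℂ where
  toFun P := P.toEnd f
  map_add' P P' := Weyl.toEnd_add P P' f
  map_smul' a P := Weyl.toEnd_smul a P f

/-- A relation between operators is tested on polynomials: on 1 to separate the order-zero part, on
w₀ to isolate the last generator, and on the coordinates of V for the δ_i. -/
theorem linearIndependent_gens (hd : 0 < d) (h0 : h ≠ 0)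
    (h_indep : LinearIndependent 𝔸 (logBasis δ p))
    (h_span : Submodule.span 𝔸 (Set.range (logBasis δ p)) = logDer h) :
    LinearIndependent 𝔸₁ (gens h p d δ c β) := by
  obtain ⟨b, hb⟩ := exists_isAdjugate h_indep h_span
  rw [Fintype.linearIndependent_iff]
  intro g hg
  rw [Fin.sum_univ_succ, Fin.sum_univ_castSucc] at hg
  simp only [gens, Fin.cons_zero, Fin.cons_succ, Fin.snoc_castSucc, Fin.snoc_last] at hg
  have key : ∀ f : 𝔸₁, g 0 * (hTilde h c d * f) +
      (∑ i : Fin m, g i.castSucc.succ * liftDer (δ i) f +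
        g (Fin.last m).succ * (chiTilde p f - C (d * β) * f)) = 0 := by
    intro f
    have h1 := congrArg (evalAt f) hg
    rw [map_zero, map_add, map_add, map_sum, map_smul, map_smul, map_sub, ← opOfPoly_C] at h1
    simp only [map_smul] at h1
    exact h1
  have k0 := key 1
  simp only [Derivation.map_one_eq_zero, mul_zero, Finset.sum_const_zero, zero_add, mul_one,
    zero_sub] at k0
  -- Subtracting f times the relation at 1 removes both multiplication terms, that of h - c w₀^d and
  -- that of dβ.
  have key' : ∀ f : 𝔸₁, ∑ i : Fin m, g i.castSucc.succ * liftDer (δ i) f +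
      g (Fin.last m).succ * chiTilde p f = 0 := by
    intro f
    linear_combination key f - f * k0
  have hlast : g (Fin.last m).succ = 0 := by
    have h1 := key' (X 0)
    simp only [liftDer_X_zero, mul_zero, Finset.sum_const_zero, zero_add, chiTilde_X_zero] at h1
    exact (mul_eq_zero.1 h1).resolve_right (X_ne_zero 0)
  have hzero : g 0 = 0 := by
    rw [hlast, zero_mul, add_zero] at k0
    exact (mul_eq_zero.1 k0).resolve_right (hTilde_ne_zero h0 c hd)
  have hmid : ∀ k : Fin m, g k.castSucc.succ = 0 := by
    intro k
    have h1 : ∀ j, ∑ i : Fin m, g i.castSucc.succ * rename Fin.succ (δ i (X j)) = 0 := by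
      intro j
      have h2 := key' (X j.succ)
      rw [hlast, zero_mul, add_zero] at h2
      simpa only [liftDer_X_succ] using h2
    have h3 : ∀ i : Fin m, ∑ j, rename Fin.succ (δ i (X j)) *
        rename Fin.succ (b j k.castSucc) = if i = k then rename Fin.succ h else 0 := by
      intro i
      have h4 := congrArg (rename Fin.succ) (hb.right i.castSucc k.castSucc)
      simp only [logBasis, Fin.snoc_castSucc, map_sum, map_mul, Fin.castSucc_inj] at h4
      rw [h4]
      split_ifs
      · rfl
      · exact map_zero _
    -- Multiplying the relations by the k-th column of b inverts the coefficient matrix up to the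
    -- factor h.
    have h5 : g k.castSucc.succ * rename Fin.succ h = 0 := by
      calc g k.castSucc.succ * rename Fin.succ h
          = ∑ i : Fin m, g i.castSucc.succ * ∑ j, rename Fin.succ (δ i (X j)) *
              rename Fin.succ (b j k.castSucc) := by
            simp only [h3, mul_ite, mul_zero, Finset.sum_ite_eq', Finset.mem_univ, if_true]
        _ = ∑ j, (∑ i : Fin m, g i.castSucc.succ * rename Fin.succ (δ i (X j))) *
              rename Fin.succ (b j k.castSucc) := by
            simp only [Finset.mul_sum, Finset.sum_mul, mul_assoc]
            exact Finset.sum_comm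
        _ = 0 := by simp only [h1, zero_mul, Finset.sum_const_zero]
    refine (mul_eq_zero.1 h5).resolve_right fun h6 => h0 ?_
    exact rename_injective _ (Fin.succ_injective _) (h6.trans (map_zero _).symm)
  intro i
  refine Fin.cases hzero (fun i => ?_) i
  exact Fin.lastCases hlast hmid i

/-- The order of `genOp k`. -/
def genOrder (m k : ℕ) : ℕ := if k = m then 0 else 1

theorem lie_opOfDer_opOfPoly {N : ℕ}
    (η : Derivation ℂ (MvPolynomial (Fin N) ℂ) (MvPolynomial (Fin N) ℂ))
    (a : MvPolynomial (Fin N) ℂ) : ⁅opOfDer η, opOfPoly a⁆ = opOfPoly (η a) := by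
  rw [Ring.lie_def, opOfDer_mul_opOfPoly, add_sub_cancel_left]

theorem lie_sub_algebraMap {N : ℕ} (P Q : Weyl N) (e : ℂ) :
    ⁅P - algebraMap ℂ (Weyl N) e, Q⁆ = ⁅P, Q⁆ := by
  rw [Ring.lie_def, Ring.lie_def, sub_mul, mul_sub, Algebra.commutes e Q]
  abel

/-- `P` is a combination of those `genOp k` whose order is less than `l`. -/
def IsCombination (h : 𝔸) (p : Fin (m + 1) → ℚ) (d : ℕ) (δ : Fin m → Derivation ℂ 𝔸 𝔸) (c β : ℂ)
    (l : ℕ) (P : Weyl (m + 2)) : Prop :=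
  ∃ a : ℕ → 𝔸₁, P = ∑ k ∈ Finset.range (m + 2), a k • genOp h p d δ c β k ∧
    ∀ k < m + 2, a k ≠ 0 → genOrder m k + 1 ≤ l

theorem IsCombination.neg {l : ℕ} {P : Weyl (m + 2)} (hP : IsCombination h p d δ c β l P) :
    IsCombination h p d δ c β l (-P) := by
  obtain ⟨a, rfl, ha⟩ := hP
  refine ⟨-a, ?_, fun k hk hk' => ha k hk (neg_ne_zero.1 hk')⟩
  simp only [Pi.neg_apply, neg_smul, Finset.sum_neg_distrib]

theorem isCombination_zero (l : ℕ) : IsCombination h p d δ c β l 0 :=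
  ⟨0, by simp only [Pi.zero_apply, zero_smul, Finset.sum_const_zero],
    fun _ _ hk => absurd rfl hk⟩

theorem isCombination_opOfDer_liftDer (hd : 0 < d) (h0 : h ≠ 0)
    (h_qh : IsWeightedHomogeneous p h (d : ℚ)) (hδ : ∀ i, δ i h = 0)
    (h_span : Submodule.span 𝔸 (Set.range (logBasis δ p)) = logDer h)
    {η : Derivation ℂ 𝔸 𝔸} (hη : η h = 0) :
    IsCombination h p d δ c β 2 (opOfDer (liftDer η)) := by
  obtain ⟨a, rfl⟩ := exists_sum_eq_of_apply_eq_zero hd h0 h_qh hδ h_span hη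
  refine ⟨fun k => if hk : k < m then rename Fin.succ (a ⟨k, hk⟩) else 0, ?_, ?_⟩
  · beta_reduce
    rw [Finset.sum_range_succ, Finset.sum_range_succ, dif_neg (by omega), dif_neg (by omega),
      zero_smul, zero_smul, add_zero, add_zero, Finset.sum_range, liftDer_sum_smul]
    change opOfDerₗ _ = _
    rw [map_sum]
    refine Finset.sum_congr rfl fun i _ => ?_
    rw [dif_pos i.2, genOp_of_lt i.2, map_smul]
    rfl
  · intro k _ _
    unfold genOrder
    split_ifs <;> omega

/-- Brackets of fields come from brackets on V that annihilate h, hence lie in the span of the δ_i: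
order 1 against a sum of orders 2. The δ_i kill h - c w₀^d, and χ + w₀∂₀ - dβ brackets it to d times
itself: order 0 against 1. -/
theorem isCombination_lie (hd : 0 < d) (h0 : h ≠ 0)
    (h_qh : IsWeightedHomogeneous p h (d : ℚ)) (hδ : ∀ i, δ i h = 0)
    (h_span : Submodule.span 𝔸 (Set.range (logBasis δ p)) = logDer h) (i j : ℕ) :
    IsCombination h p d δ c β (genOrder m i + genOrder m j)
      ⁅genOp h p d δ c β i, genOp h p d δ c β j⁆ := by
  have hlt : ∀ k, k < m → genOrder m k = 1 := fun k hk => if_neg hk.ne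
  have hgt : ∀ k, m < k → genOrder m k = 1 := fun k hk => if_neg hk.ne'
  have hself : genOrder m m = 0 := if_pos rfl
  have symm : ∀ i j : ℕ, IsCombination h p d δ c β (genOrder m i + genOrder m j)
      ⁅genOp h p d δ c β i, genOp h p d δ c β j⁆ →
      IsCombination h p d δ c β (genOrder m j + genOrder m i)
      ⁅genOp h p d δ c β j, genOp h p d δ c β i⁆ := by
    intro i j hij
    rw [add_comm, Ring.lie_def, ← neg_sub]
    exact hij.neg
  have chi_delta : ∀ i j : ℕ, m < i → j < m →
      IsCombination h p d δ c β (genOrder m i + genOrder m j)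
        ⁅genOp h p d δ c β i, genOp h p d δ c β j⁆ := by
    intro i j hi hj
    rw [genOp_of_gt hi, genOp_of_lt hj, lie_sub_algebraMap, ← opOfDer_lie, lie_chiTilde_liftDer,
      hgt i hi, hlt j hj]
    exact isCombination_opOfDer_liftDer hd h0 h_qh hδ h_span (lie_logBasis_apply h_qh hδ _)
  have delta_h : ∀ i : ℕ, i < m → IsCombination h p d δ c β (genOrder m i + genOrder m m)
        ⁅genOp h p d δ c β i, genOp h p d δ c β m⁆ := by
    intro i hi
    rw [genOp_of_lt hi, genOp_self, lie_opOfDer_opOfPoly, liftDer_hTilde (hδ _),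
      ← smul_one_eq_opOfPoly, zero_smul]
    exact isCombination_zero _
  have chi_h : ∀ i : ℕ, m < i → IsCombination h p d δ c β (genOrder m i + genOrder m m)
        ⁅genOp h p d δ c β i, genOp h p d δ c β m⁆ := by
    intro i hi
    refine ⟨fun k => if k = m then C (d : ℂ) else 0, ?_, ?_⟩
    · beta_reduce
      rw [genOp_of_gt hi, genOp_self, lie_sub_algebraMap, lie_opOfDer_opOfPoly,
        chiTilde_hTilde h_qh, Finset.sum_eq_single m, if_pos rfl, genOp_self,
        opOfPoly_mul_opOfPoly, opOfPoly_mul]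
      · intro k _ hk
        rw [if_neg hk, zero_smul]
      · intro hm
        exact absurd (Finset.mem_range.2 (by omega)) hm
    · intro k _ hk
      have hkm : k = m := by
        by_contra hkm
        exact hk (if_neg hkm)
      rw [hkm, hself, hgt i hi]
  rcases lt_trichotomy i m with hi | rfl | hi
  · rcases lt_trichotomy j m with hj | rfl | hj
    · rw [genOp_of_lt hi, genOp_of_lt hj, ← opOfDer_lie, lie_liftDer, hlt i hi, hlt j hj]
      refine isCombination_opOfDer_liftDer hd h0 h_qh hδ h_span ?_
      rw [Derivation.commutator_apply, hδ, hδ, map_zero, map_zero, sub_zero]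
    · exact delta_h i hi
    · exact symm j i (chi_delta j i hj hi)
  · rcases lt_trichotomy j i with hj | rfl | hj
    · exact symm j i (delta_h j hj)
    · rw [Ring.lie_def, sub_self]
      exact isCombination_zero _
    · exact symm j i (chi_h j hj)
  · rcases lt_trichotomy j m with hj | rfl | hj
    · exact chi_delta i j hi hj
    · exact chi_h i hi
    · rw [genOp_of_gt hi, genOp_of_gt hj, Ring.lie_def, sub_self]
      exact isCombination_zero _

theorem exists_genIndex_eq (i : Fin (m + 2)) : ∃ k < m + 2, genIndex m k = i := by
  have h1 : Function.Surjective fun k : Fin (m + 2) => genIndex m k :=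
    Finite.injective_iff_surjective.1 fun i j hij => Fin.ext (genIndex_injOn i.2 j.2 hij)
  obtain ⟨k, hk⟩ := h1 i
  exact ⟨k, k.2, hk⟩

variable (h p d δ c β) in
/-- `genOp k` as an element of `lieGens`. -/
def genElt (k : ℕ) : lieGens h p d δ c β :=
  ⟨genOp h p d δ c β k, Submodule.subset_span ⟨_, rfl⟩⟩

theorem isLieRinehart_lieGens (hd : 0 < d) (h0 : h ≠ 0)
    (h_qh : IsWeightedHomogeneous p h (d : ℚ)) (hδ : ∀ i, δ i h = 0)
    (h_span : Submodule.span 𝔸 (Set.range (logBasis δ p)) = logDer h) :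
    IsLieRinehart (lieGens h p d δ c β) := by
  refine isLieRinehart_span ?_ ?_
  · rintro _ ⟨i, rfl⟩ _ ⟨j, rfl⟩
    obtain ⟨i, -, rfl⟩ := exists_genIndex_eq i
    obtain ⟨j, -, rfl⟩ := exists_genIndex_eq j
    obtain ⟨a, ha, -⟩ := isCombination_lie (c := c) (β := β) hd h0 h_qh hδ h_span i j
    change ⁅genOp h p d δ c β i, genOp h p d δ c β j⁆ ∈ _
    rw [ha]
    exact sum_mem fun k _ => Submodule.smul_mem _ _ (genElt h p d δ c β k).2
  · rintro _ ⟨i, rfl⟩ a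
    obtain ⟨k, -, rfl⟩ := exists_genIndex_eq i
    change ∃ b : 𝔸₁, ⁅genOp h p d δ c β k, a • (1 : Weyl (m + 2))⁆ = b • (1 : Weyl (m + 2))
    simp only [smul_one_eq_opOfPoly]
    rcases lt_trichotomy k m with hk | rfl | hk
    · exact ⟨_, by rw [genOp_of_lt hk, lie_opOfDer_opOfPoly]⟩
    · refine ⟨0, ?_⟩
      rw [genOp_self, Ring.lie_def, ← opOfPoly_mul_opOfPoly, ← opOfPoly_mul_opOfPoly, mul_comm,
        sub_self, ← smul_one_eq_opOfPoly, zero_smul]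
    · exact ⟨_, by rw [genOp_of_gt hk, lie_sub_algebraMap, lie_opOfDer_opOfPoly]⟩

theorem normalOp_mul_genOp (k : ℕ) (l : ℤ) {g : MvPolynomial (Fin (m + 2)) 𝔸₁}
    (hg : g ∈ degreeLt (Fin (m + 2)) 𝔸₁ (l + 1)) :
    ∃ z ∈ degreeLt (Fin (m + 2)) 𝔸₁ (l + genOrder m k),
      normalOp g * genOp h p d δ c β k - normalOp (symbolTilde h p d δ c k * g) = normalOp z := by
  rcases lt_trichotomy k m with hk | rfl | hk
  · rw [genOp_of_lt hk, symbolTilde_of_lt hk, genOrder, if_neg hk.ne]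
    exact normalOp_mul_opOfDer _ l hg
  · rw [genOp_self, symbolTilde_self, genOrder, if_pos rfl, Nat.cast_zero, add_zero]
    exact normalOp_mul_opOfPoly _ l g hg
  · rw [genOp_of_gt hk, symbolTilde_of_gt hk, genOrder, if_neg hk.ne', Nat.cast_one]
    obtain ⟨z, hz, hz'⟩ := normalOp_mul_opOfDer (chiTilde p) l hg
    -- The constant dβ has order 0, one less than χ + w₀∂₀, so its contribution joins the error term
    -- and β does not affect the symbol.
    refine ⟨z - C (C (d * β)) * g, sub_mem hz ?_, ?_⟩
    · simpa using mul_mem_degreeLt (isHomogeneous_C (Fin (m + 2)) (C (d * β))) hg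
    · rw [map_sub normalOp, ← hz', C_mul', map_smul, ← opOfPoly_mul, opOfPoly_C,
        Algebra.commutes, mul_sub]
      abel

theorem symbolTilde_isHomogeneous (k : ℕ) :
    (symbolTilde h p d δ c k).IsHomogeneous (genOrder m k) := by
  rcases lt_trichotomy k m with hk | rfl | hk
  · rw [symbolTilde_of_lt hk, genOrder, if_neg hk.ne]
    exact symbol_isHomogeneous _
  · rw [symbolTilde_self, genOrder, if_pos rfl]
    exact isHomogeneous_C _ _
  · rw [symbolTilde_of_gt hk, genOrder, if_neg hk.ne']
    exact symbol_isHomogeneous _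

theorem coe_sum_smul_genElt (a : ℕ → 𝔸₁) :
    ((∑ k ∈ Finset.range (m + 2), a k • genElt h p d δ c β k : lieGens h p d δ c β) :
      Weyl (m + 2)) = ∑ k ∈ Finset.range (m + 2), a k • genOp h p d δ c β k := by
  rw [Submodule.coe_sum]
  rfl

theorem isQuantization_genElt (hd : 0 < d) (h0 : h ≠ 0)
    (h_qh : IsWeightedHomogeneous p h (d : ℚ)) (hδ : ∀ i, δ i h = 0)
    (h_indep : LinearIndependent 𝔸 (logBasis δ p))
    (h_span : Submodule.span 𝔸 (Set.range (logBasis δ p)) = logDer h)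
    (hSK : StronglyKoszul h δ) (hc : c ≠ 0) (hL : IsLieRinehart (lieGens h p d δ c β)) :
    IsQuantization hL (degreeFiltration (Fin (m + 2)) 𝔸₁) normalOpEquiv (genElt h p d δ c β)
      (symbolTilde h p d δ c) (genOrder m) (m + 2) where
  mul_gen k _ l g hg := normalOp_mul_genOp k l hg
  mul_base a l g hg := normalOp_mul_base a l hg
  bracket i _ j _ := by
    obtain ⟨a, ha, ha'⟩ := isCombination_lie (c := c) (β := β) hd h0 h_qh hδ h_span i j
    refine ⟨a, Subtype.ext ?_, ha'⟩
    rw [coe_sum_smul_genElt, ← ha]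
    rfl
  span x := by
    obtain ⟨a, ha⟩ := (Submodule.mem_span_range_iff_exists_fun _).1 x.2
    refine ⟨fun k => a (genIndex m k), Subtype.ext ?_⟩
    rw [coe_sum_smul_genElt, ← ha]
    exact (sum_genIndex fun i => a i • gens h p d δ c β i).symm
  dual := by
    let b := Module.Basis.span
      (linearIndependent_gens (c := c) (β := β) hd h0 h_indep h_span)
    have hb : ∀ k, b (genIndex m k) = genElt h p d δ c β k := fun k =>
      Module.Basis.span_apply _ _
    refine ⟨fun k => b.coord (genIndex m k), fun i hi j hj => ?_⟩
    rw [← hb, b.coord_apply, b.repr_self, Finsupp.single_apply]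
    by_cases hij : i = j
    · rw [if_pos hij, if_pos (by rw [hij])]
    · rw [if_neg hij, if_neg fun h' => hij (genIndex_injOn hj hi h').symm]
  symbol_homogeneous k l x := degreeProj_mul (symbolTilde_isHomogeneous k) l x
  symbol_regular := regularSeq_symbolTilde hd h0 h_indep h_span hSK hc

end Generators

end SpencerRes

end

theorem mainTheorem10 (m : ℕ) (h : MvPolynomial (Fin (m + 1)) ℂ) (h_red : Squarefree h)
    (p : Fin (m + 1) → ℚ) (d : ℕ) (h_qh : MvPolynomial.IsWeightedHomogeneous p h (d : ℚ))
    (δ : Fin m → Derivation ℂ (MvPolynomial (Fin (m + 1)) ℂ) (MvPolynomial (Fin (m + 1)) ℂ))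
    (hδ : ∀ i, δ i h = 0)
    (h_indep : LinearIndependent (MvPolynomial (Fin (m + 1)) ℂ)
      (Fin.snoc δ (SpencerRes.eulerDer p) :
        Fin (m + 1) →
          Derivation ℂ (MvPolynomial (Fin (m + 1)) ℂ) (MvPolynomial (Fin (m + 1)) ℂ)))
    (h_span : Submodule.span (MvPolynomial (Fin (m + 1)) ℂ)
      (Set.range (Fin.snoc δ (SpencerRes.eulerDer p) :
        Fin (m + 1) →
          Derivation ℂ (MvPolynomial (Fin (m + 1)) ℂ) (MvPolynomial (Fin (m + 1)) ℂ))) =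
      SpencerRes.logDer h)
    (hSK : SpencerRes.StronglyKoszul h δ)
    (c : ℂ) (hc : c ≠ 0) (β : ℂ) :
    LinearIndependent (MvPolynomial (Fin (m + 2)) ℂ) (SpencerRes.gens h p d δ c β) ∧
    ∃ hL : SpencerRes.IsLieRinehart (SpencerRes.lieGens h p d δ c β),
      SpencerRes.IsFreeResolution (T := SpencerRes.SpencerTerm (SpencerRes.lieGens h p d δ c β))
        (SpencerRes.spencerDiff hL)
        (SpencerRes.spencerAug (SpencerRes.lieGens h p d δ c β)
          (SpencerRes.idealI h p d δ c β)) := by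
  have h0 : h ≠ 0 := h_red.ne_zero
  have hd : 0 < d := SpencerRes.degree_pos h0 h_qh hδ h_span hSK
  have hli := SpencerRes.linearIndependent_gens (c := c) (β := β) hd h0 h_indep h_span
  have hL := SpencerRes.isLieRinehart_lieGens (c := c) (β := β) hd h0 h_qh hδ h_span
  refine ⟨hli, hL, ?_⟩
  exact
    { free := SpencerRes.free_spencerTerm (Module.Basis.span hli)
      exact := fun e => (SpencerRes.isQuantization_genElt hd h0 h_qh hδ h_indep h_span hSK hc
        hL).exact_spencerDiff e
      exact_augmentation := SpencerRes.exact_spencerAug hL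
      surjective := SpencerRes.spencerAug_surjective _ _ }
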